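/- **Setting.** Let $n,m\ge 1$, $p+m>3$, $\tau\in(0,1)$, and let $(X_1,Y_1),\dots,(X_n,Y_n)$ be i.i.d. copies of a random vector $(X,Y)\in\mathbb R^p\times\mathbb R^m$; $\Pi$ is the law of $X$. For a matrix $A$, $\sigma_{\max}(A)$ and $\sigma_{\min}(A)$ are the largest and smallest singular values, $\|A\|_*$ the sum of the singular values, $\|A\|_{\rm F}$ the Frobenius norm, $A_{*j}$ the $j$-th column, and $\|S\|_{L_2(\Pi)}^2=m^{-1}\mathbb E\|S^\top X\|_2^2$ for $S\in\mathbb R^{p\times m}$. Write $a\vee b=\max(a,b)$ and $\rho_\tau(u)=u(\tau-\mathbf 1\{u\le 0\})$. **Assumptions.** 1. For some $\Gamma\in\mathbb R^{p\times m}$ of rank $r$, the conditional $\tau$-quantile of $Y_j$ given $X=x$ is $x^\top\Gamma_{*j}$ for $j=1,\dots,m$, and $Y_1,\dots,Y_m$ are conditionally independent given $X$. 2. $X$ has finite second moments, its covariance matrix $\Sigma_X$ satisfies $\sigma_{\min}(\Sigma_X)>0$, and with $\widehat\Sigma_X=n^{-1}\sum_i X_iX_i^\top$ and constants $c_1>0$,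 $c_2\ge 1$, $$\mathbb P\big[\sigma_{\min}(\widehat\Sigma_X)\ge c_1\sigma_{\min}(\Sigma_X),\ \sigma_{\max}(\widehat\Sigma_X)\le c_2\sigma_{\max}(\Sigma_X)\big]\ge 1-\gamma_n .$$ 3. Given $X=x$, each $Y_j$ has a differentiable density $f_j(\cdot\,|x)$ with $|\partial_y f_j(y|x)|\le\bar f'<\infty$ for all $y$ and $f_j(x^\top\Gamma_{*j}|x)\ge\underline f>0$. Let $P_1$, $P_2$ be the orthogonal projections onto the spans of the left, respectively right, singular vectors of $\Gamma$ with nonzero singular value, $\mathcal P^\perp_\Gamma(S)=(I-P_1)S(I-P_2)$, $\mathcal P_\Gamma(S)=S-\mathcal P^\perp_\Gamma(S)$, $\mathcal K=\{S:\|\mathcal P^\perp_\Gamma(S)\|_*\le 3\|\mathcal P_\Gamma(S)\|_*\}$, and $$\nu=\frac38\,\frac{\underline f}{\bar f'}\inf_{0\ne\Delta\in\mathcal K}\frac{\|\Delta\|_{L_2(\Pi)}^3}{m^{-1}\sum_{j=1}^m\mathbb E|X^\top\Delta_{*j}|^3}\in[0,\infty].$$ **Constants and estimator.** For $C'>0$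 put $C^*=4\sqrt{2(c_2/C')\log 8}$, $$C_\tau'=8\sqrt2\Big[\Big(\sqrt{\tfrac{2}{C'}}+\tfrac{2}{\sqrt{\tau\vee(1-\tau)}}\Big)\sqrt{c_2}\ \vee\ C^*\Big],\quad C_\tau''=4\sqrt2\,C_\tau',\quad \lambda=2\frac{C^*}{m}\sqrt{\sigma_{\max}(\Sigma_X)\{\tau\vee(1-\tau)\}}\sqrt{\frac{p+m}{n}},$$ and let $\widehat\Gamma$ be any minimizer over $S\in\mathbb R^{p\times m}$ of $(nm)^{-1}\sum_{i=1}^n\sum_{j=1}^m\rho_\tau(Y_{ij}-X_i^\top S_{*j})+\lambda\|S\|_*$. Let $R=\sqrt{\log(p+m)/n}+\sqrt{(p+m)/n}$. **Claim.** There is a universal constant $C'>0$, admissible in Hoeffding's inequality $$\mathbb P\Big(\Big|\sum_i a_iZ_i\Big|\ge t\Big)\le e\cdot\exp\Big(-\frac{C't^2}{K^2\|a\|_2^2}\Big)\qquad(t\ge0)$$ for independent centered sub-Gaussian $Z_i$ with $\sup_{q\ge1}q^{-1/2}(\mathbb E|Z_i|^q)^{1/q}\le K$, such that, in every situation as above in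 which the growth condition $$\frac{C_\tau'}{\underline f\sqrt m}\sqrt{\frac{\sigma_{\max}(\Sigma_X)}{\sigma_{\min}(\Sigma_X)}}\sqrt{\tau\vee(1-\tau)}\;R\,\sqrt r<\nu$$ holds, with probability at least $1-\gamma_n-9(p+m)^{-2}-3e^{-(p+m)\log 8}$ all three of the following bounds hold: $$\|\widehat\Gamma-\Gamma\|_{L_2(\Pi)}\le\frac{C_\tau'}{\underline f\sqrt m}\sqrt{\frac{\sigma_{\max}(\Sigma_X)}{\sigma_{\min}(\Sigma_X)}}\sqrt{\tau\vee(1-\tau)}\,\sqrt r\,R,$$ $$\|\widehat\Gamma-\Gamma\|_{\rm F}\le\frac{C_\tau'}{\underline f}\sqrt{\frac{\sigma_{\max}(\Sigma_X)}{\sigma_{\min}^2(\Sigma_X)}}\sqrt{\tau\vee(1-\tau)}\,\sqrt r\,R,$$ $$\|\widehat\Gamma-\Gamma\|_*\le\frac{C_\tau''}{\underline f}\sqrt{\frac{\sigma_{\max}(\Sigma_X)}{\sigma_{\min}^2(\Sigma_X)}}\sqrt{\tau\vee(1-\tau)}\;r\,R .$$ -/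

import Mathlib

open MeasureTheory ProbabilityTheory
open scoped ENNReal

noncomputable section

namespace MQR

/-! ### Matrices -/

/-- The `k`-th largest singular value of `A`, counted from `k = 0`. -/
def sv {p m : ℕ} (A : Matrix (Fin p) (Fin m) ℝ) (k : ℕ) : ℝ :=
  (Matrix.toEuclideanLin A).singularValues k

/-- Largest singular value. -/
def sigmaMax {p m : ℕ} (A : Matrix (Fin p) (Fin m) ℝ) : ℝ := sv A 0

/-- Smallest of the `min p m` singular values. -/
def sigmaMin {p m : ℕ} (A : Matrix (Fin p) (Fin m) ℝ) : ℝ := sv A (min p m - 1)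

/-- Nuclear norm: the sum of the `min p m` singular values. -/
def nuclearNorm {p m : ℕ} (A : Matrix (Fin p) (Fin m) ℝ) : ℝ :=
  ∑ k ∈ Finset.range (min p m), sv A k

/-- Frobenius norm. -/
def frobNorm {p m : ℕ} (A : Matrix (Fin p) (Fin m) ℝ) : ℝ :=
  √(∑ a, ∑ j, A a j ^ 2)

/-- Matrix of the orthogonal projection of `ℝ^p` onto the column space of `A`, that is, onto the
span of the left singular vectors of `A` that belong to nonzero singular values. -/
def colProj {p m : ℕ} (A : Matrix (Fin p) (Fin m) ℝ) : Matrix (Fin p) (Fin p) ℝ :=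
  Matrix.toEuclideanLin.symm
    ((LinearMap.range (Matrix.toEuclideanLin A)).starProjection :
      EuclideanSpace ℝ (Fin p) →ₗ[ℝ] EuclideanSpace ℝ (Fin p))

/-- `𝒫_A^⊥(S) = P₁^⊥ S P₂^⊥`, where `P₁`, `P₂` project onto the spans of the left and of the right
singular vectors of `A` (the latter span is the column space of `Aᵀ`). -/
def suppProjPerp {p m : ℕ} (A S : Matrix (Fin p) (Fin m) ℝ) : Matrix (Fin p) (Fin m) ℝ :=
  (1 - colProj A) * S * (1 - colProj A.transpose)

/-- `𝒫_A(S) = S - P₁^⊥ S P₂^⊥`. -/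
def suppProj {p m : ℕ} (A S : Matrix (Fin p) (Fin m) ℝ) : Matrix (Fin p) (Fin m) ℝ :=
  S - suppProjPerp A S

/-- The cone `𝒦(A; c₀)`. -/
def cone {p m : ℕ} (A : Matrix (Fin p) (Fin m) ℝ) (c₀ : ℝ) : Set (Matrix (Fin p) (Fin m) ℝ) :=
  {S | nuclearNorm (suppProjPerp A S) ≤ c₀ * nuclearNorm (suppProj A S)}

/-- The linear predictor `x ↦ xᵀ S_{*j}`. -/
def linPred {p m : ℕ} (S : Matrix (Fin p) (Fin m) ℝ) (j : Fin m) (x : Fin p → ℝ) : ℝ :=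
  ∑ a, x a * S a j

/-! ### Loss function and estimator -/

/-- The check function `ρ_τ(u) = u (τ - 1{u ≤ 0})`. -/
def rho (τ u : ℝ) : ℝ := u * (τ - if u ≤ 0 then 1 else 0)

/-- Empirical loss `(nm)⁻¹ ∑ᵢ ∑ⱼ ρ_τ(Y_ij - Xᵢᵀ S_{*j})`. -/
def empLoss {n p m : ℕ} (τ : ℝ) (x : Fin n → Fin p → ℝ) (y : Fin n → Fin m → ℝ)
    (S : Matrix (Fin p) (Fin m) ℝ) : ℝ :=
  ((n : ℝ) * m)⁻¹ * ∑ i, ∑ j, rho τ (y i j - linPred S j (x i))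

/-- `G` minimizes the empirical loss plus `lam` times the nuclear norm. -/
def IsEstimator {n p m : ℕ} (τ lam : ℝ) (x : Fin n → Fin p → ℝ) (y : Fin n → Fin m → ℝ)
    (G : Matrix (Fin p) (Fin m) ℝ) : Prop :=
  ∀ S : Matrix (Fin p) (Fin m) ℝ,
    empLoss τ x y G + lam * nuclearNorm G ≤ empLoss τ x y S + lam * nuclearNorm S

/-! ### Covariates -/

/-- Covariance matrix of a random vector with law `Π`. -/
def covMat {p : ℕ} (Pi : Measure (Fin p → ℝ)) : Matrix (Fin p) (Fin p) ℝ :=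
  Matrix.of fun a b => covariance (fun x : Fin p → ℝ => x a) (fun x => x b) Pi

/-- `n⁻¹ 𝐗ᵀ 𝐗`, where the rows of `𝐗` are the covariate vectors `x i`. -/
def sampleCov {n p : ℕ} (x : Fin n → Fin p → ℝ) : Matrix (Fin p) (Fin p) ℝ :=
  (n : ℝ)⁻¹ • ((Matrix.of x).transpose * Matrix.of x)

/-- `‖S‖_{L₂(Π)} = (m⁻¹ 𝔼 ‖Sᵀ X‖₂²)^{1/2}`. -/
def normL2 {p m : ℕ} (Pi : Measure (Fin p → ℝ)) (S : Matrix (Fin p) (Fin m) ℝ) : ℝ :=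
  √((m : ℝ)⁻¹ * ∫ x, ∑ j, linPred S j x ^ 2 ∂Pi)

/-- The restricted nonlinearity constant
`ν = (3/8) (f / f') inf_{0 ≠ Δ ∈ 𝒦(Γ, 3)} ‖Δ‖³_{L₂(Π)} / (m⁻¹ ∑ⱼ 𝔼 |Xᵀ Δ_{*j}|³)`,
a number in `[0, ∞]`. -/
def nonlinConst {p m : ℕ} (Pi : Measure (Fin p → ℝ)) (Γ : Matrix (Fin p) (Fin m) ℝ)
    (fLow fDer : ℝ) : ℝ≥0∞ :=
  ENNReal.ofReal (3 / 8 * (fLow / fDer)) *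
    ⨅ Δ ∈ {Δ : Matrix (Fin p) (Fin m) ℝ | Δ ∈ cone Γ 3 ∧ Δ ≠ 0},
      ENNReal.ofReal (normL2 Pi Δ) ^ 3 /
        ((m : ℝ≥0∞)⁻¹ * ∑ j, ∫⁻ x, ENNReal.ofReal (|linPred Δ j x| ^ 3) ∂Pi)

/-! ### Conditional distribution of the responses -/

/-- The conditional law of `Y_j` given `X = x`, when `(X, Y)` has law `P`. -/
def condLaw {p m : ℕ} (P : Measure ((Fin p → ℝ) × (Fin m → ℝ))) [IsFiniteMeasure P]
    (j : Fin m) (x : Fin p → ℝ) : Measure ℝ :=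
  (P.condKernel x).map fun y => y j

/-- The `τ`-quantile `F⁻¹(τ) = inf {y | τ ≤ F(y)}` of a probability measure on `ℝ`. -/
def quantile (Q : Measure ℝ) (τ : ℝ) : ℝ := sInf {y : ℝ | τ ≤ Q.real (Set.Iic y)}

/-- The conditional `τ`-quantile of `Y_j` given `X = x` is `xᵀ Γ_{*j}`. -/
def LinearQuantiles {p m : ℕ} (P : Measure ((Fin p → ℝ) × (Fin m → ℝ))) [IsFiniteMeasure P]
    (τ : ℝ) (Γ : Matrix (Fin p) (Fin m) ℝ) : Prop :=
  ∀ᵐ x ∂P.fst, ∀ j, quantile (condLaw P j x) τ = linPred Γ j x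

/-- Given `X = x`, the responses `Y_1, …, Y_m` are independent. -/
def CondIndepResponses {p m : ℕ} (P : Measure ((Fin p → ℝ) × (Fin m → ℝ)))
    [IsFiniteMeasure P] : Prop :=
  ∀ᵐ x ∂P.fst, P.condKernel x = Measure.pi fun j => condLaw P j x

/-- Given `X = x`, each `Y_j` has a differentiable density whose derivative is bounded by `fDer` in
absolute value and whose value at `xᵀ Γ_{*j}` is at least `fLow`. -/
def DensityCondition {p m : ℕ} (P : Measure ((Fin p → ℝ) × (Fin m → ℝ))) [IsFiniteMeasure P]
    (Γ : Matrix (Fin p) (Fin m) ℝ) (fLow fDer : ℝ) : Prop :=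
  ∀ᵐ x ∂P.fst, ∀ j, ∃ f : ℝ → ℝ, (∀ y, 0 ≤ f y) ∧
    condLaw P j x = volume.withDensity (fun y => ENNReal.ofReal (f y)) ∧
    Differentiable ℝ f ∧ (∀ y, |deriv f y| ≤ fDer) ∧ fLow ≤ f (linPred Γ j x)

/-! ### Constants -/

/-- Sub-Gaussian norm `sup_{q ≥ 1} q^{-1/2} (𝔼 |Z|^q)^{1/q}`, in `[0, ∞]`. -/
def psi2Norm {Ω : Type} [MeasurableSpace Ω] (Z : Ω → ℝ) (μ : Measure Ω) : ℝ≥0∞ :=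
  ⨆ q : ℝ, ⨆ _ : 1 ≤ q, ENNReal.ofReal (√q)⁻¹ * eLpNorm Z (ENNReal.ofReal q) μ

/-- `C` is an admissible constant in Hoeffding's inequality for weighted sums of independent,
centered, sub-Gaussian random variables. -/
def IsHoeffdingConst (C : ℝ) : Prop :=
  ∀ (Ω : Type) (_ : MeasurableSpace Ω) (μ : Measure Ω) (_ : IsProbabilityMeasure μ)
    (N : ℕ) (Z : Fin N → Ω → ℝ) (K : ℝ) (a : Fin N → ℝ) (t : ℝ),
    (∀ i, Measurable (Z i)) → iIndepFun Z μ → (∀ i, ∫ ω, Z i ω ∂μ = 0) →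
    0 ≤ K → (∀ i, psi2Norm (Z i) μ ≤ ENNReal.ofReal K) → 0 ≤ t →
    μ.real {ω | t ≤ |∑ i, a i * Z i ω|} ≤
      Real.exp 1 * Real.exp (-(C * t ^ 2 / (K ^ 2 * ∑ i, a i ^ 2)))

/-- `C* = 4 √(2 (c₂ / C') log 8)`. -/
def CStar (C' c₂ : ℝ) : ℝ := 4 * √(2 * (c₂ / C') * Real.log 8)

/-- The penalty level
`λ = 2 (C* / m) √(σ_max(Σ) (τ ∨ (1 - τ))) √((p + m) / n)`. -/
def lam (C' c₂ τ : ℝ) (n p m : ℕ) (Sg : Matrix (Fin p) (Fin p) ℝ) : ℝ :=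
  2 * (CStar C' c₂ / m) * √(sigmaMax Sg * max τ (1 - τ)) * √(((p : ℝ) + m) / n)

/-- `C'_τ = 8√2 [ (√(2/C') + 2/√(τ ∨ (1-τ))) √c₂ ∨ C* ]`. -/
def CTau (C' c₂ τ : ℝ) : ℝ :=
  8 * √2 * max ((√(2 / C') + 2 / √(max τ (1 - τ))) * √c₂) (CStar C' c₂)

/-- `√(log (p + m) / n) + √((p + m) / n)`. -/
def rate (n p m : ℕ) : ℝ :=
  √(Real.log ((p : ℝ) + m) / n) + √(((p : ℝ) + m) / n)

end MQR

end

/-! Let Δ be the estimation error, κ = fLow/fDer, and t = `radius` the claimed L₂ bound. The scheme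
is that of penalized convex M-estimation: a dual-norm bound on the score puts Δ in the cone, and
curvature of the loss on the sphere of radius t keeps Δ inside the corresponding ball.

Cone. Duality between nuclear and operator norms (`exists_dual`, `frobInner_le`) yields
decomposability, `nuclearNorm_add_ge`. If λ/2 dominates the score, comparing the estimator with Γ
gives the cone condition. There `nuclearNorm_suppProj_le` bounds the penalty gain by λ√(2r) times
the Frobenius norm, hence by λKt on the sphere, with K = √2·√r·√(m/s) and s the smallest eigenvalue
of the covariance. By convexity (`IsEstimator.normL2_le`) it then suffices that the loss increment
on the sphere exceed λKt.

Curvature. Given the covariates, the expected increment of the check loss at displacement d is at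
least fLow·`hub κ d`, a quadratic minus a cubic, frozen at its maximum (`hub_le_excess`). Freezing
makes the summands bounded and nonnegative, so their averages concentrate from below on an L₂ net,
while the upper bound on the sample covariance controls the step off the net
(`exists_covariate_event`). This needs third moments of every linear functional. They come from ν:
the cone contains a·wᵀ for all a and a suitable w, so the growth condition t < ν forces E|Xᵀa|³ ≤
(8/9)κ/(√m·t) when E(Xᵀa)² = 1 (`third_moment_le`).

Deviations. Both the score and the centred loss are Lipschitz functions of the linear predictors,
summed over responses that are independent given the covariates. Symmetrization and contraction are
carried out for exponential moments of finite maxima, one coordinate at a time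
(`lintegral_expSup_le`, `lintegral_expSup_pi_le`). The resulting Rademacher process is linear, so
over a nuclear ball it is bounded by an operator norm, which is controlled by nets of two spheres.

Constants. Every C' ≤ 1/56 is admissible in Hoeffding's inequality, so C' may be taken tiny. This
enlarges C*, and with it λ and t, enough to pay for all numerical losses. Three exceptional events
remain, each of probability at most 8^{-(p+m)}: score, covariates, loss deviations. -/

noncomputable section

namespace MQR

open scoped RealInnerProductSpace

/-! ### Nuclear norm -/

section NuclearNorm

variable {p m : ℕ}

/-- Frobenius inner product of matrices. -/
def frobInner (W A : Matrix (Fin p) (Fin m) ℝ) : ℝ := ∑ a, ∑ j, W a j * A a j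

/-- The operator norm of `W` is at most `c`. -/
def OpBound (W : Matrix (Fin p) (Fin m) ℝ) (c : ℝ) : Prop :=
  ∀ (a : EuclideanSpace ℝ (Fin p)) (b : EuclideanSpace ℝ (Fin m)),
    ⟪a, Matrix.toEuclideanLin W b⟫ ≤ c * (‖a‖ * ‖b‖)

lemma toEuclideanLin_apply_apply (A : Matrix (Fin p) (Fin m) ℝ) (b : EuclideanSpace ℝ (Fin m))
    (a : Fin p) : Matrix.toEuclideanLin A b a = ∑ j, A a j * b j := by
  simp [Matrix.toLpLin_apply, Matrix.mulVec, dotProduct]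

lemma inner_toEuclideanLin (A : Matrix (Fin p) (Fin m) ℝ) (a : EuclideanSpace ℝ (Fin p))
    (b : EuclideanSpace ℝ (Fin m)) :
    ⟪a, Matrix.toEuclideanLin A b⟫ = ∑ i, ∑ j, a i * A i j * b j := by
  simp only [PiLp.inner_apply, toEuclideanLin_apply_apply, RCLike.inner_apply, conj_trivial,
    Finset.sum_mul]
  exact Finset.sum_congr rfl fun i _ => Finset.sum_congr rfl fun j _ => by ring

/-- Parseval applied to each pair of rows: the trace form may be computed in any orthonormal basis,
in particular in a basis of right singular vectors. -/
lemma frobInner_eq_sum_basis (W A : Matrix (Fin p) (Fin m) ℝ) {ι : Type*} [Fintype ι]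
    (v : OrthonormalBasis ι ℝ (EuclideanSpace ℝ (Fin m))) :
    frobInner W A = ∑ k, ⟪Matrix.toEuclideanLin W (v k), Matrix.toEuclideanLin A (v k)⟫ := by
  have key : ∀ a : Fin p, ∑ j, W a j * A a j =
      ∑ k, (Matrix.toEuclideanLin W (v k)) a * (Matrix.toEuclideanLin A (v k)) a := by
    intro a
    have h := v.sum_inner_mul_inner (WithLp.toLp 2 (W a)) (WithLp.toLp 2 (A a))
    have e1 : ⟪(WithLp.toLp 2 (W a) : EuclideanSpace ℝ (Fin m)), WithLp.toLp 2 (A a)⟫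
        = ∑ j, W a j * A a j := by
      simp [PiLp.inner_apply, mul_comm]
    rw [← e1, ← h]
    refine Finset.sum_congr rfl fun k _ => ?_
    rw [toEuclideanLin_apply_apply, toEuclideanLin_apply_apply]
    congr 1
    simp [PiLp.inner_apply, mul_comm]
  simp only [frobInner, key]
  rw [Finset.sum_comm]
  refine Finset.sum_congr rfl fun k _ => ?_
  simp [PiLp.inner_apply, mul_comm]

/-- Singular value decomposition, in terms of an orthonormal basis of right singular vectors. -/
lemma exists_svd (A : Matrix (Fin p) (Fin m) ℝ) :
    ∃ v : OrthonormalBasis (Fin m) ℝ (EuclideanSpace ℝ (Fin m)),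
      (∀ k, ‖Matrix.toEuclideanLin A (v k)‖ = sv A k) ∧
      (∀ k l, k ≠ l → ⟪Matrix.toEuclideanLin A (v k), Matrix.toEuclideanLin A (v l)⟫ = 0) := by
  set T := Matrix.toEuclideanLin A
  have hn : Module.finrank ℝ (EuclideanSpace ℝ (Fin m)) = m := by simp
  set v := T.isSymmetric_adjoint_comp_self.eigenvectorBasis hn
  -- The basis diagonalizes the composition of the adjoint with T, so images of distinct basis
  -- vectors are orthogonal and their norms are the singular values.
  have hin : ∀ k l, ⟪T (v k), T (v l)⟫ = T.singularValues l ^ 2 * ⟪v k, v l⟫ := by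
    intro k l
    rw [← LinearMap.adjoint_inner_right]
    have := T.isSymmetric_adjoint_comp_self.apply_eigenvectorBasis hn l
    rw [LinearMap.comp_apply] at this
    rw [this, inner_smul_right, T.sq_singularValues_fin hn]
    rfl
  refine ⟨v, fun k => ?_, fun k l hkl => ?_⟩
  · have h := hin k k
    rw [real_inner_self_eq_norm_sq, real_inner_self_eq_norm_sq, v.norm_eq_one] at h
    have h2 : ‖T (v k)‖ ^ 2 = T.singularValues k ^ 2 := by simpa using h
    exact (sq_eq_sq₀ (norm_nonneg _) (T.singularValues_nonneg _)).1 h2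
  · rw [hin, v.inner_eq_zero hkl, mul_zero]

lemma sv_nonneg (A : Matrix (Fin p) (Fin m) ℝ) (k : ℕ) : 0 ≤ sv A k :=
  LinearMap.singularValues_nonneg _ _

lemma finrank_range_toEuclideanLin (A : Matrix (Fin p) (Fin m) ℝ) :
    Module.finrank ℝ (LinearMap.range (Matrix.toEuclideanLin A)) = A.rank := by
  rw [Matrix.rank_eq_finrank_range_toLin A (EuclideanSpace.basisFun (Fin p) ℝ).toBasis
    (EuclideanSpace.basisFun (Fin m) ℝ).toBasis]
  rw [Matrix.toEuclideanLin_eq_toLin_orthonormal]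

lemma sv_eq_zero (A : Matrix (Fin p) (Fin m) ℝ) {k : ℕ} (hk : A.rank ≤ k) : sv A k = 0 := by
  rw [sv, LinearMap.singularValues_eq_zero_iff_le_finrank_range, finrank_range_toEuclideanLin]
  exact hk

/-- Singular values vanish from the rank on, so the sum can be cut at the rank (for Cauchy–Schwarz)
or extended to all m basis vectors (for Parseval). -/
lemma nuclearNorm_eq_sum_rank (A : Matrix (Fin p) (Fin m) ℝ) :
    nuclearNorm A = ∑ k ∈ Finset.range A.rank, sv A k := by
  have h : A.rank ≤ min p m := le_min A.rank_le_height A.rank_le_width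
  refine (Finset.sum_subset (Finset.range_subset_range.2 h) fun k _ hk => sv_eq_zero A ?_).symm
  simpa using hk

lemma nuclearNorm_eq_sum_fin (A : Matrix (Fin p) (Fin m) ℝ) :
    nuclearNorm A = ∑ k : Fin m, sv A k := by
  rw [nuclearNorm_eq_sum_rank, Fin.sum_univ_eq_sum_range (fun k => sv A k) m]
  refine Finset.sum_subset (Finset.range_subset_range.2 A.rank_le_width) fun k _ hk =>
    sv_eq_zero A ?_
  simpa using hk

lemma nuclearNorm_nonneg (A : Matrix (Fin p) (Fin m) ℝ) : 0 ≤ nuclearNorm A :=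
  Finset.sum_nonneg fun _ _ => sv_nonneg _ _

/-- One half of the duality of operator and nuclear norm: expanded in right singular vectors of A,
each term is at most c times the singular value. -/
lemma frobInner_le (W A : Matrix (Fin p) (Fin m) ℝ) {c : ℝ} (hW : OpBound W c) :
    frobInner W A ≤ c * nuclearNorm A := by
  obtain ⟨v, hv, -⟩ := exists_svd A
  rw [frobInner_eq_sum_basis W A v, nuclearNorm_eq_sum_fin, Finset.mul_sum]
  refine Finset.sum_le_sum fun k _ => ?_
  rw [real_inner_comm]
  simpa [hv] using hW (Matrix.toEuclideanLin A (v k)) (v k)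

/-- The other half: the maximizer is the partial isometry of the polar decomposition, sending each
right singular vector to its normalized image. For a zero singular value the convention 0⁻¹ = 0
sends the vector to zero, so the map stays a contraction. -/
lemma exists_dual (A : Matrix (Fin p) (Fin m) ℝ) :
    ∃ W : Matrix (Fin p) (Fin m) ℝ, OpBound W 1 ∧ frobInner W A = nuclearNorm A := by
  obtain ⟨v, hv, ho⟩ := exists_svd A
  set T := Matrix.toEuclideanLin A
  set u : Fin m → EuclideanSpace ℝ (Fin p) := fun k => (sv A k)⁻¹ • T (v k) with hu
  set L : EuclideanSpace ℝ (Fin m) →ₗ[ℝ] EuclideanSpace ℝ (Fin p) := v.toBasis.constr ℝ u with hL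
  have hLv : ∀ k, L (v k) = u k := fun k => by
    rw [hL, ← v.coe_toBasis]
    exact v.toBasis.constr_basis ℝ u k
  have huu : ∀ k, ‖u k‖ ≤ 1 := by
    intro k
    rw [hu, norm_smul, hv, norm_inv, Real.norm_of_nonneg (sv_nonneg _ _)]
    by_cases h : sv A k = 0
    · simp [h]
    · rw [inv_mul_cancel₀ h]
  have hor : ∀ k l, k ≠ l → ⟪u k, u l⟫ = 0 := by
    intro k l hkl
    simp [hu, inner_smul_left, inner_smul_right, ho k l hkl]
  have hnorm : ∀ b, ‖L b‖ ≤ ‖b‖ := by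
    intro b
    have hb : L b = ∑ k, ⟪v k, b⟫ • u k := by
      conv_lhs => rw [← v.sum_repr' b]
      simp [map_sum, hLv]
    have h2 : ‖L b‖ ^ 2 ≤ ‖b‖ ^ 2 := by
      rw [← v.sum_sq_norm_inner_right b, hb, ← real_inner_self_eq_norm_sq, sum_inner]
      refine Finset.sum_le_sum fun k _ => ?_
      rw [inner_sum, Finset.sum_eq_single k]
      · rw [inner_smul_left, inner_smul_right, real_inner_self_eq_norm_sq]
        simp only [conj_trivial, Real.norm_eq_abs, sq_abs]
        have : ‖u k‖ ^ 2 ≤ 1 := by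
          have := huu k
          have h0 := norm_nonneg (u k)
          nlinarith
        nlinarith [sq_nonneg ⟪v k, b⟫]
      · intro l _ hl
        rw [inner_smul_left, inner_smul_right, hor k l hl.symm]
        simp
      · simp
    exact le_of_sq_le_sq h2 (norm_nonneg _)
  refine ⟨Matrix.toEuclideanLin.symm L, ?_, ?_⟩
  · intro a b
    rw [LinearEquiv.apply_symm_apply, one_mul]
    exact (real_inner_le_norm _ _).trans (mul_le_mul_of_nonneg_left (hnorm b) (norm_nonneg _))
  · rw [frobInner_eq_sum_basis _ A v, nuclearNorm_eq_sum_fin]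
    refine Finset.sum_congr rfl fun k _ => ?_
    rw [LinearEquiv.apply_symm_apply, hLv, hu, inner_smul_left]
    change (starRingEnd ℝ) (sv A k)⁻¹ * ⟪T (v k), T (v k)⟫ = _
    rw [real_inner_self_eq_norm_sq, hv]
    by_cases h : sv A k = 0
    · simp [h]
    · simp only [conj_trivial]
      field_simp

lemma frobInner_add_right (W A B : Matrix (Fin p) (Fin m) ℝ) :
    frobInner W (A + B) = frobInner W A + frobInner W B := by
  simp [frobInner, mul_add, Finset.sum_add_distrib]

lemma frobInner_add_left (W V A : Matrix (Fin p) (Fin m) ℝ) :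
    frobInner (W + V) A = frobInner W A + frobInner V A := by
  simp [frobInner, add_mul, Finset.sum_add_distrib]

lemma frobInner_smul_right (W A : Matrix (Fin p) (Fin m) ℝ) (c : ℝ) :
    frobInner W (c • A) = c * frobInner W A := by
  simp only [frobInner, Finset.mul_sum, Matrix.smul_apply, smul_eq_mul]
  exact Finset.sum_congr rfl fun i _ => Finset.sum_congr rfl fun j _ => by ring

lemma frobInner_eq_trace (W A : Matrix (Fin p) (Fin m) ℝ) :
    frobInner W A = (W.transpose * A).trace := by
  simp only [frobInner, Matrix.trace, Matrix.mul_apply, Matrix.diag, Matrix.transpose_apply]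
  exact Finset.sum_comm

lemma frobInner_self (A : Matrix (Fin p) (Fin m) ℝ) : frobInner A A = frobNorm A ^ 2 := by
  rw [frobNorm, Real.sq_sqrt (by positivity)]
  simp [frobInner, sq]

lemma nuclearNorm_add_le (A B : Matrix (Fin p) (Fin m) ℝ) :
    nuclearNorm (A + B) ≤ nuclearNorm A + nuclearNorm B := by
  obtain ⟨W, hW, h⟩ := exists_dual (A + B)
  rw [← h, frobInner_add_right]
  have h1 := frobInner_le W A hW
  have h2 := frobInner_le W B hW
  linarith

lemma nuclearNorm_smul_le (A : Matrix (Fin p) (Fin m) ℝ) {c : ℝ} (hc : 0 ≤ c) :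
    nuclearNorm (c • A) ≤ c * nuclearNorm A := by
  obtain ⟨W, hW, h⟩ := exists_dual (c • A)
  rw [← h, frobInner_smul_right]
  have h1 := frobInner_le W A hW
  rw [one_mul] at h1
  exact mul_le_mul_of_nonneg_left h1 hc

lemma nuclearNorm_smul (A : Matrix (Fin p) (Fin m) ℝ) {c : ℝ} (hc : 0 ≤ c) :
    nuclearNorm (c • A) = c * nuclearNorm A := by
  refine le_antisymm (nuclearNorm_smul_le A hc) ?_
  obtain ⟨W, hW, h⟩ := exists_dual A
  have h1 := frobInner_le W (c • A) hW
  rw [frobInner_smul_right, h] at h1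
  linarith

lemma frobNorm_nonneg (A : Matrix (Fin p) (Fin m) ℝ) : 0 ≤ frobNorm A := Real.sqrt_nonneg _

lemma frobNorm_sq_eq_sum_sv (A : Matrix (Fin p) (Fin m) ℝ) :
    frobNorm A ^ 2 = ∑ k : Fin m, sv A k ^ 2 := by
  obtain ⟨v, hv, -⟩ := exists_svd A
  rw [← frobInner_self, frobInner_eq_sum_basis A A v]
  exact Finset.sum_congr rfl fun k _ => by rw [real_inner_self_eq_norm_sq, hv]

/-- Cauchy–Schwarz over the at most rank-many nonzero singular values. -/
lemma nuclearNorm_le_sqrt_rank_mul (A : Matrix (Fin p) (Fin m) ℝ) :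
    nuclearNorm A ≤ √A.rank * frobNorm A := by
  have h : nuclearNorm A ^ 2 ≤ A.rank * frobNorm A ^ 2 := by
    rw [frobNorm_sq_eq_sum_sv, nuclearNorm_eq_sum_rank,
      Fin.sum_univ_eq_sum_range (fun k => sv A k ^ 2) m]
    refine (sq_sum_le_card_mul_sum_sq).trans ?_
    rw [Finset.card_range]
    refine mul_le_mul_of_nonneg_left ?_ (Nat.cast_nonneg _)
    exact Finset.sum_le_sum_of_subset_of_nonneg (Finset.range_subset_range.2 A.rank_le_width)
      fun _ _ _ => sq_nonneg _
  refine le_of_sq_le_sq ?_ (mul_nonneg (Real.sqrt_nonneg _) (frobNorm_nonneg _))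
  rwa [mul_pow, Real.sq_sqrt (Nat.cast_nonneg _)]

lemma eq_zero_of_nuclearNorm_le_zero {A : Matrix (Fin p) (Fin m) ℝ} (h : nuclearNorm A ≤ 0) :
    A = 0 := by
  have h0 : ∀ k : Fin m, sv A k = 0 := by
    rw [nuclearNorm_eq_sum_fin] at h
    have := (Finset.sum_eq_zero_iff_of_nonneg fun (k : Fin m) _ => sv_nonneg A k).1
      (le_antisymm h (Finset.sum_nonneg fun k _ => sv_nonneg A k))
    exact fun k => this k (Finset.mem_univ _)
  have h1 := frobNorm_sq_eq_sum_sv A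
  simp only [h0] at h1
  have h2 : ∑ a, ∑ j, A a j ^ 2 = 0 := by
    rw [frobNorm, Real.sq_sqrt (by positivity)] at h1
    simpa using h1
  ext a j
  have h3 := (Finset.sum_eq_zero_iff_of_nonneg fun a _ =>
    Finset.sum_nonneg fun j _ => sq_nonneg (A a j)).1 h2 a (Finset.mem_univ _)
  have h4 := (Finset.sum_eq_zero_iff_of_nonneg fun j _ => sq_nonneg (A a j)).1 h3 j
    (Finset.mem_univ _)
  simpa using h4

end NuclearNorm

end MQR

end

noncomputable section

namespace MQR

open scoped RealInnerProductSpace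

/-! ### Support projections, decomposability and the cone -/

section Projections

variable {p m : ℕ}

/-- Matrix of an orthogonal projection. -/
def IsOrthProj (Q : Matrix (Fin p) (Fin p) ℝ) : Prop := Q.transpose = Q ∧ Q * Q = Q

lemma IsOrthProj.one_sub {Q : Matrix (Fin p) (Fin p) ℝ} (h : IsOrthProj Q) :
    IsOrthProj (1 - Q) := by
  refine ⟨by simp [h.1], ?_⟩
  rw [sub_mul, mul_sub, mul_sub, h.2]
  simp

lemma toEuclideanLin_mul_apply {q : ℕ} (A : Matrix (Fin p) (Fin q) ℝ) (B : Matrix (Fin q) (Fin m) ℝ)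
    (x : EuclideanSpace ℝ (Fin m)) :
    Matrix.toEuclideanLin (A * B) x = Matrix.toEuclideanLin A (Matrix.toEuclideanLin B x) := by
  simp [Matrix.toLpLin_apply, Matrix.mulVec_mulVec]

lemma inner_toEuclideanLin_transpose (A : Matrix (Fin p) (Fin m) ℝ) (a : EuclideanSpace ℝ (Fin p))
    (b : EuclideanSpace ℝ (Fin m)) :
    ⟪a, Matrix.toEuclideanLin A b⟫ = ⟪Matrix.toEuclideanLin A.transpose a, b⟫ := by
  rw [real_inner_comm (b : EuclideanSpace ℝ (Fin m)), inner_toEuclideanLin, inner_toEuclideanLin,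
    Finset.sum_comm]
  exact Finset.sum_congr rfl fun i _ => Finset.sum_congr rfl fun j _ => by
    rw [Matrix.transpose_apply]; ring

lemma IsOrthProj.norm_sq_add {Q : Matrix (Fin p) (Fin p) ℝ} (h : IsOrthProj Q)
    (a : EuclideanSpace ℝ (Fin p)) :
    ‖Matrix.toEuclideanLin Q a‖ ^ 2 + ‖Matrix.toEuclideanLin (1 - Q) a‖ ^ 2 = ‖a‖ ^ 2 := by
  have e : Matrix.toEuclideanLin (1 - Q) a = a - Matrix.toEuclideanLin Q a := by
    rw [map_sub, LinearMap.sub_apply]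
    congr 1
    simp
  have h1 : ⟪a, Matrix.toEuclideanLin Q a⟫ = ‖Matrix.toEuclideanLin Q a‖ ^ 2 := by
    conv_lhs => rw [← h.2, toEuclideanLin_mul_apply, inner_toEuclideanLin_transpose, h.1]
    exact real_inner_self_eq_norm_sq _
  rw [e, norm_sub_sq_real, h1]
  ring

lemma IsOrthProj.norm_le {Q : Matrix (Fin p) (Fin p) ℝ} (h : IsOrthProj Q)
    (a : EuclideanSpace ℝ (Fin p)) : ‖Matrix.toEuclideanLin Q a‖ ≤ ‖a‖ :=
  le_of_sq_le_sq (by have := h.norm_sq_add a; nlinarith [sq_nonneg ‖Matrix.toEuclideanLin (1 - Q) a‖])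
    (norm_nonneg _)

lemma toEuclideanLin_colProj (A : Matrix (Fin p) (Fin m) ℝ) (x : EuclideanSpace ℝ (Fin p)) :
    Matrix.toEuclideanLin (colProj A) x =
      (LinearMap.range (Matrix.toEuclideanLin A)).starProjection x := by
  rw [colProj, LinearEquiv.apply_symm_apply]
  rfl

lemma matrix_ext_toEuclideanLin {A B : Matrix (Fin p) (Fin m) ℝ}
    (h : ∀ x, Matrix.toEuclideanLin A x = Matrix.toEuclideanLin B x) : A = B :=
  Matrix.toEuclideanLin.injective (LinearMap.ext h)

lemma colProj_mul_self (A : Matrix (Fin p) (Fin m) ℝ) : colProj A * A = A := by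
  refine matrix_ext_toEuclideanLin fun x => ?_
  rw [toEuclideanLin_mul_apply, toEuclideanLin_colProj, Submodule.starProjection_eq_self_iff]
  exact LinearMap.mem_range_self _ _

lemma isOrthProj_colProj (A : Matrix (Fin p) (Fin m) ℝ) : IsOrthProj (colProj A) := by
  constructor
  · refine matrix_ext_toEuclideanLin fun x => ext_inner_right ℝ fun y => ?_
    rw [← inner_toEuclideanLin_transpose, toEuclideanLin_colProj, toEuclideanLin_colProj,
      Submodule.inner_starProjection_left_eq_right]
  · refine matrix_ext_toEuclideanLin fun x => ?_
    rw [toEuclideanLin_mul_apply, toEuclideanLin_colProj, toEuclideanLin_colProj,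
      Submodule.starProjection_eq_self_iff]
    exact Submodule.starProjection_apply_mem _ _

lemma rank_colProj (A : Matrix (Fin p) (Fin m) ℝ) : (colProj A).rank = A.rank := by
  rw [← finrank_range_toEuclideanLin, ← finrank_range_toEuclideanLin]
  suffices h : LinearMap.range (Matrix.toEuclideanLin (colProj A)) =
      LinearMap.range (Matrix.toEuclideanLin A) by rw [h]
  ext x
  constructor
  · rintro ⟨y, rfl⟩
    rw [toEuclideanLin_colProj]
    exact Submodule.starProjection_apply_mem _ _
  · intro hx
    exact ⟨x, by rw [toEuclideanLin_colProj, Submodule.starProjection_eq_self_iff]; exact hx⟩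

lemma mul_colProj_transpose (A : Matrix (Fin p) (Fin m) ℝ) : A * colProj A.transpose = A := by
  have h := congrArg Matrix.transpose (colProj_mul_self A.transpose)
  rwa [Matrix.transpose_mul, Matrix.transpose_transpose, (isOrthProj_colProj _).1] at h

lemma frobInner_mul_mul (Q : Matrix (Fin p) (Fin p) ℝ) (R : Matrix (Fin m) (Fin m) ℝ)
    (hQ : Q.transpose = Q) (hR : R.transpose = R) (W A : Matrix (Fin p) (Fin m) ℝ) :
    frobInner (Q * W * R) A = frobInner W (Q * A * R) := by
  rw [frobInner_eq_trace, frobInner_eq_trace, Matrix.transpose_mul, Matrix.transpose_mul, hQ, hR,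
    Matrix.mul_assoc, Matrix.trace_mul_comm]
  simp only [Matrix.mul_assoc]

/-- Two contractions placed in complementary diagonal blocks form a contraction: Pythagoras on both
sides, then Cauchy–Schwarz in the plane. This allows dual certificates of Γ and of the perpendicular
part to be glued. -/
lemma OpBound.add_compl {W V : Matrix (Fin p) (Fin m) ℝ} (hW : OpBound W 1) (hV : OpBound V 1)
    {Q : Matrix (Fin p) (Fin p) ℝ} {R : Matrix (Fin m) (Fin m) ℝ} (hQ : IsOrthProj Q)
    (hR : IsOrthProj R) : OpBound (Q * W * R + (1 - Q) * V * (1 - R)) 1 := by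
  intro a b
  rw [map_add, LinearMap.add_apply, inner_add_right]
  simp only [toEuclideanLin_mul_apply]
  rw [inner_toEuclideanLin_transpose Q, inner_toEuclideanLin_transpose (1 - Q), hQ.1, hQ.one_sub.1]
  have h1 := hW (Matrix.toEuclideanLin Q a) (Matrix.toEuclideanLin R b)
  have h2 := hV (Matrix.toEuclideanLin (1 - Q) a) (Matrix.toEuclideanLin (1 - R) b)
  have h3 := hQ.norm_sq_add a
  have h4 := hR.norm_sq_add b
  have n1 := norm_nonneg (Matrix.toEuclideanLin Q a)
  have n2 := norm_nonneg (Matrix.toEuclideanLin (1 - Q) a)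
  have n3 := norm_nonneg (Matrix.toEuclideanLin R b)
  have n4 := norm_nonneg (Matrix.toEuclideanLin (1 - R) b)
  generalize ‖Matrix.toEuclideanLin Q a‖ = x at *
  generalize ‖Matrix.toEuclideanLin (1 - Q) a‖ = y at *
  generalize ‖Matrix.toEuclideanLin R b‖ = z at *
  generalize ‖Matrix.toEuclideanLin (1 - R) b‖ = w at *
  have key : x * z + y * w ≤ ‖a‖ * ‖b‖ := by
    refine le_of_sq_le_sq ?_ (by positivity)
    rw [mul_pow, ← h3, ← h4]
    nlinarith [sq_nonneg (x * w - y * z)]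
  linarith

lemma OpBound.neg {W : Matrix (Fin p) (Fin m) ℝ} {c : ℝ} (hW : OpBound W c) : OpBound (-W) c := by
  intro a b
  have := hW (-a) b
  simpa using this

/-- Decomposability of the nuclear norm. -/
lemma nuclearNorm_add_ge (Γ Δ : Matrix (Fin p) (Fin m) ℝ) :
    nuclearNorm Γ + nuclearNorm (suppProjPerp Γ Δ) - nuclearNorm (suppProj Γ Δ) ≤
      nuclearNorm (Γ + Δ) := by
  obtain ⟨W, hW, hWΓ⟩ := exists_dual Γ
  obtain ⟨V, hV, hVΔ⟩ := exists_dual (suppProjPerp Γ Δ)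
  set Q := colProj Γ with hQdef
  set R := colProj Γ.transpose with hRdef
  have hQ : IsOrthProj Q := isOrthProj_colProj _
  have hR : IsOrthProj R := isOrthProj_colProj _
  have hQΓ : Q * Γ = Γ := colProj_mul_self Γ
  have hΓR : Γ * R = Γ := mul_colProj_transpose Γ
  -- The glued certificate attains the nuclear norms of Γ and of the perpendicular part of Δ
  -- simultaneously; on the remaining part it costs at most that part's nuclear norm.
  have hU := hW.add_compl hV hQ hR
  set U := Q * W * R + (1 - Q) * V * (1 - R)
  have e1 : frobInner U Γ = nuclearNorm Γ := by
    rw [frobInner_add_left, frobInner_mul_mul _ _ hQ.1 hR.1,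
      frobInner_mul_mul _ _ hQ.one_sub.1 hR.one_sub.1, hQΓ, hΓR, hWΓ, Matrix.sub_mul, hQΓ]
    simp [frobInner]
  have hP : suppProjPerp Γ Δ = (1 - Q) * Δ * (1 - R) := rfl
  have e2 : frobInner U (suppProjPerp Γ Δ) = nuclearNorm (suppProjPerp Γ Δ) := by
    rw [frobInner_add_left, frobInner_mul_mul _ _ hQ.1 hR.1,
      frobInner_mul_mul _ _ hQ.one_sub.1 hR.one_sub.1, ← hVΔ]
    have z1 : Q * suppProjPerp Γ Δ * R = 0 := by
      rw [hP, ← Matrix.mul_assoc, ← Matrix.mul_assoc, mul_sub Q, hQ.2]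
      simp
    have z2 : (1 - Q) * suppProjPerp Γ Δ * (1 - R) = suppProjPerp Γ Δ := by
      rw [hP, ← Matrix.mul_assoc, ← Matrix.mul_assoc, hQ.one_sub.2, Matrix.mul_assoc,
        hR.one_sub.2]
    rw [z1, z2]
    simp [frobInner]
  have e3 := frobInner_le (-U) (suppProj Γ Δ) hU.neg
  have e4 := frobInner_le U (Γ + Δ) hU
  have e5 : Γ + Δ = Γ + suppProjPerp Γ Δ + suppProj Γ Δ := by
    rw [suppProj]; abel
  have e6 : frobInner (-U) (suppProj Γ Δ) = - frobInner U (suppProj Γ Δ) := by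
    simp [frobInner]
  have e7 : frobInner U (Γ + Δ) = frobInner U Γ + frobInner U (suppProjPerp Γ Δ) +
      frobInner U (suppProj Γ Δ) := by
    conv_lhs => rw [e5]
    rw [frobInner_add_right, frobInner_add_right]
  linarith

/-- The perpendicular part is an orthogonal projection of Δ for the Frobenius form, so Pythagoras
applies to the splitting. -/
lemma frobNorm_suppProj_le (Γ Δ : Matrix (Fin p) (Fin m) ℝ) :
    frobNorm (suppProj Γ Δ) ≤ frobNorm Δ := by
  refine le_of_sq_le_sq ?_ (frobNorm_nonneg _)
  have hQ := (isOrthProj_colProj Γ).one_sub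
  have hR := (isOrthProj_colProj Γ.transpose).one_sub
  have h0 : suppProjPerp Γ (suppProj Γ Δ) = 0 := by
    unfold suppProj suppProjPerp
    generalize 1 - colProj Γ = Q at *
    generalize 1 - colProj Γ.transpose = R at *
    rw [Matrix.mul_sub, Matrix.sub_mul, ← Matrix.mul_assoc, ← Matrix.mul_assoc, hQ.2,
      Matrix.mul_assoc _ R R, hR.2, sub_self]
  have h1 : frobInner (suppProjPerp Γ Δ) (suppProj Γ Δ) = 0 := by
    have : frobInner (suppProjPerp Γ Δ) (suppProj Γ Δ) =
        frobInner Δ (suppProjPerp Γ (suppProj Γ Δ)) := frobInner_mul_mul _ _ hQ.1 hR.1 _ _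
    rw [this, h0]
    simp [frobInner]
  have h2 : Δ = suppProjPerp Γ Δ + suppProj Γ Δ := by rw [suppProj]; abel
  have h3 : frobInner (suppProj Γ Δ) (suppProjPerp Γ Δ) = 0 := by
    rw [← h1]
    simp [frobInner, mul_comm]
  have h4 : frobNorm Δ ^ 2 = frobNorm (suppProjPerp Γ Δ) ^ 2 + frobNorm (suppProj Γ Δ) ^ 2 := by
    rw [← frobInner_self]
    conv_lhs => rw [h2]
    rw [frobInner_add_left, frobInner_add_right, frobInner_add_right, h1, h3, frobInner_self,
      frobInner_self]
    ring
  nlinarith [sq_nonneg (frobNorm (suppProjPerp Γ Δ))]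

lemma matrix_rank_add_le (A B : Matrix (Fin p) (Fin m) ℝ) :
    (A + B).rank ≤ A.rank + B.rank := by
  simp only [Matrix.rank]
  refine (Submodule.finrank_mono ?_).trans (Submodule.finrank_add_le_finrank_add_finrank _ _)
  rintro _ ⟨x, rfl⟩
  rw [Matrix.mulVecLin_add, LinearMap.add_apply]
  exact Submodule.add_mem_sup ⟨x, rfl⟩ ⟨x, rfl⟩

/-- S − P₁^⊥SP₂^⊥ = P₁S + P₁^⊥SP₂, and each summand has a factor of rank at most that of Γ. -/
lemma rank_suppProj_le (Γ Δ : Matrix (Fin p) (Fin m) ℝ) :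
    (suppProj Γ Δ).rank ≤ 2 * Γ.rank := by
  have h : suppProj Γ Δ = colProj Γ * Δ + (1 - colProj Γ) * Δ * colProj Γ.transpose := by
    rw [suppProj, suppProjPerp, Matrix.mul_sub, Matrix.mul_one, Matrix.sub_mul,
      Matrix.one_mul]
    abel
  rw [h]
  refine (matrix_rank_add_le _ _).trans ?_
  have h1 := Matrix.rank_mul_le_left (colProj Γ) Δ
  have h2 := Matrix.rank_mul_le_right ((1 - colProj Γ) * Δ) (colProj Γ.transpose)
  rw [rank_colProj] at h1 h2
  rw [Matrix.rank_transpose] at h2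
  omega

lemma nuclearNorm_suppProj_le (Γ Δ : Matrix (Fin p) (Fin m) ℝ) :
    nuclearNorm (suppProj Γ Δ) ≤ √2 * √Γ.rank * frobNorm Δ := by
  refine (nuclearNorm_le_sqrt_rank_mul _).trans ?_
  refine mul_le_mul ?_ (frobNorm_suppProj_le Γ Δ) (frobNorm_nonneg _) (by positivity)
  rw [← Real.sqrt_mul (by norm_num)]
  exact Real.sqrt_le_sqrt (by exact_mod_cast rank_suppProj_le Γ Δ)

lemma nuclearNorm_le_of_mem_cone {Γ Δ : Matrix (Fin p) (Fin m) ℝ} (h : Δ ∈ cone Γ 3) :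
    nuclearNorm Δ ≤ 4 * nuclearNorm (suppProj Γ Δ) := by
  have h' : nuclearNorm (suppProjPerp Γ Δ) ≤ 3 * nuclearNorm (suppProj Γ Δ) := h
  have h1 := nuclearNorm_add_le (suppProjPerp Γ Δ) (suppProj Γ Δ)
  have h2 : suppProjPerp Γ Δ + suppProj Γ Δ = Δ := by rw [suppProj]; abel
  rw [h2] at h1
  linarith

lemma suppProjPerp_smul (Γ Δ : Matrix (Fin p) (Fin m) ℝ) (c : ℝ) :
    suppProjPerp Γ (c • Δ) = c • suppProjPerp Γ Δ := by
  simp [suppProjPerp]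

lemma suppProj_smul (Γ Δ : Matrix (Fin p) (Fin m) ℝ) (c : ℝ) :
    suppProj Γ (c • Δ) = c • suppProj Γ Δ := by
  simp [suppProj, suppProjPerp_smul, smul_sub]

lemma smul_mem_cone {Γ Δ : Matrix (Fin p) (Fin m) ℝ} {c₀ : ℝ} (h : Δ ∈ cone Γ c₀) {c : ℝ}
    (hc : 0 ≤ c) : c • Δ ∈ cone Γ c₀ := by
  have h' : nuclearNorm (suppProjPerp Γ Δ) ≤ c₀ * nuclearNorm (suppProj Γ Δ) := h
  change nuclearNorm (suppProjPerp Γ (c • Δ)) ≤ c₀ * nuclearNorm (suppProj Γ (c • Δ))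
  rw [suppProjPerp_smul, suppProj_smul, nuclearNorm_smul _ hc, nuclearNorm_smul _ hc]
  have := mul_le_mul_of_nonneg_left h' hc
  linarith

/-- If `Γ = 0`, the cone is trivial. -/
lemma eq_zero_of_mem_cone {Γ Δ : Matrix (Fin p) (Fin m) ℝ} (hΓ : Γ.rank = 0)
    (h : Δ ∈ cone Γ 3) : Δ = 0 := by
  refine eq_zero_of_nuclearNorm_le_zero ((nuclearNorm_le_of_mem_cone h).trans ?_)
  have := nuclearNorm_suppProj_le Γ Δ
  rw [hΓ] at this
  simp at this
  linarith

lemma opBound_vecMulVec (a : EuclideanSpace ℝ (Fin p)) (b : EuclideanSpace ℝ (Fin m)) :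
    OpBound (Matrix.vecMulVec (a : Fin p → ℝ) (b : Fin m → ℝ)) (‖a‖ * ‖b‖) := by
  intro x y
  have : ⟪x, Matrix.toEuclideanLin (Matrix.vecMulVec (a : Fin p → ℝ) (b : Fin m → ℝ)) y⟫ =
      ⟪x, a⟫ * ⟪b, y⟫ := by
    rw [inner_toEuclideanLin, PiLp.inner_apply, PiLp.inner_apply, Finset.sum_mul_sum]
    refine Finset.sum_congr rfl fun i _ => Finset.sum_congr rfl fun j _ => ?_
    simp [Matrix.vecMulVec_apply]
    ring
  rw [this]
  have h1 := abs_real_inner_le_norm x a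
  have h2 := abs_real_inner_le_norm b y
  calc ⟪x, a⟫ * ⟪b, y⟫ ≤ |⟪x, a⟫| * |⟪b, y⟫| := by rw [← abs_mul]; exact le_abs_self _
    _ ≤ (‖x‖ * ‖a‖) * (‖b‖ * ‖y‖) := mul_le_mul h1 h2 (abs_nonneg _) (by positivity)
    _ = _ := by ring

lemma frobInner_vecMulVec (W : Matrix (Fin p) (Fin m) ℝ) (a : EuclideanSpace ℝ (Fin p))
    (b : EuclideanSpace ℝ (Fin m)) :
    frobInner W (Matrix.vecMulVec (a : Fin p → ℝ) (b : Fin m → ℝ)) =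
      ⟪a, Matrix.toEuclideanLin W b⟫ := by
  rw [inner_toEuclideanLin, frobInner]
  refine Finset.sum_congr rfl fun i _ => Finset.sum_congr rfl fun j _ => ?_
  rw [Matrix.vecMulVec_apply]
  ring

lemma nuclearNorm_vecMulVec_le (a : EuclideanSpace ℝ (Fin p)) (b : EuclideanSpace ℝ (Fin m)) :
    nuclearNorm (Matrix.vecMulVec (a : Fin p → ℝ) (b : Fin m → ℝ)) ≤ ‖a‖ * ‖b‖ := by
  obtain ⟨W, hW, h⟩ := exists_dual (Matrix.vecMulVec (a : Fin p → ℝ) (b : Fin m → ℝ))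
  rw [← h, frobInner_vecMulVec]
  simpa using hW a b

lemma mul_vecMulVec_mul {Q : Matrix (Fin p) (Fin p) ℝ} {R : Matrix (Fin m) (Fin m) ℝ}
    (hR : R.transpose = R) (a : EuclideanSpace ℝ (Fin p)) (b : EuclideanSpace ℝ (Fin m)) :
    Q * Matrix.vecMulVec (a : Fin p → ℝ) (b : Fin m → ℝ) * R =
      Matrix.vecMulVec (Matrix.toEuclideanLin Q a : Fin p → ℝ)
        (Matrix.toEuclideanLin R b : Fin m → ℝ) := by
  rw [Matrix.mul_vecMulVec, Matrix.vecMulVec_mul]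
  congr 1
  conv_rhs => rw [← hR]
  ext j
  rw [toEuclideanLin_apply_apply]
  simp [Matrix.vecMul, dotProduct, mul_comm]

/-- Rank-one matrices `a wᵀ` belong to the cone as soon as `w` is close to the row space. -/
lemma vecMulVec_mem_cone (Γ : Matrix (Fin p) (Fin m) ℝ) (a : EuclideanSpace ℝ (Fin p))
    (w : EuclideanSpace ℝ (Fin m))
    (hw : ‖Matrix.toEuclideanLin (1 - colProj Γ.transpose) w‖ ≤
      3 * ‖Matrix.toEuclideanLin (colProj Γ.transpose) w‖) :
    Matrix.vecMulVec (a : Fin p → ℝ) (w : Fin m → ℝ) ∈ cone Γ 3 := by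
  set Q := colProj Γ
  set R := colProj Γ.transpose with hRdef
  have hQ : IsOrthProj Q := isOrthProj_colProj _
  have hR : IsOrthProj R := isOrthProj_colProj _
  set Δ := Matrix.vecMulVec (a : Fin p → ℝ) (w : Fin m → ℝ) with hΔ
  set b := Matrix.toEuclideanLin R w with hb
  change nuclearNorm (suppProjPerp Γ Δ) ≤ 3 * nuclearNorm (suppProj Γ Δ)
  have h1 : nuclearNorm (suppProjPerp Γ Δ) ≤ ‖a‖ * (3 * ‖b‖) := by
    have : suppProjPerp Γ Δ = (1 - Q) * Δ * (1 - R) := rfl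
    rw [this, hΔ, mul_vecMulVec_mul hR.one_sub.1]
    refine (nuclearNorm_vecMulVec_le _ _).trans ?_
    exact mul_le_mul (hQ.one_sub.norm_le a) hw (norm_nonneg _) (norm_nonneg _)
  -- Lower bound by testing against a·bᵀ, with b the row-space part of w: the perpendicular part
  -- annihilates b, and ⟨w, b⟩ = ‖b‖².
  have h2 : ‖a‖ * ‖b‖ * (‖a‖ * ‖b‖) ≤ ‖a‖ * ‖b‖ * nuclearNorm (suppProj Γ Δ) := by
    have hle := frobInner_le _ (suppProj Γ Δ) (opBound_vecMulVec a b)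
    have hRb : Matrix.toEuclideanLin R b = b := by
      rw [hb, ← toEuclideanLin_mul_apply, hR.2]
    have hRb' : Matrix.toEuclideanLin (1 - R) b = 0 := by
      rw [hb, ← toEuclideanLin_mul_apply, sub_mul, one_mul, hR.2]
      simp
    have hfi : frobInner (Matrix.vecMulVec (a : Fin p → ℝ) (b : Fin m → ℝ)) (suppProj Γ Δ) =
        (‖a‖ * ‖b‖) ^ 2 := by
      have hcomm : ∀ A B : Matrix (Fin p) (Fin m) ℝ, frobInner A B = frobInner B A := fun A B => by
        simp [frobInner, mul_comm]
      rw [hcomm, frobInner_vecMulVec, suppProj, map_sub, LinearMap.sub_apply, inner_sub_right]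
      have z : Matrix.toEuclideanLin (suppProjPerp Γ Δ) b = 0 := by
        have : suppProjPerp Γ Δ = (1 - Q) * Δ * (1 - R) := rfl
        rw [this, toEuclideanLin_mul_apply, hRb', map_zero]
      rw [z, inner_zero_right, sub_zero, ← frobInner_vecMulVec, hΔ, frobInner_vecMulVec]
      have : ⟪a, Matrix.toEuclideanLin (Matrix.vecMulVec (a : Fin p → ℝ) (w : Fin m → ℝ)) b⟫ =
          ⟪a, a⟫ * ⟪w, b⟫ := by
        rw [inner_toEuclideanLin, PiLp.inner_apply, PiLp.inner_apply, Finset.sum_mul_sum]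
        refine Finset.sum_congr rfl fun i _ => Finset.sum_congr rfl fun j _ => ?_
        simp [Matrix.vecMulVec_apply]
        ring
      rw [this, real_inner_self_eq_norm_sq]
      have hwb : ⟪w, b⟫ = ‖b‖ ^ 2 := by
        rw [← real_inner_self_eq_norm_sq]
        conv_lhs => rw [← hRb, inner_toEuclideanLin_transpose, hR.1]
      rw [hwb]
      ring
    rw [hfi] at hle
    linarith
  rcases (mul_nonneg (norm_nonneg a) (norm_nonneg b)).eq_or_lt with h0 | h0
  · have := nuclearNorm_nonneg (suppProj Γ Δ)
    linarith
  · have := le_of_mul_le_mul_left h2 h0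
    linarith

end Projections

end MQR

end

noncomputable section

namespace MQR

open scoped RealInnerProductSpace

/-! ### Extreme singular values of covariance matrices -/

section Spectral

variable {p m : ℕ}

lemma norm_toEuclideanLin_le (A : Matrix (Fin p) (Fin m) ℝ) (x : EuclideanSpace ℝ (Fin m)) :
    ‖Matrix.toEuclideanLin A x‖ ≤ sigmaMax A * ‖x‖ := by
  obtain ⟨v, hv, ho⟩ := exists_svd A
  set T := Matrix.toEuclideanLin A
  have hb : T x = ∑ k, ⟪v k, x⟫ • T (v k) := by
    conv_lhs => rw [← v.sum_repr' x]
    simp [map_sum]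
  have hs : ∀ k : Fin m, sv A k ≤ sigmaMax A := fun k =>
    LinearMap.singularValues_antitone _ (Nat.zero_le _)
  have h0 : 0 ≤ sigmaMax A := sv_nonneg _ _
  refine le_of_sq_le_sq ?_ (mul_nonneg h0 (norm_nonneg _))
  rw [mul_pow, ← v.sum_sq_norm_inner_right x, hb, ← real_inner_self_eq_norm_sq, sum_inner,
    Finset.mul_sum]
  refine Finset.sum_le_sum fun k _ => ?_
  rw [inner_sum, Finset.sum_eq_single k]
  · rw [inner_smul_left, inner_smul_right, real_inner_self_eq_norm_sq, hv]
    simp only [conj_trivial, Real.norm_eq_abs, sq_abs]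
    have : sv A k ^ 2 ≤ sigmaMax A ^ 2 := pow_le_pow_left₀ (sv_nonneg _ _) (hs k) 2
    nlinarith [sq_nonneg ⟪v k, x⟫]
  · intro l _ hl
    rw [inner_smul_left, inner_smul_right, ho k l hl.symm]
    simp
  · simp

lemma sigmaMin_mul_norm_le (A : Matrix (Fin p) (Fin p) ℝ) (x : EuclideanSpace ℝ (Fin p)) :
    sigmaMin A * ‖x‖ ≤ ‖Matrix.toEuclideanLin A x‖ := by
  obtain ⟨v, hv, ho⟩ := exists_svd A
  set T := Matrix.toEuclideanLin A
  have hb : T x = ∑ k, ⟪v k, x⟫ • T (v k) := by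
    conv_lhs => rw [← v.sum_repr' x]
    simp [map_sum]
  have hs : ∀ k : Fin p, sigmaMin A ≤ sv A k := fun k =>
    LinearMap.singularValues_antitone _ (by rw [min_self]; omega)
  have h0 : 0 ≤ sigmaMin A := sv_nonneg _ _
  refine le_of_sq_le_sq ?_ (norm_nonneg _)
  rw [mul_pow, ← v.sum_sq_norm_inner_right x, hb, ← real_inner_self_eq_norm_sq, sum_inner,
    Finset.mul_sum]
  refine Finset.sum_le_sum fun k _ => ?_
  rw [inner_sum, Finset.sum_eq_single k]
  · rw [inner_smul_left, inner_smul_right, real_inner_self_eq_norm_sq, hv]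
    simp only [conj_trivial, Real.norm_eq_abs, sq_abs]
    have : sigmaMin A ^ 2 ≤ sv A k ^ 2 := pow_le_pow_left₀ h0 (hs k) 2
    nlinarith [sq_nonneg ⟪v k, x⟫]
  · intro l _ hl
    rw [inner_smul_left, inner_smul_right, ho k l hl.symm]
    simp
  · simp

lemma sigmaMin_le_sigmaMax (A : Matrix (Fin p) (Fin m) ℝ) : sigmaMin A ≤ sigmaMax A :=
  LinearMap.singularValues_antitone _ (Nat.zero_le _)

/-- Lower bound for the quadratic form of a positive semidefinite matrix. -/
lemma sigmaMin_mul_sq_le {A : Matrix (Fin p) (Fin p) ℝ} (hA : A.transpose = A)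
    (hpos : ∀ x : EuclideanSpace ℝ (Fin p), 0 ≤ ⟪x, Matrix.toEuclideanLin A x⟫)
    (x : EuclideanSpace ℝ (Fin p)) :
    sigmaMin A * ‖x‖ ^ 2 ≤ ⟪x, Matrix.toEuclideanLin A x⟫ := by
  set T := Matrix.toEuclideanLin A with hT
  have hsym : T.IsSymmetric := fun a b => by
    rw [inner_toEuclideanLin_transpose, hA]
  have hn : Module.finrank ℝ (EuclideanSpace ℝ (Fin p)) = p := by simp
  set v := hsym.eigenvectorBasis hn
  have hv : ∀ k, T (v k) = hsym.eigenvalues hn k • v k := fun k =>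
    hsym.apply_eigenvectorBasis hn k
  have he0 : ∀ k, 0 ≤ hsym.eigenvalues hn k := fun k => by
    have := hpos (v k)
    rw [hv, inner_smul_right, real_inner_self_eq_norm_sq, v.norm_eq_one] at this
    simpa using this
  -- For a nonnegative symmetric map the norm of the image of a unit eigenvector is the eigenvalue
  -- itself, which links eigenvalues to the smallest singular value.
  have he : ∀ k, sigmaMin A ≤ hsym.eigenvalues hn k := fun k => by
    have := sigmaMin_mul_norm_le A (v k)
    rw [← hT, hv, norm_smul, v.norm_eq_one, Real.norm_of_nonneg (he0 k)] at this
    simpa using this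
  have hb : T x = ∑ k, (hsym.eigenvalues hn k * ⟪v k, x⟫) • v k := by
    conv_lhs => rw [← v.sum_repr' x]
    simp [map_sum, hv, smul_smul, mul_comm]
  rw [hb, inner_sum, ← v.sum_sq_norm_inner_right x, Finset.mul_sum]
  refine Finset.sum_le_sum fun k _ => ?_
  rw [inner_smul_right, real_inner_comm]
  simp only [Real.norm_eq_abs, sq_abs]
  nlinarith [he k, sq_nonneg ⟪v k, x⟫]

/-- The linear functional `x ↦ xᵀ a`. -/
def lin (a : EuclideanSpace ℝ (Fin p)) (x : Fin p → ℝ) : ℝ := ∑ i, x i * a i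

lemma sampleCov_quadForm {n : ℕ} (x : Fin n → Fin p → ℝ) (a : EuclideanSpace ℝ (Fin p)) :
    ⟪a, Matrix.toEuclideanLin (sampleCov x) a⟫ = (n : ℝ)⁻¹ * ∑ i, lin a (x i) ^ 2 := by
  rw [sampleCov, map_smul, LinearMap.smul_apply, inner_smul_right, toEuclideanLin_mul_apply,
    inner_toEuclideanLin_transpose, Matrix.transpose_transpose, PiLp.inner_apply]
  congr 1
  refine Finset.sum_congr rfl fun i _ => ?_
  rw [toEuclideanLin_apply_apply]
  simp [lin, sq]

lemma sum_lin_sq_le_of_sigmaMax {n : ℕ} (hn : 0 < n) (x : Fin n → Fin p → ℝ) {c : ℝ}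
    (h : sigmaMax (sampleCov x) ≤ c) (a : EuclideanSpace ℝ (Fin p)) :
    ∑ i, lin a (x i) ^ 2 ≤ n * (c * ‖a‖ ^ 2) := by
  have h1 := sampleCov_quadForm x a
  have h2 := real_inner_le_norm a (Matrix.toEuclideanLin (sampleCov x) a)
  have h3 := norm_toEuclideanLin_le (sampleCov x) a
  have hn' : (0 : ℝ) < n := by exact_mod_cast hn
  have h4 : (n : ℝ)⁻¹ * ∑ i, lin a (x i) ^ 2 ≤ c * ‖a‖ ^ 2 := by
    rw [← h1]
    calc _ ≤ ‖a‖ * (sigmaMax (sampleCov x) * ‖a‖) :=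
          h2.trans (mul_le_mul_of_nonneg_left h3 (norm_nonneg _))
      _ = sigmaMax (sampleCov x) * ‖a‖ ^ 2 := by ring
      _ ≤ _ := mul_le_mul_of_nonneg_right h (sq_nonneg _)
  rw [inv_mul_le_iff₀ hn'] at h4
  exact h4

/-- The second moment of a linear functional dominates the smallest eigenvalue of the
covariance matrix. -/
lemma sigmaMin_covMat_le (Pi : Measure (Fin p → ℝ)) [IsProbabilityMeasure Pi]
    (hX : ∀ a, MemLp (fun x : Fin p → ℝ => x a) 2 Pi) (a : EuclideanSpace ℝ (Fin p)) :
    sigmaMin (covMat Pi) * ‖a‖ ^ 2 ≤ ∫ x, lin a x ^ 2 ∂Pi := by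
  have hmem : MemLp (lin a) 2 Pi := by
    have : lin a = fun x => ∑ i, a i * x i := by
      ext x; simp [lin, mul_comm]
    rw [this]
    exact memLp_finsetSum _ fun i _ => (hX i).const_mul (a i)
  have hq : ∀ b : EuclideanSpace ℝ (Fin p),
      ⟪b, Matrix.toEuclideanLin (covMat Pi) b⟫ = variance (lin b) Pi := by
    intro b
    rw [inner_toEuclideanLin]
    have : lin b = fun x => ∑ i, b i * x i := by
      ext x; simp [lin, mul_comm]
    rw [this, ← covariance_self
      (Finset.aemeasurable_fun_sum _ fun i _ => ((hX i).aemeasurable.const_mul _)),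
      covariance_fun_sum_fun_sum (fun i => (hX i).const_mul (b i))
        (fun i => (hX i).const_mul (b i))]
    refine Finset.sum_congr rfl fun i _ => Finset.sum_congr rfl fun j _ => ?_
    rw [covariance_const_mul_left, covariance_const_mul_right]
    simp [covMat]
    ring
  have h1 := sigmaMin_mul_sq_le (A := covMat Pi)
    (by ext i j; simp [covMat, covariance_comm]) (fun b => by rw [hq]; exact variance_nonneg _ _) a
  rw [hq] at h1
  -- The covariates need not be centred: the covariance form is a variance, and dropping the squared
  -- mean only increases it.
  exact h1.trans (variance_le_expectation_sq hmem.aestronglyMeasurable)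

end Spectral

/-! ### Nets -/

section Nets

/-- Volumetric bound for separated subsets of the unit ball. -/
lemma card_le_of_separated_ball {E : Type*} [NormedAddCommGroup E] [NormedSpace ℝ E]
    [FiniteDimensional ℝ E] {ε : ℝ} (hε : 0 < ε) (s : Finset E) (hs : ∀ c ∈ s, ‖c‖ ≤ 1)
    (h : ∀ c ∈ s, ∀ d ∈ s, c ≠ d → ε ≤ ‖c - d‖) :
    (s.card : ℝ) ≤ (1 + 2 / ε) ^ Module.finrank ℝ E := by
  borelize E
  let μ : Measure E := Measure.addHaar
  let δ : ℝ := ε / 2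
  let ρ : ℝ := 1 + ε / 2
  have ρpos : 0 < ρ := by positivity
  set A := ⋃ c ∈ s, Metric.ball (c : E) δ with hA
  -- Balls of radius ε/2 about ε-separated points are disjoint and lie in the ball of radius 1 +
  -- ε/2; comparing volumes gives the count.
  have D : Set.Pairwise (s : Set E) (Function.onFun Disjoint fun c => Metric.ball (c : E) δ) := by
    rintro c hc d hd hcd
    apply Metric.ball_disjoint_ball
    rw [dist_eq_norm]
    convert h c hc d hd hcd
    simp [δ]
  have A_subset : A ⊆ Metric.ball (0 : E) ρ := by
    refine Set.iUnion₂_subset fun x hx => ?_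
    apply Metric.ball_subset_ball'
    calc δ + dist x 0 ≤ δ + 1 := by rw [dist_zero_right]; exact add_le_add le_rfl (hs x hx)
      _ = ρ := by simp [δ, ρ]; ring
  have I : (s.card : ℝ≥0∞) * ENNReal.ofReal (δ ^ Module.finrank ℝ E) * μ (Metric.ball 0 1) ≤
      ENNReal.ofReal (ρ ^ Module.finrank ℝ E) * μ (Metric.ball 0 1) :=
    calc (s.card : ℝ≥0∞) * ENNReal.ofReal (δ ^ Module.finrank ℝ E) * μ (Metric.ball 0 1) = μ A := by
          rw [hA, measure_biUnion_finset D fun c _ => measurableSet_ball]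
          have I : 0 < δ := by positivity
          simp only [μ.addHaar_ball_of_pos _ I, Finset.sum_const, nsmul_eq_mul, mul_assoc]
      _ ≤ μ (Metric.ball (0 : E) ρ) := measure_mono A_subset
      _ = ENNReal.ofReal (ρ ^ Module.finrank ℝ E) * μ (Metric.ball 0 1) := by
          simp only [μ.addHaar_ball_of_pos _ ρpos]
  have J : (s.card : ℝ≥0∞) * ENNReal.ofReal (δ ^ Module.finrank ℝ E) ≤
      ENNReal.ofReal (ρ ^ Module.finrank ℝ E) :=
    (ENNReal.mul_le_mul_iff_left (Metric.measure_ball_pos _ _ zero_lt_one).ne'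
      measure_ball_lt_top.ne).1 I
  have K : (s.card : ℝ) * δ ^ Module.finrank ℝ E ≤ ρ ^ Module.finrank ℝ E := by
    rw [← ENNReal.ofReal_natCast, ← ENNReal.ofReal_mul (by positivity)] at J
    exact (ENNReal.ofReal_le_ofReal_iff (by positivity)).1 J
  have e : 1 + 2 / ε = ρ / δ := by simp only [ρ, δ]; field_simp; ring
  rw [e, div_pow, le_div_iff₀ (by positivity)]
  exact K

/-- The unit sphere of a finite-dimensional normed space has an `ε`-net with at most
`(1 + 2 / ε) ^ d` points. -/
lemma exists_sphere_net (E : Type*) [NormedAddCommGroup E] [NormedSpace ℝ E]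
    [FiniteDimensional ℝ E] {ε : ℝ} (hε : 0 < ε) :
    ∃ s : Finset E, (∀ c ∈ s, ‖c‖ = 1) ∧ (∀ x : E, ‖x‖ = 1 → ∃ c ∈ s, ‖x - c‖ ≤ ε) ∧
      (s.card : ℝ) ≤ (1 + 2 / ε) ^ Module.finrank ℝ E := by
  classical
  -- Sizes of ε-separated subsets of the sphere. A separated set of maximal size is a net, since an
  -- uncovered point could be added.
  let S : Set ℕ := {k | ∃ s : Finset E, s.card = k ∧ (∀ c ∈ s, ‖c‖ = 1) ∧
    ∀ c ∈ s, ∀ d ∈ s, c ≠ d → ε ≤ ‖c - d‖}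
  have hne : S.Nonempty := ⟨0, ∅, by simp⟩
  have hbd : BddAbove S := by
    refine ⟨⌊(1 + 2 / ε) ^ Module.finrank ℝ E⌋₊, ?_⟩
    rintro _ ⟨s, rfl, h1, h2⟩
    exact Nat.le_floor (card_le_of_separated_ball hε s (fun c hc => (h1 c hc).le) h2)
  obtain ⟨s, hcard, h1, h2⟩ := Nat.sSup_mem hne hbd
  refine ⟨s, h1, fun x hx => ?_, card_le_of_separated_ball hε s (fun c hc => (h1 c hc).le) h2⟩
  by_contra hcon
  push Not at hcon
  have hxs : x ∉ s := fun hxs => by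
    have := hcon x hxs
    simp at this
    linarith
  have hmem : (insert x s).card ∈ S := by
    refine ⟨insert x s, rfl, ?_, ?_⟩
    · intro c hc
      rcases Finset.mem_insert.1 hc with rfl | hc
      · exact hx
      · exact h1 c hc
    · intro c hc d hd hcd
      rcases Finset.mem_insert.1 hc with hc' | hc' <;>
        rcases Finset.mem_insert.1 hd with hd' | hd'
      · exact absurd (hc'.trans hd'.symm) hcd
      · rw [hc']; exact (hcon d hd').le
      · rw [hd', norm_sub_rev]; exact (hcon c hc').le
      · exact h2 c hc' d hd' hcd
  have := le_csSup hbd hmem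
  rw [Finset.card_insert_of_notMem hxs] at this
  omega

end Nets

end MQR

end

noncomputable section

namespace MQR

/-! ### Hoeffding's inequality for sub-Gaussian variables -/

section Hoeffding

/-- The linear term disappears after centring, leaving only an exponential of the square. This
yields a moment generating function bound without a factor in front for small arguments. -/
lemma exp_le_add_exp_sq (x : ℝ) : Real.exp x ≤ x + Real.exp (x ^ 2) := by
  have h1 := Real.add_one_le_exp (x ^ 2)
  rcases le_or_gt |x| 1 with h | h
  · have := (abs_le.1 (Real.abs_exp_sub_one_sub_id_le h)).2
    linarith
  · rcases lt_abs.1 h with h | h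
    · have : Real.exp x ≤ Real.exp (x ^ 2) := Real.exp_le_exp.2 (by nlinarith)
      linarith
    · have : Real.exp x ≤ 1 := Real.exp_le_one_iff.2 (by linarith)
      nlinarith

variable {Ω : Type} [MeasurableSpace Ω] {μ : Measure Ω} {Z : Ω → ℝ} {K : ℝ}

lemma lintegral_pow_le_of_psi2Norm (hK : 0 ≤ K) (h : psi2Norm Z μ ≤ ENNReal.ofReal K)
    {k : ℕ} (hk : k ≠ 0) :
    ∫⁻ ω, ENNReal.ofReal (Z ω ^ (2 * k)) ∂μ ≤ ENNReal.ofReal ((2 * k * K ^ 2) ^ k) := by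
  set q : ℝ := 2 * k with hq
  have hk1 : (1 : ℝ) ≤ k := by exact_mod_cast Nat.one_le_iff_ne_zero.2 hk
  have hq1 : 1 ≤ q := by rw [hq]; linarith
  have hq0 : 0 < q := by linarith
  have h1 : ENNReal.ofReal (√q)⁻¹ * eLpNorm Z (ENNReal.ofReal q) μ ≤ ENNReal.ofReal K :=
    (le_iSup₂ (f := fun (q : ℝ) (_ : 1 ≤ q) =>
      ENNReal.ofReal (√q)⁻¹ * eLpNorm Z (ENNReal.ofReal q) μ) q hq1).trans h
  have hsq : 0 < √q := Real.sqrt_pos.2 hq0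
  have h2 : eLpNorm Z (ENNReal.ofReal q) μ ≤ ENNReal.ofReal (√q * K) := by
    rw [ENNReal.ofReal_mul hsq.le]
    calc eLpNorm Z (ENNReal.ofReal q) μ
        = ENNReal.ofReal (√q) * (ENNReal.ofReal (√q)⁻¹ * eLpNorm Z (ENNReal.ofReal q) μ) := by
          rw [← mul_assoc, ← ENNReal.ofReal_mul hsq.le, mul_inv_cancel₀ hsq.ne']; simp
      _ ≤ _ := by gcongr
  rw [eLpNorm_eq_lintegral_rpow_enorm_toReal (by simpa using hq0) ENNReal.ofReal_ne_top,
    ENNReal.toReal_ofReal hq0.le, one_div, ENNReal.rpow_inv_le_iff hq0] at h2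
  have h3 : ∀ ω, ‖Z ω‖ₑ ^ q = ENNReal.ofReal (Z ω ^ (2 * k)) := by
    intro ω
    rw [← ofReal_norm, ENNReal.ofReal_rpow_of_nonneg (norm_nonneg _) hq0.le]
    congr 1
    rw [hq, show (2 * (k : ℝ)) = ((2 * k : ℕ) : ℝ) by push_cast; ring, Real.rpow_natCast,
      pow_mul, pow_mul]
    simp
  simp only [h3] at h2
  refine h2.trans (le_of_eq ?_)
  rw [ENNReal.ofReal_rpow_of_nonneg (by positivity) hq0.le]
  congr 1
  rw [hq, show (2 * (k : ℝ)) = ((2 * k : ℕ) : ℝ) by push_cast; ring, Real.rpow_natCast,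
    pow_mul, mul_pow, Real.sq_sqrt (by positivity)]

/-- Term by term in the exponential series, the moment of order 2k contributes kᵏ/k! ≤ eᵏ, so the
series is dominated by a geometric one of ratio x ≤ 1/2; then 1/(1−x) ≤ 1 + 2x ≤ e^{2x}. -/
lemma lintegral_exp_sq_le (hZ : Measurable Z) [IsProbabilityMeasure μ] (hK : 0 ≤ K)
    (h : psi2Norm Z μ ≤ ENNReal.ofReal K) {c : ℝ} (hc : 0 ≤ c)
    (hcK : 4 * Real.exp 1 * c * K ^ 2 ≤ 1) :
    ∫⁻ ω, ENNReal.ofReal (Real.exp (c * Z ω ^ 2)) ∂μ ≤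
      ENNReal.ofReal (Real.exp (4 * Real.exp 1 * c * K ^ 2)) := by
  set x : ℝ := 2 * Real.exp 1 * c * K ^ 2 with hx
  have hx0 : 0 ≤ x := by positivity
  have hx1 : x ≤ 1 / 2 := by rw [hx]; linarith
  have e1 : ∀ ω, ENNReal.ofReal (Real.exp (c * Z ω ^ 2)) =
      ∑' k : ℕ, ENNReal.ofReal ((c * Z ω ^ 2) ^ k / k.factorial) := by
    intro ω
    rw [← ENNReal.ofReal_tsum_of_nonneg (fun k => by positivity)
      (Real.summable_pow_div_factorial _), Real.exp_eq_exp_ℝ, NormedSpace.exp_eq_tsum_div]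
  have e2 : ∀ k : ℕ, ∫⁻ ω, ENNReal.ofReal ((c * Z ω ^ 2) ^ k / k.factorial) ∂μ ≤
      ENNReal.ofReal (x ^ k) := by
    intro k
    rcases eq_or_ne k 0 with rfl | hk
    · simp
    have : ∀ ω, ENNReal.ofReal ((c * Z ω ^ 2) ^ k / k.factorial) =
        ENNReal.ofReal (c ^ k / k.factorial) * ENNReal.ofReal (Z ω ^ (2 * k)) := by
      intro ω
      rw [← ENNReal.ofReal_mul (by positivity), mul_pow, pow_mul]
      congr 1
      ring
    simp only [this]
    rw [lintegral_const_mul _ (by fun_prop)]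
    calc _ ≤ ENNReal.ofReal (c ^ k / k.factorial) * ENNReal.ofReal ((2 * k * K ^ 2) ^ k) := by
          gcongr
          exact lintegral_pow_le_of_psi2Norm hK h hk
      _ ≤ _ := by
          rw [← ENNReal.ofReal_mul (by positivity)]
          apply ENNReal.ofReal_le_ofReal
          have h1 : (k : ℝ) ^ k / k.factorial ≤ Real.exp 1 ^ k := by
            rw [← Real.exp_nat_mul, mul_one]
            exact Real.pow_div_factorial_le_exp (k : ℝ) (Nat.cast_nonneg _) k
          calc c ^ k / k.factorial * (2 * k * K ^ 2) ^ k
              = (2 * c * K ^ 2) ^ k * ((k : ℝ) ^ k / k.factorial) := by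
                simp only [mul_pow]; ring
            _ ≤ (2 * c * K ^ 2) ^ k * Real.exp 1 ^ k := by gcongr
            _ = x ^ k := by rw [← mul_pow, hx]; ring_nf
  simp only [e1]
  rw [lintegral_tsum (fun k => by fun_prop)]
  calc _ ≤ ∑' k : ℕ, ENNReal.ofReal (x ^ k) := ENNReal.tsum_le_tsum e2
    _ = ENNReal.ofReal ((1 - x)⁻¹) := by
        rw [← ENNReal.ofReal_tsum_of_nonneg (fun k => by positivity)
          (summable_geometric_of_lt_one hx0 (by linarith)),
          tsum_geometric_of_lt_one hx0 (by linarith)]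
    _ ≤ _ := by
        apply ENNReal.ofReal_le_ofReal
        have h2 : 4 * Real.exp 1 * c * K ^ 2 = 2 * x := by rw [hx]; ring
        rw [h2]
        have h3 := Real.add_one_le_exp (2 * x)
        refine le_trans ?_ h3
        rw [inv_le_iff_one_le_mul₀ (by linarith)]
        nlinarith

/-- For small s use e^x ≤ x + e^{x²} and centring. For large s complete the square; the constant
factor e then costs at most 4e·s²K². The exponents are 4e and 5e times K²s², both below 14K²s², half
the variance proxy times s². -/
lemma hasSubgaussianMGF_of_psi2Norm (hZ : Measurable Z) [IsProbabilityMeasure μ] (hK : 0 < K)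
    (h0 : ∫ ω, Z ω ∂μ = 0) (h : psi2Norm Z μ ≤ ENNReal.ofReal K) :
    HasSubgaussianMGF Z (Real.toNNReal (28 * K ^ 2)) μ := by
  have hintg : ∀ c : ℝ, 0 ≤ c → 4 * Real.exp 1 * c * K ^ 2 ≤ 1 →
      Integrable (fun ω => Real.exp (c * Z ω ^ 2)) μ ∧
        ∫ ω, Real.exp (c * Z ω ^ 2) ∂μ ≤ Real.exp (4 * Real.exp 1 * c * K ^ 2) := by
    intro c hc hcK
    have h1 := lintegral_exp_sq_le hZ hK.le h hc hcK
    have hi : Integrable (fun ω => Real.exp (c * Z ω ^ 2)) μ := by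
      refine ⟨by fun_prop, ?_⟩
      rw [hasFiniteIntegral_iff_ofReal (ae_of_all _ fun _ => (Real.exp_pos _).le)]
      exact h1.trans_lt ENNReal.ofReal_lt_top
    refine ⟨hi, ?_⟩
    rw [← ofReal_integral_eq_lintegral_ofReal hi (ae_of_all _ fun _ => (Real.exp_pos _).le)] at h1
    exact (ENNReal.ofReal_le_ofReal_iff (Real.exp_pos _).le).1 h1
  have hZint : Integrable Z μ := by
    have h1 : MemLp Z 1 μ := by
      refine ⟨hZ.aestronglyMeasurable, ?_⟩
      have := (le_iSup₂ (f := fun (q : ℝ) (_ : 1 ≤ q) =>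
        ENNReal.ofReal (√q)⁻¹ * eLpNorm Z (ENNReal.ofReal q) μ) 1 le_rfl).trans h
      simp only [Real.sqrt_one, inv_one, ENNReal.ofReal_one, one_mul] at this
      exact this.trans_lt ENNReal.ofReal_lt_top
    exact memLp_one_iff_integrable.1 h1
  have he1 := Real.exp_one_lt_d9
  have he0 := Real.exp_one_gt_d9
  have hK2 : 0 < K ^ 2 := by positivity
  have main : ∀ s : ℝ, Integrable (fun ω => Real.exp (s * Z ω)) μ ∧
      mgf Z μ s ≤ Real.exp (14 * K ^ 2 * s ^ 2) := by
    intro s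
    set c : ℝ := (4 * Real.exp 1 * K ^ 2)⁻¹ with hc
    have hcK : 4 * Real.exp 1 * c * K ^ 2 = 1 := by
      rw [hc]; field_simp
    have hc0 : 0 ≤ c := by positivity
    obtain ⟨hi, hle⟩ := hintg c hc0 hcK.le
    have hpt : ∀ ω, Real.exp (s * Z ω) ≤
        Real.exp (Real.exp 1 * K ^ 2 * s ^ 2) * Real.exp (c * Z ω ^ 2) := by
      intro ω
      rw [← Real.exp_add]
      apply Real.exp_le_exp.2
      have hd : 0 < Real.exp 1 * K ^ 2 := by positivity
      have : Real.exp 1 * K ^ 2 * s ^ 2 + c * Z ω ^ 2 - s * Z ω =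
          (2 * (Real.exp 1 * K ^ 2) * s - Z ω) ^ 2 * c := by
        rw [hc]; field_simp; ring
      have h2 : 0 ≤ (2 * (Real.exp 1 * K ^ 2) * s - Z ω) ^ 2 * c := by positivity
      linarith
    have hI : Integrable (fun ω => Real.exp (s * Z ω)) μ := by
      refine (hi.const_mul (Real.exp (Real.exp 1 * K ^ 2 * s ^ 2))).mono' (by fun_prop) ?_
      exact ae_of_all _ fun ω => by
        rw [Real.norm_of_nonneg (Real.exp_pos _).le]; exact hpt ω
    refine ⟨hI, ?_⟩
    rcases le_or_gt (4 * Real.exp 1 * s ^ 2 * K ^ 2) 1 with hs | hs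
    · obtain ⟨hi2, hle2⟩ := hintg (s ^ 2) (sq_nonneg s) hs
      calc mgf Z μ s ≤ ∫ ω, (s * Z ω + Real.exp (s ^ 2 * Z ω ^ 2)) ∂μ := by
            refine integral_mono hI ((hZint.const_mul s).add hi2) fun ω => ?_
            have := exp_le_add_exp_sq (s * Z ω)
            rwa [mul_pow] at this
        _ = ∫ ω, Real.exp (s ^ 2 * Z ω ^ 2) ∂μ := by
            rw [integral_add (hZint.const_mul s) hi2, integral_const_mul, h0]; simp
        _ ≤ _ := hle2.trans (Real.exp_le_exp.2 (by nlinarith [mul_nonneg hK2.le (sq_nonneg s)]))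
    · calc mgf Z μ s ≤ ∫ ω, Real.exp (Real.exp 1 * K ^ 2 * s ^ 2) * Real.exp (c * Z ω ^ 2) ∂μ :=
            integral_mono hI (hi.const_mul _) hpt
        _ ≤ Real.exp (Real.exp 1 * K ^ 2 * s ^ 2) * Real.exp (4 * Real.exp 1 * c * K ^ 2) := by
            rw [integral_const_mul]
            gcongr
        _ ≤ _ := by
            rw [← Real.exp_add, hcK]
            apply Real.exp_le_exp.2
            nlinarith [mul_nonneg hK2.le (sq_nonneg s)]
  refine ⟨fun s => (main s).1, fun s => (main s).2.trans (Real.exp_le_exp.2 (le_of_eq ?_))⟩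
  rw [Real.coe_toNNReal _ (by positivity)]
  ring

/-- Variance proxies 28K²aᵢ² add up under independence and give the exponent 1/56; the two tails
contribute a factor 2 ≤ e. Lowering C only weakens the inequality. -/
lemma isHoeffdingConst_of_le {C : ℝ} (hC : C ≤ 1 / 56) : IsHoeffdingConst C := by
  intro Ω _ μ _ N Z K a t hZ hind h0 hK hpsi ht
  set S := ∑ i, a i ^ 2 with hS
  have hS0 : 0 ≤ S := Finset.sum_nonneg fun _ _ => sq_nonneg _
  rcases (mul_nonneg (sq_nonneg K) hS0).eq_or_lt with hz | hpos
  · rw [← hz, div_zero, neg_zero, Real.exp_zero, mul_one]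
    exact measureReal_le_one.trans (Real.one_le_exp zero_le_one)
  have hKpos : 0 < K := lt_of_le_of_ne hK fun h => by
    rw [← h] at hpos; simp at hpos
  have hsub : ∀ i, HasSubgaussianMGF (fun ω => a i * Z i ω)
      (Real.toNNReal (28 * K ^ 2 * a i ^ 2)) μ := by
    intro i
    have := (hasSubgaussianMGF_of_psi2Norm (hZ i) hKpos (h0 i) (hpsi i)).const_mul (a i)
    convert this using 1
    refine NNReal.eq ?_
    rw [Real.coe_toNNReal _ (by positivity)]
    refine Eq.trans ?_ (NNReal.coe_mul _ _).symm
    rw [Real.coe_toNNReal _ (by positivity)]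
    change _ = a i ^ 2 * (28 * K ^ 2)
    ring
  have hsum : HasSubgaussianMGF (fun ω => ∑ i, a i * Z i ω)
      (∑ i, Real.toNNReal (28 * K ^ 2 * a i ^ 2)) μ :=
    HasSubgaussianMGF.sum_of_iIndepFun
      (hind.comp (fun i z => a i * z) fun i => measurable_const_mul (a i)) fun i _ => hsub i
  have hcoe : ((∑ i, Real.toNNReal (28 * K ^ 2 * a i ^ 2) : NNReal) : ℝ) = 28 * (K ^ 2 * S) := by
    push_cast
    rw [Finset.sum_congr rfl fun i _ => Real.coe_toNNReal _ (by positivity), ← Finset.mul_sum]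
    ring
  have hexp : Real.exp (-t ^ 2 / (2 * (28 * (K ^ 2 * S)))) ≤
      Real.exp (-(C * t ^ 2 / (K ^ 2 * S))) := by
    apply Real.exp_le_exp.2
    rw [neg_div, neg_le_neg_iff, div_le_div_iff₀ hpos (by positivity)]
    have := mul_nonneg (sq_nonneg t) hpos.le
    nlinarith
  have h1 := hsum.measure_ge_le ht
  have h2 := hsum.neg.measure_ge_le ht
  rw [hcoe] at h1 h2
  have hsplit : {ω | t ≤ |∑ i, a i * Z i ω|} ⊆
      {ω | t ≤ ∑ i, a i * Z i ω} ∪ {ω | t ≤ (-fun ω => ∑ i, a i * Z i ω) ω} := by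
    intro ω hω
    rw [Set.mem_ofPred_eq] at hω
    rcases le_abs.1 hω with h | h
    · exact Or.inl h
    · exact Or.inr h
  calc _ ≤ μ.real {ω | t ≤ ∑ i, a i * Z i ω} +
        μ.real {ω | t ≤ (-fun ω => ∑ i, a i * Z i ω) ω} :=
        (measureReal_mono hsplit).trans (measureReal_union_le _ _)
    _ ≤ 2 * Real.exp (-(C * t ^ 2 / (K ^ 2 * S))) := by linarith
    _ ≤ _ := by
        have := Real.exp_one_gt_d9
        have := Real.exp_pos (-(C * t ^ 2 / (K ^ 2 * S)))
        nlinarith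

end Hoeffding

end MQR

end

noncomputable section

namespace MQR

open scoped RealInnerProductSpace

/-! ### Symmetrization and contraction for exponential moments of suprema -/

section Contraction

variable {α : Type*} {T : Finset α} (hT : T.Nonempty)

/-- Exponential of a maximum over a finite set. -/
def expSup (u : α → ℝ) : ℝ≥0∞ := ENNReal.ofReal (Real.exp (T.sup' hT u))

/-- Here s and t stand for the maximizers of u + h and u − h. If the values of v have opposite signs
the bound is termwise. Otherwise the exponential has larger increments from a larger base and over a
longer step, so the gain at one index outweighs the loss at the other; the larger of the two values
of v decides which alternative holds. -/
lemma exp_add_exp_le_aux {a b hs ht vs vt : ℝ} (h1 : |hs - ht| ≤ |vs - vt|) (h2 : |hs| ≤ |vs|)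
    (h3 : |ht| ≤ |vt|) (ha : b + ht ≤ a + hs) (hb : a - hs ≤ b - ht) (hv : 0 ≤ vs) :
    Real.exp (a + hs) + Real.exp (b - ht) ≤ Real.exp (a + vs) + Real.exp (b - vt) ∨
      Real.exp (a + hs) + Real.exp (b - ht) ≤ Real.exp (b + vt) + Real.exp (a - vs) := by
  have key : ∀ x y c d : ℝ, x ≤ y → 0 ≤ c → c ≤ d →
      Real.exp (x + c) - Real.exp x ≤ Real.exp (y + d) - Real.exp y := by
    intro x y c d hxy hc hcd
    have e1 : Real.exp (x + c) - Real.exp x = Real.exp x * (Real.exp c - 1) := by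
      rw [Real.exp_add]; ring
    have e2 : Real.exp (y + d) - Real.exp y = Real.exp y * (Real.exp d - 1) := by
      rw [Real.exp_add]; ring
    rw [e1, e2]
    have := Real.one_le_exp hc
    exact mul_le_mul (Real.exp_le_exp.2 hxy) (by linarith [Real.exp_le_exp.2 hcd]) (by linarith)
      (Real.exp_pos _).le
  rw [abs_of_nonneg hv] at h2
  obtain ⟨h2a, h2b⟩ := abs_le.1 h2
  rcases le_total vt 0 with ht0 | ht0
  · left
    rw [abs_of_nonpos ht0] at h3
    obtain ⟨h3a, h3b⟩ := abs_le.1 h3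
    exact add_le_add (Real.exp_le_exp.2 (by linarith)) (Real.exp_le_exp.2 (by linarith))
  rw [abs_of_nonneg ht0] at h3
  obtain ⟨h3a, h3b⟩ := abs_le.1 h3
  rcases le_total vt vs with hle | hle
  · left
    rw [abs_of_nonneg (sub_nonneg.2 hle)] at h1
    have h1b := (abs_le.1 h1).2
    have := key (b - vt) (a + hs) (vt - ht) (vs - hs) (by linarith) (by linarith) (by linarith)
    rw [show b - vt + (vt - ht) = b - ht by ring, show a + hs + (vs - hs) = a + vs by ring] at this
    linarith
  · right
    rw [abs_of_nonpos (sub_nonpos.2 hle)] at h1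
    have h1b := (abs_le.1 h1).2
    have := key (a - vs) (b - ht) (hs + vs) (ht + vt) (by linarith) (by linarith) (by linarith)
    rw [show a - vs + (hs + vs) = a + hs by ring, show b - ht + (ht + vt) = b + vt by ring] at this
    linarith

/-- Contraction principle for one Rademacher sign. -/
lemma exp_sup_contraction (u h v : α → ℝ)
    (hl : ∀ s ∈ T, ∀ t ∈ T, |h s - h t| ≤ |v s - v t|) (h0 : ∀ s ∈ T, |h s| ≤ |v s|) :
    Real.exp (T.sup' hT fun s => u s + h s) + Real.exp (T.sup' hT fun s => u s - h s) ≤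
      Real.exp (T.sup' hT fun s => u s + v s) + Real.exp (T.sup' hT fun s => u s - v s) := by
  obtain ⟨s, hs, es⟩ := Finset.exists_mem_eq_sup' hT fun s => u s + h s
  obtain ⟨t, ht, et⟩ := Finset.exists_mem_eq_sup' hT fun s => u s - h s
  have m1 : ∀ f : α → ℝ, ∀ r ∈ T, f r ≤ T.sup' hT f := fun f r hr => Finset.le_sup' f hr
  have a1 : u t + h t ≤ u s + h s := by
    rw [← es]; exact m1 (fun s => u s + h s) t ht
  have a2 : u s - h s ≤ u t - h t := by
    rw [← et]; exact m1 (fun s => u s - h s) s hs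
  rw [es, et]
  have p1 := Real.exp_le_exp.2 (m1 (fun s => u s + v s) s hs)
  have p2 := Real.exp_le_exp.2 (m1 (fun s => u s + v s) t ht)
  have p3 := Real.exp_le_exp.2 (m1 (fun s => u s - v s) s hs)
  have p4 := Real.exp_le_exp.2 (m1 (fun s => u s - v s) t ht)
  rcases le_total 0 (v s) with hv | hv
  · rcases exp_add_exp_le_aux (hl s hs t ht) (h0 s hs) (h0 t ht) a1 a2 hv with h | h <;> linarith
  -- Replacing v by −v exchanges the two exponentials on the right, so the sign of v at s may be
  -- normalized.
  · have e : |h s - h t| ≤ |-v s - -v t| := by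
      rw [show -v s - -v t = -(v s - v t) by ring, abs_neg]; exact hl s hs t ht
    have q := exp_add_exp_le_aux e (by rw [abs_neg]; exact h0 s hs)
      (by rw [abs_neg]; exact h0 t ht) a1 a2 (neg_nonneg.2 hv)
    simp only [sub_neg_eq_add, ← sub_eq_add_neg] at q
    rcases q with h | h <;> linarith

/-- Law of a Rademacher sign. -/
def rad : Measure ℝ := (2 : ℝ≥0∞)⁻¹ • (Measure.dirac 1 + Measure.dirac (-1))

instance : IsProbabilityMeasure rad := ⟨by
  simp only [rad, Measure.smul_apply, Measure.add_apply, measure_univ, smul_eq_mul]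
  rw [one_add_one_eq_two, ENNReal.inv_mul_cancel (by simp) (by simp)]⟩

lemma lintegral_rad (f : ℝ → ℝ≥0∞) : ∫⁻ e, f e ∂rad = 2⁻¹ * (f 1 + f (-1)) := by
  simp [rad, lintegral_smul_measure, lintegral_add_measure, mul_add]

variable {Y : Type*} [MeasurableSpace Y]

lemma measurable_expSup {β : Type*} [MeasurableSpace β] (G : α → β → ℝ)
    (hG : ∀ s, Measurable (G s)) : Measurable fun y => expSup hT fun s => G s y := by
  have : Measurable fun y => T.sup' hT fun s => G s y := by
    have h := Finset.measurable_sup' hT (f := G) fun s _ => hG s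
    convert h using 1
    ext y
    rw [Finset.sup'_apply]
  exact (Real.measurable_exp.comp this).ennreal_ofReal

/-- Jensen at the index where the left maximum is attained, followed by bounding that one index by
the maximum. This introduces the independent ghost copy. -/
lemma expSup_integral_le (ν : Measure Y) [IsProbabilityMeasure ν] (g : α → Y → ℝ) (v : α → ℝ)
    (hg : ∀ s, Measurable (g s)) (h0 : ∀ s y, |g s y| ≤ |v s|) (u : α → ℝ) :
    expSup hT (fun s => u s + ∫ z, g s z ∂ν) ≤ ∫⁻ z, expSup hT (fun s => u s + g s z) ∂ν := by
  obtain ⟨s, hs, es⟩ := Finset.exists_mem_eq_sup' hT fun s => u s + ∫ z, g s z ∂ν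
  have hgi : Integrable (g s) ν :=
    Integrable.of_bound (hg s).aestronglyMeasurable (|v s|) (ae_of_all _ fun z => h0 s z)
  have hi : Integrable (fun z => u s + g s z) ν := (integrable_const _).add hgi
  have hmeas : Measurable fun z => Real.exp (u s + g s z) := by
    have := hg s
    fun_prop
  have hie : Integrable (fun z => Real.exp (u s + g s z)) ν := by
    refine Integrable.of_bound hmeas.aestronglyMeasurable
      (Real.exp (u s + |v s|)) (ae_of_all _ fun z => ?_)
    rw [Real.norm_of_nonneg (Real.exp_pos _).le]
    exact Real.exp_le_exp.2 (add_le_add le_rfl ((le_abs_self _).trans (h0 s z)))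
  have hj : Real.exp (u s + ∫ z, g s z ∂ν) ≤ ∫ z, Real.exp (u s + g s z) ∂ν := by
    have h1 := convexOn_exp.map_integral_le Real.continuous_exp.continuousOn isClosed_univ
      (ae_of_all ν fun z => Set.mem_univ (u s + g s z)) hi hie
    have h2 : ∫ z, (u s + g s z) ∂ν = u s + ∫ z, g s z ∂ν := by
      rw [integral_add (integrable_const _) hgi]
      simp
    rwa [h2] at h1
  rw [expSup, es]
  refine (ENNReal.ofReal_le_ofReal hj).trans ?_
  rw [ofReal_integral_eq_lintegral_ofReal hie (ae_of_all _ fun z => (Real.exp_pos _).le)]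
  refine lintegral_mono fun z => ENNReal.ofReal_le_ofReal (Real.exp_le_exp.2 ?_)
  exact Finset.le_sup' (fun s => u s + g s z) hs

/-- Symmetrization and contraction for one coordinate. -/
lemma lintegral_expSup_le (ν : Measure Y) [IsProbabilityMeasure ν] (g : α → Y → ℝ) (v : α → ℝ)
    (hg : ∀ s, Measurable (g s)) (hl : ∀ s t y, |g s y - g t y| ≤ |v s - v t|)
    (h0 : ∀ s y, |g s y| ≤ |v s|) (u : α → ℝ) :
    ∫⁻ y, expSup hT (fun s => u s + (∫ z, g s z ∂ν - g s y)) ∂ν ≤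
      ∫⁻ e, expSup hT (fun s => u s + e * (2 * v s)) ∂rad := by
  obtain ⟨F, hF⟩ : ∃ F : Y → Y → ℝ≥0∞,
      F = fun y z => expSup hT fun s => u s + (g s z - g s y) := ⟨_, rfl⟩
  have hFm : Measurable (Function.uncurry F) := by
    rw [hF]
    exact measurable_expSup hT (fun s (q : Y × Y) => u s + (g s q.2 - g s q.1)) fun s => by
      have := hg s
      fun_prop
  have jensen : ∀ y, expSup hT (fun s => u s + (∫ z, g s z ∂ν - g s y)) ≤ ∫⁻ z, F y z ∂ν := by
    intro y
    have h1 := expSup_integral_le hT ν g v hg h0 fun s => u s - g s y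
    have e1 : (fun s => u s - g s y + ∫ z, g s z ∂ν) =
        fun s => u s + (∫ z, g s z ∂ν - g s y) := by ext s; ring
    have e2 : ∀ z, (fun s => u s - g s y + g s z) = fun s => u s + (g s z - g s y) := by
      intro z; ext s; ring
    simp only [e1, e2] at h1
    rw [hF]
    exact h1
  -- The symmetrization: exchanging the sample with its ghost flips the sign of all increments. The
  -- pair sum is thus two exponentials with opposite signs, to which contraction applies pointwise;
  -- increments of a difference of two copies are twice as large, hence 2v.
  have hpair : ∀ y z, F y z + F z y ≤ expSup hT (fun s => u s + 2 * v s) +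
      expSup hT (fun s => u s - 2 * v s) := by
    intro y z
    have hc := exp_sup_contraction hT u (fun s => g s z - g s y) (fun s => 2 * v s)
      (fun s _ t _ => by
        have h1 := hl s t z
        have h2 := hl s t y
        have e : (g s z - g s y) - (g t z - g t y) = (g s z - g t z) - (g s y - g t y) := by ring
        rw [e, ← mul_sub, abs_mul, abs_of_pos (by norm_num : (0 : ℝ) < 2)]
        exact (abs_sub _ _).trans (by linarith))
      (fun s _ => by
        rw [abs_mul, abs_of_pos (by norm_num : (0 : ℝ) < 2)]
        exact (abs_sub _ _).trans (by linarith [h0 s z, h0 s y]))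
    have e2 : F z y = expSup hT (fun s => u s - (g s z - g s y)) := by
      simp only [hF]
      congr 1
      ext s
      ring
    rw [e2]
    simp only [hF, expSup]
    rw [← ENNReal.ofReal_add (Real.exp_pos _).le (Real.exp_pos _).le,
      ← ENNReal.ofReal_add (Real.exp_pos _).le (Real.exp_pos _).le]
    exact ENNReal.ofReal_le_ofReal hc
  have hswap : ∫⁻ y, ∫⁻ z, F y z ∂ν ∂ν = ∫⁻ y, ∫⁻ z, F z y ∂ν ∂ν :=
    lintegral_lintegral_swap hFm.aemeasurable
  have hm1 : ∀ y, Measurable fun z => F y z := fun y => hFm.comp measurable_prodMk_left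
  have hm2 : Measurable fun y => ∫⁻ z, F y z ∂ν := hFm.lintegral_prod_right'
  have hdouble : 2 * ∫⁻ y, ∫⁻ z, F y z ∂ν ∂ν ≤ expSup hT (fun s => u s + 2 * v s) +
      expSup hT (fun s => u s - 2 * v s) := by
    calc 2 * ∫⁻ y, ∫⁻ z, F y z ∂ν ∂ν
        = ∫⁻ y, ∫⁻ z, F y z ∂ν ∂ν + ∫⁻ y, ∫⁻ z, F z y ∂ν ∂ν := by rw [two_mul, ← hswap]
      _ = ∫⁻ y, ∫⁻ z, (F y z + F z y) ∂ν ∂ν := by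
          rw [← lintegral_add_left hm2]
          exact lintegral_congr fun y => (lintegral_add_left (hm1 y) _).symm
      _ ≤ ∫⁻ _ : Y, ∫⁻ _ : Y, (expSup hT (fun s => u s + 2 * v s) +
            expSup hT (fun s => u s - 2 * v s)) ∂ν ∂ν :=
          lintegral_mono fun y => lintegral_mono fun z => hpair y z
      _ = _ := by simp
  refine (lintegral_mono jensen).trans ?_
  rw [lintegral_rad]
  have e3 : (fun s => u s + -1 * (2 * v s)) = fun s => u s - 2 * v s := by ext s; ring
  have e4 : (fun s => u s + 1 * (2 * v s)) = fun s => u s + 2 * v s := by ext s; ring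
  rw [e3, e4, ← ENNReal.mul_le_mul_iff_right (a := 2) (by simp) (by simp), ← mul_assoc,
    ENNReal.mul_inv_cancel (by simp) (by simp), one_mul]
  exact hdouble

lemma lintegral_expSup_pi_succ {N : ℕ} (κ : Fin (N + 1) → Measure Y)
    [∀ k, IsProbabilityMeasure (κ k)] (H : Fin (N + 1) → α → Y → ℝ)
    (hH : ∀ k s, Measurable (H k s)) (u : α → ℝ) :
    ∫⁻ y, expSup hT (fun s => u s + ∑ k, H k s (y k)) ∂Measure.pi κ =
      ∫⁻ z, ∫⁻ y, expSup hT (fun s => u s + H 0 s z + ∑ k : Fin N, H k.succ s (y k))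
        ∂Measure.pi (fun k => κ k.succ) ∂κ 0 := by
  have hmp := (measurePreserving_piFinSuccAbove κ 0).symm
  have hm : Measurable fun y : Fin (N + 1) → Y =>
      expSup hT (fun s => u s + ∑ k, H k s (y k)) :=
    measurable_expSup hT (fun s (y : Fin (N + 1) → Y) => u s + ∑ k, H k s (y k)) fun s => by
      have := fun k => hH k s
      fun_prop
  rw [← hmp.lintegral_comp_emb (MeasurableEquiv.measurableEmbedding _),
    lintegral_prod]
  swap
  · exact (hm.comp (MeasurableEquiv.measurable _)).aemeasurable
  refine lintegral_congr fun z => lintegral_congr fun y => ?_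
  congr 1
  ext s
  rw [Fin.sum_univ_succ, ← add_assoc]
  rfl

/-- Coordinatewise comparison of exponential moments implies comparison under product measures. -/
lemma lintegral_expSup_pi_le {Y' : Type*} [MeasurableSpace Y'] {N : ℕ}
    (ν : Fin N → Measure Y) [∀ k, IsProbabilityMeasure (ν k)]
    (ν' : Fin N → Measure Y') [∀ k, IsProbabilityMeasure (ν' k)]
    (G : Fin N → α → Y → ℝ) (G' : Fin N → α → Y' → ℝ)
    (hG : ∀ k s, Measurable (G k s)) (hG' : ∀ k s, Measurable (G' k s))
    (hle : ∀ k (u : α → ℝ), ∫⁻ y, expSup hT (fun s => u s + G k s y) ∂ν k ≤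
      ∫⁻ y, expSup hT (fun s => u s + G' k s y) ∂ν' k) (u : α → ℝ) :
    ∫⁻ y, expSup hT (fun s => u s + ∑ k, G k s (y k)) ∂Measure.pi ν ≤
      ∫⁻ y, expSup hT (fun s => u s + ∑ k, G' k s (y k)) ∂Measure.pi ν' := by
  induction N generalizing u with
  | zero => simp
  | succ N ih =>
    rw [lintegral_expSup_pi_succ hT ν G hG, lintegral_expSup_pi_succ hT ν' G' hG']
    have m1 : Measurable fun q : Y × (Fin N → Y') => expSup hT
        (fun s => u s + G 0 s q.1 + ∑ k : Fin N, G' k.succ s (q.2 k)) :=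
      measurable_expSup hT _ fun s => by
        have := hG 0 s
        have := fun k : Fin N => hG' k.succ s
        fun_prop
    have m2 : Measurable fun q : Y' × (Fin N → Y') => expSup hT
        (fun s => u s + G' 0 s q.1 + ∑ k : Fin N, G' k.succ s (q.2 k)) :=
      measurable_expSup hT _ fun s => by
        have := hG' 0 s
        have := fun k : Fin N => hG' k.succ s
        fun_prop
    -- Replace the tail coordinates with the head frozen into u, then swap integrals and replace the
    -- head with the tail frozen. This works because the one-coordinate comparison holds for every
    -- shift u.
    calc _ ≤ ∫⁻ z, ∫⁻ y, expSup hT (fun s => u s + G 0 s z + ∑ k : Fin N, G' k.succ s (y k))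
          ∂Measure.pi (fun k => ν' k.succ) ∂ν 0 :=
          lintegral_mono fun z => ih (fun k => ν k.succ) (fun k => ν' k.succ)
            (fun k => G k.succ) (fun k => G' k.succ) (fun k => hG k.succ) (fun k => hG' k.succ)
            (fun k => hle k.succ) (fun s => u s + G 0 s z)
      _ = ∫⁻ y, ∫⁻ z, expSup hT (fun s => u s + G 0 s z + ∑ k : Fin N, G' k.succ s (y k))
          ∂ν 0 ∂Measure.pi (fun k => ν' k.succ) := lintegral_lintegral_swap m1.aemeasurable
      _ ≤ ∫⁻ y, ∫⁻ z, expSup hT (fun s => u s + G' 0 s z + ∑ k : Fin N, G' k.succ s (y k))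
          ∂ν' 0 ∂Measure.pi (fun k => ν' k.succ) := by
          refine lintegral_mono fun y => ?_
          have := hle 0 (fun s => u s + ∑ k : Fin N, G' k.succ s (y k))
          simp only [add_right_comm _ (∑ k : Fin N, _) _] at this
          exact this
      _ = _ := (lintegral_lintegral_swap m2.aemeasurable).symm

end Contraction

end MQR

end

noncomputable section

namespace MQR

open scoped RealInnerProductSpace

/-! ### Uniform deviations over nuclear balls, for a fixed design -/

section FixedDesign

variable {n p m : ℕ}

/-- Approximating both unit vectors within 1/4 loses half of the operator norm c, so c ≤ M + c/2. A
one-sided bound on the net suffices because the sphere is symmetric; positive dimensions supply unit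
vectors, which gives M ≥ 0. -/
lemma opBound_of_net (hp : 0 < p) (hm : 0 < m) (W : Matrix (Fin p) (Fin m) ℝ) {S : Finset (EuclideanSpace ℝ (Fin p))}
    {R : Finset (EuclideanSpace ℝ (Fin m))} (hS1 : ∀ c ∈ S, ‖c‖ = 1)
    (hS : ∀ x : EuclideanSpace ℝ (Fin p), ‖x‖ = 1 → ∃ c ∈ S, ‖x - c‖ ≤ 1 / 4)
    (hR : ∀ x : EuclideanSpace ℝ (Fin m), ‖x‖ = 1 → ∃ c ∈ R, ‖x - c‖ ≤ 1 / 4) {M : ℝ}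
    (hM : ∀ a ∈ S, ∀ b ∈ R, ⟪a, Matrix.toEuclideanLin W b⟫ ≤ M) :
    0 ≤ M ∧ OpBound W (2 * M) := by
  set L := (Matrix.toEuclideanLin W).toContinuousLinearMap with hL
  have hLe : ∀ x, Matrix.toEuclideanLin W x = L x := fun x => rfl
  set c := ‖L‖ with hc
  have hc0 : 0 ≤ c := norm_nonneg _
  have hunit : ∀ a b, ‖a‖ = 1 → ‖b‖ = 1 → ⟪a, L b⟫ ≤ M + c / 2 := by
    intro a b ha hb
    obtain ⟨a0, ha0, haa⟩ := hS a ha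
    obtain ⟨b0, hb0, hbb⟩ := hR b hb
    have e : ⟪a, L b⟫ = ⟪a0, L b0⟫ + ⟪a - a0, L b⟫ + ⟪a0, L (b - b0)⟫ := by
      rw [map_sub, inner_sub_right, inner_sub_left]; ring
    have h1 : ⟪a - a0, L b⟫ ≤ 1 / 4 * c := by
      refine (real_inner_le_norm _ _).trans ?_
      have := L.le_opNorm b
      rw [hb, mul_one] at this
      exact mul_le_mul haa this (norm_nonneg _) (by norm_num)
    have h2 : ⟪a0, L (b - b0)⟫ ≤ c * (1 / 4) := by
      refine (real_inner_le_norm _ _).trans ?_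
      rw [hS1 a0 ha0, one_mul]
      exact (L.le_opNorm _).trans (mul_le_mul_of_nonneg_left hbb hc0)
    have h3 := hM a0 ha0 b0 hb0
    rw [hLe] at h3
    rw [e]
    linarith
  have hall : ∀ a b, ⟪a, L b⟫ ≤ (M + c / 2) * (‖a‖ * ‖b‖) := by
    intro a b
    by_cases ha : a = 0
    · simp [ha]
    by_cases hb : b = 0
    · simp [hb]
    have na : 0 < ‖a‖ := norm_pos_iff.2 ha
    have nb : 0 < ‖b‖ := norm_pos_iff.2 hb
    have := hunit (‖a‖⁻¹ • a) (‖b‖⁻¹ • b) (norm_smul_inv_norm ha) (norm_smul_inv_norm hb)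
    rw [map_smul, inner_smul_left, inner_smul_right] at this
    simp only [conj_trivial] at this
    calc ⟪a, L b⟫ = (‖a‖⁻¹ * (‖b‖⁻¹ * ⟪a, L b⟫)) * (‖a‖ * ‖b‖) := by field_simp
      _ ≤ _ := mul_le_mul_of_nonneg_right this (by positivity)
  have hMc : 0 ≤ M + c / 2 := by
    have h1 := hunit (EuclideanSpace.single ⟨0, hp⟩ 1) (EuclideanSpace.single ⟨0, hm⟩ 1)
      (by simp) (by simp)
    have h2 := hunit (-EuclideanSpace.single ⟨0, hp⟩ 1) (EuclideanSpace.single ⟨0, hm⟩ 1)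
      (by simp) (by simp)
    rw [inner_neg_left] at h2
    linarith
  have hcM : c ≤ M + c / 2 := by
    refine L.opNorm_le_bound hMc fun b => ?_
    have := hall (L b) b
    rw [real_inner_self_eq_norm_sq] at this
    by_cases h0 : ‖L b‖ = 0
    · rw [h0]; positivity
    · have hp : 0 < ‖L b‖ := lt_of_le_of_ne (norm_nonneg _) (Ne.symm h0)
      nlinarith
  refine ⟨by linarith, fun a b => ?_⟩
  rw [hLe]
  refine (hall a b).trans (mul_le_mul_of_nonneg_right (by linarith) (by positivity))

/-- The weighted design matrix `∑ᵢⱼ eᵢⱼ xᵢ eⱼᵀ`. -/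
def designSum (x : Fin n → Fin p → ℝ) (e : Fin n → Fin m → ℝ) : Matrix (Fin p) (Fin m) ℝ :=
  Matrix.of fun a j => ∑ i, e i j * x i a

lemma frobInner_designSum (x : Fin n → Fin p → ℝ) (e : Fin n → Fin m → ℝ)
    (Δ : Matrix (Fin p) (Fin m) ℝ) :
    frobInner (designSum x e) Δ = ∑ i, ∑ j, e i j * linPred Δ j (x i) := by
  simp only [frobInner, designSum, linPred, Matrix.of_apply, Finset.sum_mul, Finset.mul_sum]
  rw [Finset.sum_comm]
  rw [Finset.sum_congr rfl fun j _ => Finset.sum_comm, Finset.sum_comm]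
  simp only [mul_assoc]

lemma inner_designSum (x : Fin n → Fin p → ℝ) (e : Fin n → Fin m → ℝ)
    (a : EuclideanSpace ℝ (Fin p)) (b : EuclideanSpace ℝ (Fin m)) :
    ⟪a, Matrix.toEuclideanLin (designSum x e) b⟫ = ∑ i, ∑ j, e i j * (lin a (x i) * b j) := by
  rw [← frobInner_vecMulVec, frobInner_designSum]
  refine Finset.sum_congr rfl fun i _ => Finset.sum_congr rfl fun j _ => ?_
  simp only [linPred, lin, Matrix.vecMulVec_apply, Finset.sum_mul]
  congr 1
  exact Finset.sum_congr rfl fun k _ => by ring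

lemma lintegral_exp_rad_le (c u : ℝ) :
    ∫⁻ e, ENNReal.ofReal (Real.exp (u + e * c)) ∂rad ≤ ENNReal.ofReal (Real.exp (u + c ^ 2 / 2)) := by
  rw [lintegral_rad, ← ENNReal.ofReal_add (Real.exp_pos _).le (Real.exp_pos _).le,
    show (2 : ℝ≥0∞)⁻¹ = ENNReal.ofReal (2⁻¹) by
      rw [ENNReal.ofReal_inv_of_pos (by norm_num)]; simp,
    ← ENNReal.ofReal_mul (by norm_num)]
  apply ENNReal.ofReal_le_ofReal
  have h := Real.cosh_le_exp_half_sq c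
  rw [Real.cosh_eq] at h
  rw [Real.exp_add, Real.exp_add, Real.exp_add, one_mul, neg_one_mul]
  have := mul_le_mul_of_nonneg_left h (Real.exp_pos u).le
  calc _ = Real.exp u * ((Real.exp c + Real.exp (-c)) / 2) := by ring
    _ ≤ _ := this

/-- The product comparison with a one-point index set tensorizes cosh c ≤ e^{c²/2}, first within
rows and then across them. -/
lemma lintegral_exp_sum_rad_le (c : Fin n → Fin m → ℝ) :
    ∫⁻ e : Fin n → Fin m → ℝ, ENNReal.ofReal (Real.exp (∑ i, ∑ j, e i j * c i j))
      ∂Measure.pi (fun _ => Measure.pi fun _ => rad) ≤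
      ENNReal.ofReal (Real.exp (∑ i, ∑ j, c i j ^ 2 / 2)) := by
  have hT : ({()} : Finset Unit).Nonempty := Finset.singleton_nonempty _
  have hexp : ∀ f : Unit → ℝ, expSup hT f = ENNReal.ofReal (Real.exp (f ())) := fun f => by
    simp [expSup]
  have inner : ∀ i (u : Unit → ℝ),
      ∫⁻ y : Fin m → ℝ, expSup hT (fun s => u s + ∑ j, y j * c i j) ∂Measure.pi (fun _ => rad) ≤
      ∫⁻ _ : Fin m → ℝ, expSup hT (fun s => u s + ∑ j, c i j ^ 2 / 2)
        ∂Measure.pi (fun _ => rad) := by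
    intro i u
    refine lintegral_expSup_pi_le hT (fun _ => rad) (fun _ => rad) (fun j _ y => y * c i j)
      (fun j _ _ => c i j ^ 2 / 2) (fun j _ => by fun_prop) (fun j _ => by fun_prop) ?_ u
    intro j u
    simp only [hexp]
    refine (lintegral_exp_rad_le _ _).trans (le_of_eq ?_)
    simp
  have := lintegral_expSup_pi_le hT (fun _ : Fin n => Measure.pi fun _ : Fin m => rad)
    (fun _ : Fin n => Measure.pi fun _ : Fin m => rad) (fun i _ y => ∑ j, y j * c i j)
    (fun i _ _ => ∑ j, c i j ^ 2 / 2) (fun j _ => by fun_prop) (fun j _ => by fun_prop)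
    inner (fun _ => 0)
  simpa [hexp] using this

/-- Exponential moment of the supremum of the centred process. -/
lemma lintegral_expSup_process_le (hp : 0 < p) (hm : 0 < m) (x : Fin n → Fin p → ℝ) {V B : ℝ}
    (hV : ∀ a : EuclideanSpace ℝ (Fin p), ∑ i, lin a (x i) ^ 2 ≤ V * ‖a‖ ^ 2)
    (ν : Fin n → Fin m → Measure ℝ) [∀ i j, IsProbabilityMeasure (ν i j)]
    (g : Fin n → Fin m → ℝ → ℝ → ℝ) (hg : ∀ i j d, Measurable (g i j d))
    (hl : ∀ i j d d' y, |g i j d y - g i j d' y| ≤ |d - d'|) (h0 : ∀ i j y, g i j 0 y = 0)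
    {T : Finset (Matrix (Fin p) (Fin m) ℝ)} (hT : T.Nonempty) (hTB : ∀ Δ ∈ T, nuclearNorm Δ ≤ B)
    {s : ℝ} (hs : 0 ≤ s) :
    ∫⁻ y : Fin n → Fin m → ℝ, expSup hT (fun Δ => s * ∑ i, ∑ j,
        (∫ z, g i j (linPred Δ j (x i)) z ∂ν i j - g i j (linPred Δ j (x i)) (y i j)))
      ∂Measure.pi (fun i => Measure.pi (ν i)) ≤
      ENNReal.ofReal (9 ^ (p + m) * Real.exp (8 * s ^ 2 * B ^ 2 * V)) := by
  have one : ∀ i j (u : Matrix (Fin p) (Fin m) ℝ → ℝ),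
      ∫⁻ y, expSup hT (fun Δ => u Δ + s * (∫ z, g i j (linPred Δ j (x i)) z ∂ν i j -
        g i j (linPred Δ j (x i)) y)) ∂ν i j ≤
      ∫⁻ e, expSup hT (fun Δ => u Δ + e * (2 * (s * linPred Δ j (x i)))) ∂rad := by
    intro i j u
    have := lintegral_expSup_le hT (ν i j) (fun Δ y => s * g i j (linPred Δ j (x i)) y)
      (fun Δ => s * linPred Δ j (x i)) (fun Δ => (hg i j _).const_mul s)
      (fun Δ Δ' y => by
        rw [← mul_sub, ← mul_sub, abs_mul, abs_mul]
        exact mul_le_mul_of_nonneg_left (hl i j _ _ y) (abs_nonneg _))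
      (fun Δ y => by
        rw [abs_mul, abs_mul]
        refine mul_le_mul_of_nonneg_left ?_ (abs_nonneg _)
        have := hl i j (linPred Δ j (x i)) 0 y
        rwa [h0, sub_zero, sub_zero] at this) u
    simpa only [integral_const_mul, ← mul_sub] using this
  have rows : ∀ i (u : Matrix (Fin p) (Fin m) ℝ → ℝ),
      ∫⁻ y : Fin m → ℝ, expSup hT (fun Δ => u Δ + ∑ j, s * (∫ z, g i j (linPred Δ j (x i)) z ∂ν i j -
        g i j (linPred Δ j (x i)) (y j))) ∂Measure.pi (ν i) ≤
      ∫⁻ e : Fin m → ℝ, expSup hT (fun Δ => u Δ + ∑ j, e j * (2 * (s * linPred Δ j (x i))))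
        ∂Measure.pi (fun _ => rad) := by
    intro i u
    exact lintegral_expSup_pi_le hT (ν i) (fun _ => rad)
      (fun j Δ y => s * (∫ z, g i j (linPred Δ j (x i)) z ∂ν i j - g i j (linPred Δ j (x i)) y))
      (fun j Δ e => e * (2 * (s * linPred Δ j (x i))))
      (fun j Δ => by have := hg i j (linPred Δ j (x i)); fun_prop)
      (fun j Δ => by fun_prop) (fun j u => one i j u) u
  have all := lintegral_expSup_pi_le hT (fun i => Measure.pi (ν i))
    (fun _ : Fin n => Measure.pi fun _ : Fin m => rad)
    (fun i Δ y => ∑ j, s * (∫ z, g i j (linPred Δ j (x i)) z ∂ν i j -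
      g i j (linPred Δ j (x i)) (y j)))
    (fun i Δ e => ∑ j, e j * (2 * (s * linPred Δ j (x i))))
    (fun i Δ => by
      have := fun j => hg i j (linPred Δ j (x i))
      fun_prop)
    (fun i Δ => by fun_prop) rows (fun _ => 0)
  simp only [zero_add] at all
  simp only [Finset.mul_sum]
  refine all.trans ?_
  obtain ⟨S, hS1, hS, hScard⟩ := exists_sphere_net (EuclideanSpace ℝ (Fin p))
    (by norm_num : (0 : ℝ) < 1 / 4)
  obtain ⟨R, hR1, hR, hRcard⟩ := exists_sphere_net (EuclideanSpace ℝ (Fin m))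
    (by norm_num : (0 : ℝ) < 1 / 4)
  have hSne : S.Nonempty := by
    obtain ⟨c, hc, -⟩ := hS (EuclideanSpace.single ⟨0, hp⟩ 1) (by simp)
    exact ⟨c, hc⟩
  have hRne : R.Nonempty := by
    obtain ⟨c, hc, -⟩ := hR (EuclideanSpace.single ⟨0, hm⟩ 1) (by simp)
    exact ⟨c, hc⟩
  -- The Rademacher process is linear in Δ, hence at most the operator norm of the signed design
  -- times B. One factor 2 comes from symmetrization and one from the nets, giving 4sB; the maximum
  -- over net pairs is replaced by a sum.
  have pointwise : ∀ e : Fin n → Fin m → ℝ,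
      expSup hT (fun Δ => ∑ i, ∑ j, e i j * (2 * (s * linPred Δ j (x i)))) ≤
      ∑ q ∈ S ×ˢ R, ENNReal.ofReal (Real.exp
        (∑ i, ∑ j, e i j * (4 * s * B * (lin q.1 (x i) * q.2 j)))) := by
    intro e
    set W := designSum x e with hW
    obtain ⟨q, hq, eq⟩ := Finset.exists_mem_eq_sup' (hSne.product hRne)
      fun q => ⟪q.1, Matrix.toEuclideanLin W q.2⟫
    obtain ⟨hq1, hq2⟩ := Finset.mem_product.1 hq
    set M := ⟪q.1, Matrix.toEuclideanLin W q.2⟫ with hMdef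
    have hM : ∀ a ∈ S, ∀ b ∈ R, ⟪a, Matrix.toEuclideanLin W b⟫ ≤ M := by
      intro a ha b hb
      rw [← eq]
      exact Finset.le_sup' (fun q : EuclideanSpace ℝ (Fin p) × EuclideanSpace ℝ (Fin m) =>
        ⟪q.1, Matrix.toEuclideanLin W q.2⟫) (Finset.mk_mem_product ha hb)
    obtain ⟨hM0, hop⟩ := opBound_of_net hp hm W hS1 hS hR hM
    have hsup : T.sup' hT (fun Δ => ∑ i, ∑ j, e i j * (2 * (s * linPred Δ j (x i)))) ≤
        4 * s * B * M := by
      refine Finset.sup'_le _ _ fun Δ hΔ => ?_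
      have h1 := frobInner_le W Δ hop
      rw [hW, frobInner_designSum] at h1
      have h2 : ∑ i, ∑ j, e i j * (2 * (s * linPred Δ j (x i))) =
          2 * s * ∑ i, ∑ j, e i j * linPred Δ j (x i) := by
        simp only [Finset.mul_sum]
        exact Finset.sum_congr rfl fun i _ => Finset.sum_congr rfl fun j _ => by ring
      rw [h2]
      have h3 : 2 * M * nuclearNorm Δ ≤ 2 * M * B :=
        mul_le_mul_of_nonneg_left (hTB Δ hΔ) (by positivity)
      calc _ ≤ 2 * s * (2 * M * B) := mul_le_mul_of_nonneg_left (h1.trans h3) (by positivity)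
        _ = _ := by ring
    have hterm : 4 * s * B * M = ∑ i, ∑ j, e i j * (4 * s * B * (lin q.1 (x i) * q.2 j)) := by
      rw [hMdef, hW, inner_designSum]
      simp only [Finset.mul_sum]
      exact Finset.sum_congr rfl fun i _ => Finset.sum_congr rfl fun j _ => by ring
    refine (ENNReal.ofReal_le_ofReal (Real.exp_le_exp.2 hsup)).trans ?_
    rw [hterm]
    exact Finset.single_le_sum (f := fun q : EuclideanSpace ℝ (Fin p) × EuclideanSpace ℝ (Fin m) =>
      ENNReal.ofReal (Real.exp (∑ i, ∑ j, e i j * (4 * s * B * (lin q.1 (x i) * q.2 j)))))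
      (fun _ _ => zero_le) hq
  refine (lintegral_mono pointwise).trans ?_
  rw [lintegral_finsetSum _ fun q _ => by fun_prop]
  have each : ∀ q ∈ S ×ˢ R, ∫⁻ e : Fin n → Fin m → ℝ, ENNReal.ofReal (Real.exp
        (∑ i, ∑ j, e i j * (4 * s * B * (lin q.1 (x i) * q.2 j))))
        ∂Measure.pi (fun _ => Measure.pi fun _ => rad) ≤
      ENNReal.ofReal (Real.exp (8 * s ^ 2 * B ^ 2 * V)) := by
    intro q hq
    obtain ⟨hq1, hq2⟩ := Finset.mem_product.1 hq
    refine (lintegral_exp_sum_rad_le _).trans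
      (ENNReal.ofReal_le_ofReal (Real.exp_le_exp.2 ?_))
    have h1 : ∑ i, ∑ j, (4 * s * B * (lin q.1 (x i) * q.2 j)) ^ 2 / 2 =
        8 * s ^ 2 * B ^ 2 * ((∑ i, lin q.1 (x i) ^ 2) * ∑ j, q.2 j ^ 2) := by
      rw [Finset.sum_mul_sum, Finset.mul_sum]
      refine Finset.sum_congr rfl fun i _ => ?_
      rw [Finset.mul_sum]
      exact Finset.sum_congr rfl fun j _ => by ring
    have h2 : ∑ j, q.2 j ^ 2 = 1 := by
      have := EuclideanSpace.real_norm_sq_eq q.2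
      rw [hR1 _ hq2] at this
      linarith
    have h3 := hV q.1
    rw [hS1 _ hq1] at h3
    rw [h1, h2, mul_one]
    exact mul_le_mul_of_nonneg_left (by linarith) (by positivity)
  refine (Finset.sum_le_sum each).trans ?_
  rw [Finset.sum_const, nsmul_eq_mul, Finset.card_product]
  rw [ENNReal.ofReal_mul (by positivity)]
  gcongr
  rw [← ENNReal.ofReal_natCast]
  apply ENNReal.ofReal_le_ofReal
  push_cast
  -- Nets of mesh 1/4 have at most 9 to the dimension points.
  have e9 : (1 : ℝ) + 2 / (1 / 4) = 9 := by norm_num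
  rw [e9, finrank_euclideanSpace, Fintype.card_fin] at hScard hRcard
  rw [pow_add]
  exact mul_le_mul hScard hRcard (by positivity) (by positivity)

/-- Uniform deviation bound over a countable subset of a nuclear ball. -/
lemma measure_process_gt_le (hp : 0 < p) (hm : 0 < m) (x : Fin n → Fin p → ℝ) {V B : ℝ}
    (hB : 0 < B) (hVpos : 0 < V)
    (hV : ∀ a : EuclideanSpace ℝ (Fin p), ∑ i, lin a (x i) ^ 2 ≤ V * ‖a‖ ^ 2)
    (ν : Fin n → Fin m → Measure ℝ) [∀ i j, IsProbabilityMeasure (ν i j)]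
    (g : Fin n → Fin m → ℝ → ℝ → ℝ) (hg : ∀ i j d, Measurable (g i j d))
    (hl : ∀ i j d d' y, |g i j d y - g i j d' y| ≤ |d - d'|) (h0 : ∀ i j y, g i j 0 y = 0)
    {D : Set (Matrix (Fin p) (Fin m) ℝ)} (hD : D.Countable) (hDB : ∀ Δ ∈ D, nuclearNorm Δ ≤ B)
    {t : ℝ} (ht : 0 ≤ t) :
    Measure.pi (fun i => Measure.pi (ν i)) {y : Fin n → Fin m → ℝ | ∃ Δ ∈ D, t < ∑ i, ∑ j,
        (∫ z, g i j (linPred Δ j (x i)) z ∂ν i j - g i j (linPred Δ j (x i)) (y i j))} ≤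
      ENNReal.ofReal (9 ^ (p + m) * Real.exp (-(t ^ 2 / (32 * B ^ 2 * V)))) := by
  set P := Measure.pi (fun i => Measure.pi (ν i))
  set Φ : Matrix (Fin p) (Fin m) ℝ → (Fin n → Fin m → ℝ) → ℝ := fun Δ y => ∑ i, ∑ j,
    (∫ z, g i j (linPred Δ j (x i)) z ∂ν i j - g i j (linPred Δ j (x i)) (y i j)) with hΦ
  have fin : ∀ T : Finset (Matrix (Fin p) (Fin m) ℝ), (∀ Δ ∈ T, nuclearNorm Δ ≤ B) →
      P {y | ∃ Δ ∈ T, t < Φ Δ y} ≤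
      ENNReal.ofReal (9 ^ (p + m) * Real.exp (-(t ^ 2 / (32 * B ^ 2 * V)))) := by
    intro T hTB
    rcases T.eq_empty_or_nonempty with rfl | hT
    · simp
    -- The minimizer of 8s²B²V − st, with minimum −t²/(32B²V).
    set s : ℝ := t / (16 * B ^ 2 * V) with hs
    have hs0 : 0 ≤ s := by positivity
    have hmom := lintegral_expSup_process_le hp hm x hV ν g hg hl h0 hT hTB hs0
    have hsub : {y | ∃ Δ ∈ T, t < Φ Δ y} ⊆
        {y | ENNReal.ofReal (Real.exp (s * t)) ≤ expSup hT (fun Δ => s * Φ Δ y)} := by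
      rintro y ⟨Δ, hΔ, hlt⟩
      refine ENNReal.ofReal_le_ofReal (Real.exp_le_exp.2 ?_)
      exact (mul_le_mul_of_nonneg_left hlt.le hs0).trans
        (Finset.le_sup' (fun Δ => s * Φ Δ y) hΔ)
    refine (measure_mono hsub).trans ?_
    have hmeas : Measurable fun y : Fin n → Fin m → ℝ => expSup hT (fun Δ => s * Φ Δ y) :=
      measurable_expSup hT (fun Δ y => s * Φ Δ y) fun Δ => by
        have := fun i j => hg i j (linPred Δ j (x i))
        simp only [hΦ]
        fun_prop
    have hmk := meas_ge_le_lintegral_div (μ := P) hmeas.aemeasurable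
      (ε := ENNReal.ofReal (Real.exp (s * t)))
      (by simpa using Real.exp_pos _) ENNReal.ofReal_ne_top
    refine hmk.trans ((ENNReal.div_le_div_right hmom _).trans ?_)
    rw [← ENNReal.ofReal_div_of_pos (Real.exp_pos _), mul_div_assoc, ← Real.exp_sub]
    apply ENNReal.ofReal_le_ofReal
    refine mul_le_mul_of_nonneg_left (Real.exp_le_exp.2 (le_of_eq ?_)) (by positivity)
    rw [hs]
    field_simp
    ring
  rcases D.eq_empty_or_nonempty with rfl | hDne
  · simp
  obtain ⟨f, rfl⟩ := hD.exists_eq_range hDne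
  -- The finite-set bound does not depend on the set, so an increasing union of finite subsets
  -- reaches the countable one.
  have hU : {y | ∃ Δ ∈ Set.range f, t < Φ Δ y} =
      ⋃ N : ℕ, {y | ∃ Δ ∈ (Finset.range N).image f, t < Φ Δ y} := by
    ext y
    simp only [Set.mem_iUnion, Set.mem_ofPred_eq, Finset.mem_image, Finset.mem_range]
    constructor
    · rintro ⟨_, ⟨k, rfl⟩, h⟩
      exact ⟨k + 1, _, ⟨k, by omega, rfl⟩, h⟩
    · rintro ⟨N, _, ⟨k, -, rfl⟩, h⟩
      exact ⟨_, ⟨k, rfl⟩, h⟩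
  rw [hU, Monotone.measure_iUnion]
  · refine iSup_le fun N => fin _ fun Δ hΔ => ?_
    obtain ⟨k, -, rfl⟩ := Finset.mem_image.1 hΔ
    exact hDB _ ⟨k, rfl⟩
  · rintro N N' hN y ⟨Δ, hΔ, h⟩
    refine ⟨Δ, ?_, h⟩
    exact Finset.image_subset_image (Finset.range_subset_range.2 hN) hΔ

end FixedDesign

end MQR

end

noncomputable section

namespace MQR

/-! ### Truncated quadratic minorant -/

section Hub

/-- The function `d²/2 - |d|³/(6k)`, frozen beyond its maximum at `|d| = 2k`. -/
def hub (k d : ℝ) : ℝ := (min |d| (2 * k)) ^ 2 / 2 - (min |d| (2 * k)) ^ 3 / (6 * k)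

lemma continuous_hub (k : ℝ) : Continuous (hub k) := by
  unfold hub
  fun_prop

lemma hub_eq_of_le {k d : ℝ} (h : |d| ≤ 2 * k) : hub k d = d ^ 2 / 2 - |d| ^ 3 / (6 * k) := by
  rw [hub, min_eq_left h, sq_abs]

lemma hub_eq_of_ge {k d : ℝ} (hk : 0 < k) (h : 2 * k ≤ |d|) : hub k d = 2 * k ^ 2 / 3 := by
  rw [hub, min_eq_right h]
  field_simp
  ring

lemma hub_eq_mul {k d : ℝ} (hk : 0 < k) :
    hub k d = (min |d| (2 * k)) ^ 2 / 2 * (1 - min |d| (2 * k) / (3 * k)) := by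
  rw [hub]
  field_simp
  ring

lemma hub_nonneg {k : ℝ} (hk : 0 < k) (d : ℝ) : 0 ≤ hub k d := by
  rw [hub_eq_mul hk]
  refine mul_nonneg (by positivity) ?_
  have : min |d| (2 * k) / (3 * k) ≤ 1 := by
    rw [div_le_one (by positivity)]
    linarith [min_le_right |d| (2 * k)]
  linarith

lemma hub_le_sq {k : ℝ} (hk : 0 < k) (d : ℝ) : hub k d ≤ d ^ 2 / 2 := by
  have h0 : 0 ≤ min |d| (2 * k) := le_min (abs_nonneg _) (by linarith)
  have h1 : (min |d| (2 * k)) ^ 2 ≤ d ^ 2 := by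
    rw [← sq_abs d]; exact pow_le_pow_left₀ h0 (min_le_left _ _) 2
  have h2 : 0 ≤ (min |d| (2 * k)) ^ 3 / (6 * k) := by positivity
  unfold hub
  linarith

lemma sub_le_hub {k : ℝ} (hk : 0 < k) (d : ℝ) : d ^ 2 / 2 - |d| ^ 3 / (6 * k) ≤ hub k d := by
  rcases le_total |d| (2 * k) with h | h
  · rw [hub_eq_of_le h]
  · rw [hub_eq_of_ge hk h, ← sq_abs, sub_le_iff_le_add, ← sub_le_iff_le_add',
      le_div_iff₀ (by positivity)]
    generalize |d| = y at *
    nlinarith [mul_nonneg (sub_nonneg.2 h) (sq_nonneg (y - 2 * k)),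
      mul_nonneg hk.le (sq_nonneg (y - 2 * k))]

lemma hub_le_const {k : ℝ} (hk : 0 < k) (d : ℝ) : hub k d ≤ 2 * k ^ 2 / 3 := by
  rcases le_total |d| (2 * k) with h | h
  · rw [hub_eq_of_le h, ← sq_abs, sub_le_iff_le_add, ← sub_le_iff_le_add',
      le_div_iff₀ (by positivity)]
    have h0 := abs_nonneg d
    generalize |d| = y at *
    nlinarith [mul_nonneg (sub_nonneg.2 h) h0, mul_nonneg (sub_nonneg.2 h) (sub_nonneg.2 h),
      mul_nonneg (mul_nonneg (sub_nonneg.2 h) (sub_nonneg.2 h)) hk.le,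
      mul_nonneg (mul_nonneg (sub_nonneg.2 h) (sub_nonneg.2 h)) h0]
  · rw [hub_eq_of_ge hk h]

/-- Enlarging k weakens the cubic correction and raises the plateau. A single threshold, valid for
the largest possible column scale, therefore serves all columns. -/
lemma hub_mono {k k' : ℝ} (hk : 0 < k) (hkk : k ≤ k') (d : ℝ) : hub k d ≤ hub k' d := by
  have hk' : 0 < k' := hk.trans_le hkk
  have h0 := abs_nonneg d
  rcases le_total |d| (2 * k) with h | h
  · rw [hub_eq_of_le h, hub_eq_of_le (by linarith)]
    gcongr
  · rw [hub_eq_of_ge hk h]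
    rcases le_total |d| (2 * k') with h' | h'
    · rw [hub_eq_of_le h', ← sq_abs d]
      have h1 : |d| ^ 3 / (6 * k') ≤ |d| ^ 2 / 3 := by
        rw [div_le_div_iff₀ (by positivity) (by norm_num)]
        nlinarith [mul_nonneg (sq_nonneg |d|) (sub_nonneg.2 h')]
      nlinarith
    · rw [hub_eq_of_ge hk' h']
      have := pow_le_pow_left₀ hk.le hkk 2
      linarith

/-- Homogeneity reduces a column of arbitrary L₂ size to a unit direction, at the price of rescaling
the threshold. -/
lemma hub_scale {k r : ℝ} (hr : 0 < r) (d : ℝ) : hub (r * k) (r * d) = r ^ 2 * hub k d := by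
  have e : min |r * d| (2 * (r * k)) = r * min |d| (2 * k) := by
    rw [abs_mul, abs_of_pos hr, mul_min_of_nonneg _ _ hr.le]
    ring_nf
  rw [hub, hub, e]
  by_cases hk : k = 0
  · simp [hk]
  · field_simp

/-- Transfers bounds from a net to nearby directions. The clipped modulus is 1-Lipschitz, and the
truncated quadratic increases with it. In the only nontrivial case x ≤ y the factor 1 − z/(3k)
decreases, so comparing squares suffices. -/
lemma hub_le_add_sq {k : ℝ} (hk : 0 < k) (d d' : ℝ) :
    hub k d' ≤ 9 / 8 * hub k d + 9 / 2 * (d - d') ^ 2 := by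
  have key : ∀ x y : ℝ, 0 ≤ x → x ≤ y → y ≤ 2 * k →
      y ^ 2 / 2 * (1 - y / (3 * k)) ≤
        9 / 8 * (x ^ 2 / 2 * (1 - x / (3 * k))) + 9 / 2 * (y - x) ^ 2 := by
    intro x y hx hxy hy
    have w1 : y / (3 * k) ≤ 1 := by rw [div_le_one (by positivity)]; linarith
    have w2 : x / (3 * k) ≤ y / (3 * k) := by gcongr
    have w3 : 0 ≤ x / (3 * k) := by positivity
    set wx := 1 - x / (3 * k)
    have h1 : y ^ 2 / 2 * (1 - y / (3 * k)) ≤ y ^ 2 / 2 * wx :=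
      mul_le_mul_of_nonneg_left (by simp only [wx]; linarith) (by positivity)
    -- Young's inequality: the difference of the two sides is (x − 8(y − x))²/8.
    have h2 : y ^ 2 ≤ 9 / 8 * x ^ 2 + 9 * (y - x) ^ 2 := by
      nlinarith [sq_nonneg (x - 8 * (y - x))]
    have hwx0 : 0 ≤ wx := by simp only [wx]; linarith
    have hwx1 : wx ≤ 1 := by simp only [wx]; linarith
    nlinarith [mul_le_mul_of_nonneg_right h2 hwx0,
      mul_nonneg (sq_nonneg (y - x)) (sub_nonneg.2 hwx1)]
  have hmono : ∀ x y : ℝ, 0 ≤ x → x ≤ y → y ≤ 2 * k →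
      x ^ 2 / 2 * (1 - x / (3 * k)) ≤ y ^ 2 / 2 * (1 - y / (3 * k)) := by
    intro x y hx hxy hy
    have e : ∀ z : ℝ, z ^ 2 / 2 * (1 - z / (3 * k)) = (3 * k * z ^ 2 - z ^ 3) / (6 * k) := by
      intro z; field_simp; ring
    rw [e, e]
    gcongr ?_ / _
    have h1 : y ^ 2 + x * y + x ^ 2 ≤ 3 * k * (x + y) := by
      nlinarith [mul_nonneg (add_nonneg hx (hx.trans hxy)) (sub_nonneg.2 hy),
        mul_nonneg hx (sub_nonneg.2 hxy), mul_nonneg (hx.trans hxy) (sub_nonneg.2 hxy)]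
    nlinarith [mul_nonneg (sub_nonneg.2 hxy) (sub_nonneg.2 h1)]
  rw [hub_eq_mul hk, hub_eq_mul hk]
  set x := min |d| (2 * k) with hx
  set y := min |d'| (2 * k) with hy
  have hx0 : 0 ≤ x := le_min (abs_nonneg _) (by linarith)
  have hy0 : 0 ≤ y := le_min (abs_nonneg _) (by linarith)
  have hx2 : x ≤ 2 * k := min_le_right _ _
  have hy2 : y ≤ 2 * k := min_le_right _ _
  have hxy : (y - x) ^ 2 ≤ (d - d') ^ 2 := by
    rw [sq_le_sq]
    calc |y - x| ≤ max |(|d'| - |d|)| |2 * k - 2 * k| := abs_min_sub_min_le_max _ _ _ _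
      _ = |(|d'| - |d|)| := by simp
      _ ≤ |d' - d| := abs_abs_sub_abs_le_abs_sub _ _
      _ = |d - d'| := abs_sub_comm _ _
  rcases le_total x y with h | h
  · have := key x y hx0 h hy2
    linarith
  · have h1 := hmono y x hy0 h hx2
    have h2 : 0 ≤ x ^ 2 / 2 * (1 - x / (3 * k)) := by
      rw [hx, ← hub_eq_mul hk]; exact hub_nonneg hk d
    nlinarith [sq_nonneg (d - d')]

end Hub

end MQR

end

noncomputable section

namespace MQR

/-! ### Check loss and conditional quantiles -/

section Quantile

/-- The subgradient inequality of the check loss. Convexity of the loss, the score bound and the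
derivative of the expected excess all rest on it. -/
lemma rho_sub_ge (τ v w : ℝ) :
    (w - v) * (τ - if v ≤ 0 then 1 else 0) ≤ rho τ w - rho τ v := by
  unfold rho
  split_ifs <;> nlinarith

lemma abs_rho_sub_le {τ : ℝ} (h0 : 0 < τ) (h1 : τ < 1) (v w : ℝ) :
    |rho τ w - rho τ v| ≤ |w - v| := by
  have key : ∀ v w : ℝ, rho τ v - rho τ w ≤ |w - v| := by
    intro v w
    have h := rho_sub_ge τ v w
    have h2 : |(w - v) * (τ - if v ≤ 0 then 1 else 0)| ≤ |w - v| := by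
      rw [abs_mul]
      refine mul_le_of_le_one_right (abs_nonneg _) (abs_le.2 ?_)
      split_ifs <;> constructor <;> linarith
    have h3 := (abs_le.1 h2).1
    linarith
  rw [abs_le]
  constructor
  · linarith [key v w]
  · have := key w v
    rw [abs_sub_comm] at this
    exact this

lemma continuous_rho {τ : ℝ} (h0 : 0 < τ) (h1 : τ < 1) : Continuous (rho τ) := by
  have : LipschitzWith 1 (rho τ) := LipschitzWith.of_dist_le_mul fun a b => by
    rw [Real.dist_eq, Real.dist_eq, NNReal.coe_one, one_mul]
    exact abs_rho_sub_le h0 h1 b a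
  exact this.continuous

variable {Q : Measure ℝ} [IsProbabilityMeasure Q] {f : ℝ → ℝ}

lemma measureReal_Iic_sub (hf0 : ∀ y, 0 ≤ f y)
    (hQ : Q = volume.withDensity fun y => ENNReal.ofReal (f y)) (hf : Continuous f) {a b : ℝ}
    (hab : a ≤ b) : Q.real (Set.Iic b) - Q.real (Set.Iic a) = ∫ y in a..b, f y := by
  rw [← measureReal_sdiff (Set.Iic_subset_Iic.2 hab) measurableSet_Iic, Set.Iic_sdiff_Iic,
    intervalIntegral.integral_of_le hab, measureReal_def, hQ,
    withDensity_apply _ measurableSet_Ioc,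
    ← ofReal_integral_eq_lintegral_ofReal _ (ae_of_all _ hf0), ENNReal.toReal_ofReal]
  · exact integral_nonneg hf0
  · exact (hf.integrableOn_Icc).mono_set Set.Ioc_subset_Icc_self

lemma continuous_measureReal_Iic (hf0 : ∀ y, 0 ≤ f y)
    (hQ : Q = volume.withDensity fun y => ENNReal.ofReal (f y)) (hf : Continuous f) :
    Continuous fun b => Q.real (Set.Iic b) := by
  have e : (fun b => Q.real (Set.Iic b)) = fun b => Q.real (Set.Iic 0) + ∫ y in (0 : ℝ)..b, f y := by
    ext b
    rcases le_total 0 b with h | h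
    · rw [← measureReal_Iic_sub hf0 hQ hf h]; ring
    · rw [intervalIntegral.integral_symm, ← measureReal_Iic_sub hf0 hQ hf h]; ring
  rw [e]
  exact continuous_const.add
    (intervalIntegral.continuous_primitive (fun a b => hf.intervalIntegrable a b) 0)

/-- The distribution function of an atomless law equals `τ` at the `τ`-quantile. -/
lemma measureReal_Iic_quantile {τ : ℝ} (h0 : 0 < τ) (h1 : τ < 1)
    (hc : Continuous fun b => Q.real (Set.Iic b)) : Q.real (Set.Iic (quantile Q τ)) = τ := by
  set F : ℝ → ℝ := fun b => Q.real (Set.Iic b) with hF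
  have hcdf : ∀ b, F b = cdf Q b := fun b => by rw [cdf_eq_real]
  have hFc : F = cdf Q := funext hcdf
  have hbot : Filter.Tendsto F Filter.atBot (nhds 0) := by
    rw [hFc]; exact tendsto_cdf_atBot Q
  have htop : Filter.Tendsto F Filter.atTop (nhds 1) := by
    rw [hFc]; exact tendsto_cdf_atTop Q
  have hmono : Monotone F := fun a b hab => by
    rw [hcdf, hcdf]; exact monotone_cdf Q hab
  set S := {y : ℝ | τ ≤ F y} with hS
  have hne : S.Nonempty := by
    obtain ⟨y, hy⟩ := (htop.eventually (lt_mem_nhds h1)).exists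
    exact ⟨y, hy.le⟩
  have hbdd : BddBelow S := by
    obtain ⟨y, hy⟩ := (hbot.eventually (gt_mem_nhds h0)).exists
    refine ⟨y, fun z hz => ?_⟩
    by_contra hlt
    push Not at hlt
    have := hmono hlt.le
    have hz' : τ ≤ F z := hz
    linarith
  have hclosed : IsClosed S := isClosed_le continuous_const hc
  have hq : quantile Q τ = sInf S := rfl
  have hmem : τ ≤ F (sInf S) := hclosed.csInf_mem hne hbdd
  rw [hq]
  refine le_antisymm ?_ hmem
  by_contra hlt
  push Not at hlt
  -- If the distribution function exceeded τ at the infimum, continuity would give a smaller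
  -- admissible point.
  have hev : ∀ᶠ y in nhds (sInf S), τ < F y := hc.continuousAt.eventually (lt_mem_nhds hlt)
  obtain ⟨ε, hε, hball⟩ := Metric.eventually_nhds_iff.1 hev
  have : τ < F (sInf S - ε / 2) := hball (by
    rw [Real.dist_eq, show sInf S - ε / 2 - sInf S = -(ε / 2) by ring, abs_neg,
      abs_of_pos (by linarith)]
    linarith)
  have := csInf_le hbdd (show sInf S - ε / 2 ∈ S from this.le)
  linarith

lemma density_lower_bound {D : ℝ} (hd : Differentiable ℝ f) (hD : ∀ y, |deriv f y| ≤ D) (q y : ℝ) :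
    f q - D * |y - q| ≤ f y := by
  have := Convex.norm_image_sub_le_of_norm_deriv_le (s := Set.univ) (f := f) (C := D)
    (fun x _ => hd x) (fun x _ => hD x) convex_univ (Set.mem_univ q) (Set.mem_univ y)
  rw [Real.norm_eq_abs, Real.norm_eq_abs] at this
  linarith [(abs_le.1 this).1]

/-- Integrate the lower bound fl − D|y − q| for the density over an interval of length d on either
side of q. -/
lemma measureReal_Iic_growth {fl D q : ℝ} (hf0 : ∀ y, 0 ≤ f y)
    (hQ : Q = volume.withDensity fun y => ENNReal.ofReal (f y)) (hd : Differentiable ℝ f)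
    (hD : ∀ y, |deriv f y| ≤ D) (hfl : fl ≤ f q) {d : ℝ} (h : 0 ≤ d) :
    fl * d - D * d ^ 2 / 2 ≤ Q.real (Set.Iic (q + d)) - Q.real (Set.Iic q) ∧
      fl * d - D * d ^ 2 / 2 ≤ Q.real (Set.Iic q) - Q.real (Set.Iic (q - d)) := by
  have hc := hd.continuous
  constructor
  · rw [measureReal_Iic_sub hf0 hQ hc (by linarith)]
    have e : ∫ y in q..(q + d), (fl - D * (y - q)) = fl * d - D * d ^ 2 / 2 := by
      rw [intervalIntegral.integral_sub (by simp) (by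
        apply Continuous.intervalIntegrable; fun_prop),
        intervalIntegral.integral_const_mul, intervalIntegral.integral_sub (by simp) (by simp)]
      simp
      ring
    rw [← e]
    refine intervalIntegral.integral_mono_on (by linarith)
      (Continuous.intervalIntegrable (by fun_prop) _ _) (hc.intervalIntegrable _ _) fun y hy => ?_
    have := density_lower_bound hd hD q y
    rw [abs_of_nonneg (by linarith [hy.1])] at this
    linarith
  · rw [measureReal_Iic_sub hf0 hQ hc (by linarith)]
    have e : ∫ y in (q - d)..q, (fl - D * (q - y)) = fl * d - D * d ^ 2 / 2 := by
      rw [intervalIntegral.integral_sub (by simp) (by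
        apply Continuous.intervalIntegrable; fun_prop),
        intervalIntegral.integral_const_mul, intervalIntegral.integral_sub (by simp) (by simp)]
      simp
      ring
    rw [← e]
    refine intervalIntegral.integral_mono_on (by linarith)
      (Continuous.intervalIntegrable (by fun_prop) _ _) (hc.intervalIntegrable _ _) fun y hy => ?_
    have := density_lower_bound hd hD q y
    rw [abs_of_nonpos (by linarith [hy.2])] at this
    linarith

/-- Up to 2k, integrate the lower bound for the derivative. Beyond 2k that bound is useless, but Ψ
still increases and keeps at least its value at 2k, where the truncated quadratic is frozen. -/
lemma hub_le_of_deriv {Ψ G : ℝ → ℝ} {fl k : ℝ} (hfl : 0 < fl) (hk : 0 < k) (h0 : Ψ 0 = 0)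
    (hΨ : ∀ d, HasDerivAt Ψ (G d) d) (hG0 : ∀ d, 0 ≤ d → 0 ≤ G d)
    (hG : ∀ d, 0 ≤ d → fl * d - fl / k * d ^ 2 / 2 ≤ G d) {d : ℝ} (hd : 0 ≤ d) :
    fl * hub k d ≤ Ψ d := by
  have hcont : Continuous Ψ := continuous_iff_continuousAt.2 fun x => (hΨ x).continuousAt
  have hquad : ∀ d, 0 ≤ d → fl * (d ^ 2 / 2 - d ^ 3 / (6 * k)) ≤ Ψ d := by
    intro d hd
    have hder : ∀ x, HasDerivAt (fun d => Ψ d - fl * (d ^ 2 / 2 - d ^ 3 / (6 * k)))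
        (G x - fl * (x - x ^ 2 / (2 * k))) x := by
      intro x
      refine (hΨ x).sub (HasDerivAt.const_mul fl ?_)
      refine HasDerivAt.congr_deriv
        (((hasDerivAt_pow 2 x).div_const 2).sub ((hasDerivAt_pow 3 x).div_const (6 * k))) ?_
      field_simp
      norm_num
      ring
    have hm : MonotoneOn (fun d => Ψ d - fl * (d ^ 2 / 2 - d ^ 3 / (6 * k))) (Set.Ici 0) := by
      refine monotoneOn_of_deriv_nonneg (convex_Ici 0)
        (fun x _ => (hder x).continuousAt.continuousWithinAt)
        (fun x _ => (hder x).differentiableAt.differentiableWithinAt) fun x hx => ?_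
      rw [interior_Ici] at hx
      rw [(hder x).deriv]
      have := hG x (le_of_lt hx)
      have e : fl * x - fl / k * x ^ 2 / 2 = fl * (x - x ^ 2 / (2 * k)) := by field_simp
      linarith
    have := hm (Set.mem_Ici.2 le_rfl) (Set.mem_Ici.2 hd) hd
    simp only [h0] at this
    norm_num at this
    linarith
  have hmono : MonotoneOn Ψ (Set.Ici 0) := by
    refine monotoneOn_of_deriv_nonneg (convex_Ici 0) hcont.continuousOn
      (fun x _ => (hΨ x).differentiableAt.differentiableWithinAt) fun x hx => ?_
    rw [interior_Ici] at hx
    rw [(hΨ x).deriv]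
    exact hG0 x (le_of_lt hx)
  rcases le_total d (2 * k) with h | h
  · rw [hub_eq_of_le (by rwa [abs_of_nonneg hd]), abs_of_nonneg hd]
    exact hquad d hd
  · rw [hub_eq_of_ge hk (by rwa [abs_of_nonneg hd]), ← hub_eq_of_ge (d := 2 * k) hk
      (by rw [abs_of_pos (by linarith)]), hub_eq_of_le (by rw [abs_of_pos (by linarith)]),
      abs_of_pos (by linarith)]
    exact (hquad (2 * k) (by linarith)).trans
      (hmono (Set.mem_Ici.2 (by linarith)) (Set.mem_Ici.2 hd) h)

/-- Expected excess check loss. -/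
def excess (Q : Measure ℝ) (τ q d : ℝ) : ℝ := ∫ y, (rho τ (y - q - d) - rho τ (y - q)) ∂Q

lemma integrable_rho_sub {τ : ℝ} (h0 : 0 < τ) (h1 : τ < 1) (a b : ℝ) :
    Integrable (fun y => rho τ (y - a) - rho τ (y - b)) Q := by
  have hc := continuous_rho h0 h1
  refine Integrable.of_bound (C := |b - a|) (by fun_prop : Continuous _).aestronglyMeasurable
    (ae_of_all _ fun y => ?_)
  have := abs_rho_sub_le h0 h1 (y - b) (y - a)
  rwa [show y - a - (y - b) = b - a by ring] at this

/-- The subgradient inequality integrated over y: the centred distribution function is a subgradient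
of the expected excess. -/
lemma excess_sub_ge {τ : ℝ} (h0 : 0 < τ) (h1 : τ < 1) (q d d' : ℝ) :
    (d' - d) * (Q.real (Set.Iic (q + d)) - τ) ≤ excess Q τ q d' - excess Q τ q d := by
  have i1 := integrable_rho_sub (Q := Q) h0 h1 (q + d') q
  have i2 := integrable_rho_sub (Q := Q) h0 h1 (q + d) q
  simp only [← sub_sub] at i1 i2
  rw [excess, excess, ← integral_sub i1 i2]
  have i3 : Integrable (fun y => (Set.Iic (q + d)).indicator (fun _ => (1 : ℝ)) y) Q :=
    (integrable_const 1).indicator measurableSet_Iic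
  have e : (d' - d) * (Q.real (Set.Iic (q + d)) - τ) =
      ∫ y, (d' - d) * ((Set.Iic (q + d)).indicator (fun _ => (1 : ℝ)) y - τ) ∂Q := by
    rw [integral_const_mul, integral_sub i3 (integrable_const _), integral_indicator_const _
      measurableSet_Iic]
    simp
  rw [e]
  refine integral_mono ((i3.sub (integrable_const τ)).const_mul _) (i1.sub i2) fun y => ?_
  have := rho_sub_ge τ (y - q - d) (y - q - d')
  have hi : (Set.Iic (q + d)).indicator (fun _ => (1 : ℝ)) y = if y - q - d ≤ 0 then 1 else 0 := by
    rw [Set.indicator_apply]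
    congr 1
    rw [Set.mem_Iic, eq_iff_iff]
    constructor <;> intro h <;> linarith
  simp only [hi]
  linarith

/-- The expected excess loss dominates the truncated quadratic. -/
lemma hub_le_excess {τ fl D : ℝ} (h0 : 0 < τ) (h1 : τ < 1) (hfl0 : 0 < fl) (hD0 : 0 < D)
    (hf0 : ∀ y, 0 ≤ f y) (hQ : Q = volume.withDensity fun y => ENNReal.ofReal (f y))
    (hd : Differentiable ℝ f) (hD : ∀ y, |deriv f y| ≤ D) (hfl : fl ≤ f (quantile Q τ)) (d : ℝ) :
    fl * hub (fl / D) d ≤ excess Q τ (quantile Q τ) d := by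
  set q := quantile Q τ with hq
  have hc := continuous_measureReal_Iic hf0 hQ hd.continuous
  have hFq : Q.real (Set.Iic q) = τ := measureReal_Iic_quantile h0 h1 hc
  -- The subgradient inequalities at both endpoints sandwich the increment; continuity of the
  -- distribution function turns this into a derivative without differentiating under the integral.
  have hder : ∀ d, HasDerivAt (excess Q τ q) (Q.real (Set.Iic (q + d)) - τ) d := by
    intro d
    rw [hasDerivAt_iff_isLittleO, Asymptotics.isLittleO_iff]
    intro c hcpos
    have hcd : ContinuousAt (fun z => Q.real (Set.Iic (q + z))) d :=
      (hc.comp (continuous_const.add continuous_id)).continuousAt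
    filter_upwards [Metric.continuousAt_iff'.1 hcd c hcpos] with z hz
    rw [Real.dist_eq] at hz
    have g1 := excess_sub_ge (Q := Q) h0 h1 q d z
    have g2 := excess_sub_ge (Q := Q) h0 h1 q z d
    rw [smul_eq_mul, Real.norm_eq_abs, Real.norm_eq_abs, abs_of_nonneg (by linarith)]
    have h3 : excess Q τ q z - excess Q τ q d - (z - d) * (Q.real (Set.Iic (q + d)) - τ) ≤
        (z - d) * (Q.real (Set.Iic (q + z)) - Q.real (Set.Iic (q + d))) := by linarith
    refine h3.trans ((le_abs_self _).trans ?_)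
    rw [abs_mul, mul_comm]
    exact mul_le_mul_of_nonneg_right hz.le (abs_nonneg _)
  have hk : 0 < fl / D := div_pos hfl0 hD0
  have hfD : fl / (fl / D) = D := by field_simp
  have hmono : ∀ a b : ℝ, a ≤ b → Q.real (Set.Iic a) ≤ Q.real (Set.Iic b) := fun a b hab =>
    measureReal_mono (Set.Iic_subset_Iic.2 hab)
  have hz : excess Q τ q 0 = 0 := by simp [excess]
  rcases le_total 0 d with h | h
  · refine hub_le_of_deriv hfl0 hk hz hder (fun d hd => ?_) (fun d hd' => ?_) h
    · have := hmono q (q + d) (by linarith)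
      linarith
    · rw [hfD]
      have := (measureReal_Iic_growth hf0 hQ hd hD hfl hd').1
      linarith
  -- Negative displacements: reflect, and use the growth of the distribution function to the left of
  -- the quantile.
  · have e : hub (fl / D) d = hub (fl / D) (-d) := by simp [hub]
    have key := hub_le_of_deriv (Ψ := fun z => excess Q τ q (-z))
      (G := fun z => τ - Q.real (Set.Iic (q - z))) hfl0 hk (by simpa using hz)
      (fun z => by
        have h5 := (hder (-z)).comp z (hasDerivAt_neg z)
        refine HasDerivAt.congr_deriv h5 ?_
        rw [← sub_eq_add_neg]; ring)
      (fun z hz' => by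
        have := hmono (q - z) q (by linarith)
        linarith)
      (fun z hz' => by
        rw [hfD]
        have := (measureReal_Iic_growth hf0 hQ hd hD hfl hz').2
        linarith) (neg_nonneg.2 h)
    rw [e]
    simpa using key

/-- The density cannot fall quickly from its value at q, so an interval of length fl/D carries mass
at least fl²/(2D), and a mass is at most 1. This scale bound makes the covariate exponent large in
terms of the radius. -/
lemma density_ratio_le {fl D q : ℝ} (hfl0 : 0 < fl) (hD0 : 0 < D)
    (hf0 : ∀ y, 0 ≤ f y) (hQ : Q = volume.withDensity fun y => ENNReal.ofReal (f y))
    (hd : Differentiable ℝ f) (hD : ∀ y, |deriv f y| ≤ D) (hfl : fl ≤ f q) :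
    fl * (fl / D) ≤ 2 := by
  have h := (measureReal_Iic_growth hf0 hQ hd hD hfl (div_pos hfl0 hD0).le).1
  have h1 : Q.real (Set.Iic (q + fl / D)) ≤ 1 := measureReal_le_one
  have h2 : 0 ≤ Q.real (Set.Iic q) := measureReal_nonneg
  have e : fl * (fl / D) - D * (fl / D) ^ 2 / 2 = fl * (fl / D) / 2 := by field_simp; ring
  linarith

lemma integral_score {τ q : ℝ} (hq : Q.real (Set.Iic q) = τ) (d : ℝ) :
    ∫ y, d * ((if y ≤ q then 1 else 0) - τ) ∂Q = 0 := by
  have i3 : Integrable (fun y => (Set.Iic q).indicator (fun _ => (1 : ℝ)) y) Q :=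
    (integrable_const 1).indicator measurableSet_Iic
  have e : ∀ y : ℝ, (if y ≤ q then (1 : ℝ) else 0) = (Set.Iic q).indicator (fun _ => (1 : ℝ)) y :=
    fun y => by simp [Set.indicator_apply]
  simp only [e]
  rw [integral_const_mul, integral_sub i3 (integrable_const _),
    integral_indicator_const _ measurableSet_Iic]
  simp [hq]

end Quantile

end MQR

end

noncomputable section

namespace MQR

/-! ### Lower isometry for the covariates -/

section Covariates

variable {n p : ℕ} {Pi : Measure (Fin p → ℝ)}

/-- Second moment of a linear functional. -/
def secondMoment (Pi : Measure (Fin p → ℝ)) (a : EuclideanSpace ℝ (Fin p)) : ℝ :=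
  ∫ x, lin a x ^ 2 ∂Pi

lemma lin_add (a b : EuclideanSpace ℝ (Fin p)) (x : Fin p → ℝ) :
    lin (a + b) x = lin a x + lin b x := by
  simp [lin, mul_add, Finset.sum_add_distrib]

lemma lin_sub (a b : EuclideanSpace ℝ (Fin p)) (x : Fin p → ℝ) :
    lin (a - b) x = lin a x - lin b x := by
  simp [lin, mul_sub, Finset.sum_sub_distrib]

lemma lin_smul (c : ℝ) (a : EuclideanSpace ℝ (Fin p)) (x : Fin p → ℝ) :
    lin (c • a) x = c * lin a x := by
  simp only [lin, Finset.mul_sum, PiLp.smul_apply, smul_eq_mul]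
  exact Finset.sum_congr rfl fun i _ => by ring

lemma continuous_lin (a : EuclideanSpace ℝ (Fin p)) : Continuous (lin a) := by
  unfold lin
  fun_prop

@[fun_prop]
lemma measurable_lin (a : EuclideanSpace ℝ (Fin p)) : Measurable (lin a) :=
  (continuous_lin a).measurable

lemma secondMoment_smul (c : ℝ) (a : EuclideanSpace ℝ (Fin p)) :
    secondMoment Pi (c • a) = c ^ 2 * secondMoment Pi a := by
  simp only [secondMoment, lin_smul, mul_pow, integral_const_mul]

lemma memLp_lin (hX : ∀ a, MemLp (fun x : Fin p → ℝ => x a) 2 Pi)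
    (a : EuclideanSpace ℝ (Fin p)) : MemLp (lin a) 2 Pi := by
  have : lin a = fun x => ∑ i, a i * x i := by
    ext x; simp [lin, mul_comm]
  rw [this]
  exact memLp_finsetSum _ fun i _ => (hX i).const_mul (a i)

/-- The embedding of linear functionals into `L²`. -/
def linToLp (hX : ∀ a, MemLp (fun x : Fin p → ℝ => x a) 2 Pi) :
    EuclideanSpace ℝ (Fin p) →ₗ[ℝ] Lp ℝ 2 Pi where
  toFun a := (memLp_lin hX a).toLp (lin a)
  map_add' a b := by
    rw [← MemLp.toLp_add]
    congr 1
    ext x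
    exact lin_add a b x
  map_smul' c a := by
    rw [RingHom.id_apply, ← MemLp.toLp_const_smul]
    congr 1
    ext x
    exact lin_smul c a x

lemma norm_linToLp_sq (hX : ∀ a, MemLp (fun x : Fin p → ℝ => x a) 2 Pi)
    (a : EuclideanSpace ℝ (Fin p)) : ‖linToLp hX a‖ ^ 2 = secondMoment Pi a := by
  rw [← real_inner_self_eq_norm_sq, L2.inner_def, secondMoment]
  refine integral_congr_ae ?_
  filter_upwards [(memLp_lin hX a).coeFn_toLp] with x hx
  change inner ℝ (((memLp_lin hX a).toLp (lin a)) x) (((memLp_lin hX a).toLp (lin a)) x) = _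
  rw [hx]
  simp [sq]

/-- Nets of the unit sphere for the `L²` norm of linear functionals. -/
lemma exists_secondMoment_net (hX : ∀ a, MemLp (fun x : Fin p → ℝ => x a) 2 Pi) {ε : ℝ}
    (hε : 0 < ε) :
    ∃ N : Finset (EuclideanSpace ℝ (Fin p)), (∀ c ∈ N, secondMoment Pi c = 1) ∧
      (∀ a, secondMoment Pi a = 1 → ∃ c ∈ N, secondMoment Pi (a - c) ≤ ε ^ 2) ∧
      (N.card : ℝ) ≤ (1 + 2 / ε) ^ p := by
  classical
  set φ := linToLp hX
  -- The net is taken on the unit sphere of the image in L², where the second moment is a genuine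
  -- squared norm even if the functionals are degenerate, and then lifted along chosen preimages.
  obtain ⟨S, hS1, hS, hcard⟩ := exists_sphere_net (LinearMap.range φ) hε
  choose ψ hψ using fun v : LinearMap.range φ => v.2
  have hone : ∀ a, secondMoment Pi a = 1 → ‖φ a‖ = 1 := fun a ha => by
    have := norm_linToLp_sq hX a
    rw [ha] at this
    exact (pow_eq_one_iff_of_nonneg (norm_nonneg _) two_ne_zero).1 this
  refine ⟨S.image ψ, ?_, ?_, ?_⟩
  · intro c hc
    obtain ⟨v, hv, rfl⟩ := Finset.mem_image.1 hc
    rw [← norm_linToLp_sq hX]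
    have h1 := hS1 v hv
    change ‖φ (ψ v)‖ ^ 2 = 1
    rw [hψ v]
    rw [show ‖(v : Lp ℝ 2 Pi)‖ = 1 from h1]
    norm_num
  · intro a ha
    obtain ⟨v, hv, hd⟩ := hS ⟨φ a, LinearMap.mem_range_self _ _⟩ (hone a ha)
    refine ⟨ψ v, Finset.mem_image_of_mem _ hv, ?_⟩
    rw [← norm_linToLp_sq hX]
    change ‖φ (a - ψ v)‖ ^ 2 ≤ ε ^ 2
    rw [map_sub, hψ v]
    exact pow_le_pow_left₀ (norm_nonneg _) hd 2
  · calc ((S.image ψ).card : ℝ) ≤ S.card := by exact_mod_cast Finset.card_image_le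
      _ ≤ _ := hcard
      _ ≤ _ := by
        refine pow_le_pow_right₀ (by have : 0 < 2 / ε := by positivity
                                     linarith) ?_
        refine (LinearMap.finrank_range_le φ).trans ?_
        simp

variable [IsProbabilityMeasure Pi]

/-- Lower tail bound for sums of independent nonnegative variables. -/
lemma measure_sum_le_of_nonneg {E : Type*} [MeasurableSpace E] (κ : Measure E)
    [IsProbabilityMeasure κ] {Z : E → ℝ} (hZm : Measurable Z) (hZ0 : ∀ x, 0 ≤ Z x) {b v e δ : ℝ}
    (hb : ∀ x, Z x ≤ b) (he : e ≤ ∫ x, Z x ∂κ) (hv : 0 < v) (hv2 : ∫ x, Z x ^ 2 ∂κ ≤ v)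
    (hδ : 0 ≤ δ) :
    Measure.pi (fun _ : Fin n => κ) {x | ∑ i, Z (x i) < n * (e - δ)} ≤
      ENNReal.ofReal (Real.exp (-(n * δ ^ 2 / (2 * v)))) := by
  have hT : ({()} : Finset Unit).Nonempty := Finset.singleton_nonempty _
  have hexp : ∀ f : Unit → ℝ, expSup hT f = ENNReal.ofReal (Real.exp (f ())) := fun f => by
    simp [expSup]
  -- The minimizer of −θδ + θ²v/2, the per-observation Chernoff exponent.
  set θ : ℝ := δ / v with hθ
  have hθ0 : 0 ≤ θ := by positivity
  set c : ℝ := -θ * e + θ ^ 2 * v / 2 with hc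
  have iZ : Integrable Z κ := Integrable.of_bound hZm.aestronglyMeasurable b
    (ae_of_all _ fun x => by rw [Real.norm_of_nonneg (hZ0 x)]; exact hb x)
  have iZ2 : Integrable (fun x => Z x ^ 2) κ :=
    Integrable.of_bound (hZm.pow_const 2).aestronglyMeasurable (b ^ 2)
      (ae_of_all _ fun x => by
        rw [Real.norm_of_nonneg (sq_nonneg _)]; exact pow_le_pow_left₀ (hZ0 x) (hb x) 2)
  -- For nonnegative variables this quadratic bound needs no control of the upper range, so only the
  -- second moment enters the lower tail.
  have hquad : ∀ y : ℝ, 0 ≤ y → Real.exp (-y) ≤ 1 - y + y ^ 2 / 2 := by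
    intro y hy
    have h1 := Real.quadratic_le_exp_of_nonneg hy
    rw [Real.exp_neg, inv_le_iff_one_le_mul₀ (Real.exp_pos _)]
    have h2 : 0 ≤ 1 - y + y ^ 2 / 2 := by nlinarith [sq_nonneg (y - 1)]
    calc (1 : ℝ) ≤ (1 - y + y ^ 2 / 2) * (1 + y + y ^ 2 / 2) := by nlinarith [sq_nonneg (y ^ 2)]
      _ ≤ _ := mul_le_mul_of_nonneg_left h1 h2
  have iE : Integrable (fun x => Real.exp (-(θ * Z x))) κ :=
    Integrable.of_bound (by fun_prop : Measurable _).aestronglyMeasurable 1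
      (ae_of_all _ fun x => by
        rw [Real.norm_of_nonneg (Real.exp_pos _).le]
        exact Real.exp_le_one_iff.2 (neg_nonpos.2 (mul_nonneg hθ0 (hZ0 x))))
  have hmgf : ∫ x, Real.exp (-(θ * Z x)) ∂κ ≤ Real.exp c := by
    calc ∫ x, Real.exp (-(θ * Z x)) ∂κ ≤ ∫ x, ((1 - θ * Z x) + θ ^ 2 / 2 * Z x ^ 2) ∂κ := by
          refine integral_mono iE (((integrable_const 1).sub (iZ.const_mul θ)).add
            (iZ2.const_mul _)) fun x => ?_
          have := hquad (θ * Z x) (mul_nonneg hθ0 (hZ0 x))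
          simp only
          linarith [mul_pow θ (Z x) 2]
      _ = (1 - θ * ∫ x, Z x ∂κ) + θ ^ 2 / 2 * ∫ x, Z x ^ 2 ∂κ := by
          have i1 : Integrable (fun x => 1 - θ * Z x) κ := (integrable_const 1).sub (iZ.const_mul θ)
          rw [integral_add i1 (iZ2.const_mul _),
            integral_sub (integrable_const 1) (iZ.const_mul θ), integral_const_mul,
            integral_const_mul]
          simp
      _ ≤ 1 + c := by
          have h1 := mul_le_mul_of_nonneg_left he hθ0
          have h2 := mul_le_mul_of_nonneg_left hv2 (by positivity : 0 ≤ θ ^ 2 / 2)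
          rw [hc]
          linarith
      _ ≤ Real.exp c := by linarith [Real.add_one_le_exp c]
  have hstep : ∀ (_ : Fin n) (u : Unit → ℝ),
      ∫⁻ x, expSup hT (fun s => u s + -(θ * Z x)) ∂κ ≤ ∫⁻ _ : E, expSup hT (fun s => u s + c) ∂κ := by
    intro _ u
    simp only [hexp, Real.exp_add (u ())]
    rw [lintegral_const, measure_univ, mul_one]
    have : ∀ x, ENNReal.ofReal (Real.exp (u ()) * Real.exp (-(θ * Z x))) =
        ENNReal.ofReal (Real.exp (u ())) * ENNReal.ofReal (Real.exp (-(θ * Z x))) := fun x =>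
      ENNReal.ofReal_mul (Real.exp_pos _).le
    simp only [this]
    rw [lintegral_const_mul _ (by fun_prop), ENNReal.ofReal_mul (Real.exp_pos _).le,
      ← ofReal_integral_eq_lintegral_ofReal iE (ae_of_all _ fun _ => (Real.exp_pos _).le)]
    gcongr
  have hprod := lintegral_expSup_pi_le hT (fun _ : Fin n => κ) (fun _ : Fin n => κ)
    (fun _ _ x => -(θ * Z x)) (fun _ _ _ => c) (fun _ _ => by fun_prop) (fun _ _ => by fun_prop)
    hstep (fun _ => 0)
  simp only [hexp, zero_add, Finset.sum_const, Finset.card_univ, Fintype.card_fin, nsmul_eq_mul,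
    lintegral_const, measure_univ, mul_one] at hprod
  have hsub : {x : Fin n → E | ∑ i, Z (x i) < n * (e - δ)} ⊆
      {x | ENNReal.ofReal (Real.exp (-(θ * (n * (e - δ))))) ≤
        ENNReal.ofReal (Real.exp (∑ i, -(θ * Z (x i))))} := by
    intro x hx
    refine ENNReal.ofReal_le_ofReal (Real.exp_le_exp.2 ?_)
    rw [Finset.sum_neg_distrib, ← Finset.mul_sum]
    exact neg_le_neg (mul_le_mul_of_nonneg_left (le_of_lt hx) hθ0)
  refine (measure_mono hsub).trans ?_
  have hmk := meas_ge_le_lintegral_div (μ := Measure.pi fun _ : Fin n => κ)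
    (f := fun x => ENNReal.ofReal (Real.exp (∑ i, -(θ * Z (x i)))))
    (by fun_prop : Measurable _).aemeasurable
    (ε := ENNReal.ofReal (Real.exp (-(θ * (n * (e - δ))))))
    (by simpa using Real.exp_pos _) ENNReal.ofReal_ne_top
  refine hmk.trans ((ENNReal.div_le_div_right hprod _).trans ?_)
  rw [← ENNReal.ofReal_div_of_pos (Real.exp_pos _), ← Real.exp_sub]
  refine ENNReal.ofReal_le_ofReal (Real.exp_le_exp.2 (le_of_eq ?_))
  rw [hc, hθ]
  field_simp
  ring

/-- With high probability, the truncated quadratic is bounded from below uniformly over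
directions, provided the sample covariance is bounded from above. -/
lemma exists_covariate_event (hX : ∀ a, MemLp (fun x : Fin p → ℝ => x a) 2 Pi) {k s c : ℝ}
    (hk : 0 < k) (hs : 0 < s) (hsc : s ≤ c)
    (hmin : ∀ a : EuclideanSpace ℝ (Fin p), s * ‖a‖ ^ 2 ≤ secondMoment Pi a)
    (hthird : ∀ a, secondMoment Pi a = 1 →
      Integrable (fun x => |lin a x| ^ 3) Pi ∧ ∫ x, |lin a x| ^ 3 ∂Pi ≤ 8 / 9 * k) :
    ∃ E : Set (Fin n → Fin p → ℝ), MeasurableSet E ∧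
      Measure.pi (fun _ : Fin n => Pi) Eᶜ ≤
        ENNReal.ofReal (Real.exp (5 * p * (c / s) - 3 * n / (5000 * k ^ 2))) ∧
      ∀ x ∈ E, (∀ b : EuclideanSpace ℝ (Fin p), ∑ i, lin b (x i) ^ 2 ≤ n * (c * ‖b‖ ^ 2)) →
        ∀ a, secondMoment Pi a = 1 → 7 / 25 * n ≤ ∑ i, hub k (lin a (x i)) := by
  have hc : 0 < c := hs.trans_le hsc
  -- Chosen so that the covariance bound makes the off-net error c‖a − a₀‖² at most 1/450, hence
  -- 1/100 after the factor 9/2 of `hub_le_add_sq`.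
  set ε : ℝ := √(s / (450 * c)) with hε
  have hε0 : 0 < ε := Real.sqrt_pos.2 (by positivity)
  have hε2 : ε ^ 2 = s / (450 * c) := Real.sq_sqrt (by positivity)
  obtain ⟨N, hN1, hN, hcard⟩ := exists_secondMoment_net hX hε0
  -- A lower bound for the mean: 1/2 − (8/9)/6 = 19/54. With the tail slack 1/50 and the net error
  -- 1/100, (8/9)(19/54 − 3/100) still exceeds 7/25.
  set e : ℝ := 19 / 54
  set δ : ℝ := 1 / 50
  have hmeas : ∀ a, Measurable fun x : Fin n → Fin p → ℝ => ∑ i, hub k (lin a (x i)) := fun a => by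
    have := (continuous_hub k).measurable
    fun_prop
  refine ⟨{x | ∀ a ∈ N, n * (e - δ) ≤ ∑ i, hub k (lin a (x i))}, ?_, ?_, ?_⟩
  · have : {x : Fin n → Fin p → ℝ | ∀ a ∈ N, n * (e - δ) ≤ ∑ i, hub k (lin a (x i))} =
        ⋂ a ∈ N, {x | n * (e - δ) ≤ ∑ i, hub k (lin a (x i))} := by ext; simp
    rw [this]
    exact Finset.measurableSet_biInter _ fun a _ => measurableSet_le measurable_const (hmeas a)
  · have hsub : {x : Fin n → Fin p → ℝ | ∀ a ∈ N, n * (e - δ) ≤ ∑ i, hub k (lin a (x i))}ᶜ ⊆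
        ⋃ a ∈ N, {x | ∑ i, hub k (lin a (x i)) < n * (e - δ)} := by
      intro x hx
      simp only [Set.mem_compl_iff, Set.mem_ofPred_eq, not_forall, not_le] at hx
      obtain ⟨a, ha, h⟩ := hx
      simp only [Set.mem_iUnion]
      exact ⟨a, ha, h⟩
    refine (measure_mono hsub).trans ((measure_biUnion_finset_le _ _).trans ?_)
    have each : ∀ a ∈ N, Measure.pi (fun _ : Fin n => Pi)
        {x | ∑ i, hub k (lin a (x i)) < n * (e - δ)} ≤
        ENNReal.ofReal (Real.exp (-(3 * n / (5000 * k ^ 2)))) := by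
      intro a ha
      have h1 := hN1 a ha
      obtain ⟨hi3, h3⟩ := hthird a h1
      have hi2 : Integrable (fun x => lin a x ^ 2) Pi := (memLp_lin hX a).integrable_sq
      have hmh : Measurable fun x => hub k (lin a x) := by
        have := (continuous_hub k).measurable
        fun_prop
      have hih : Integrable (fun x => hub k (lin a x)) Pi :=
        Integrable.of_bound hmh.aestronglyMeasurable (2 * k ^ 2 / 3) (ae_of_all _ fun x => by
          rw [Real.norm_of_nonneg (hub_nonneg hk _)]; exact hub_le_const hk _)
      have hmean : e ≤ ∫ x, hub k (lin a x) ∂Pi := by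
        have hintg : ∫ x, (lin a x ^ 2 / 2 - |lin a x| ^ 3 / (6 * k)) ∂Pi =
            secondMoment Pi a / 2 - (∫ x, |lin a x| ^ 3 ∂Pi) / (6 * k) := by
          rw [integral_sub (hi2.div_const 2) (hi3.div_const _), integral_div, integral_div]
          rfl
        have hle := integral_mono ((hi2.div_const 2).sub (hi3.div_const (6 * k))) hih
          fun x => sub_le_hub hk (lin a x)
        have hle' : ∫ x, (lin a x ^ 2 / 2 - |lin a x| ^ 3 / (6 * k)) ∂Pi ≤
          ∫ x, hub k (lin a x) ∂Pi := hle
        rw [hintg, h1] at hle'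
        have h4 : (∫ x, |lin a x| ^ 3 ∂Pi) / (6 * k) ≤ 4 / 27 := by
          rw [div_le_iff₀ (by positivity)]; linarith
        simp only [e]
        linarith
      have hsq : ∫ x, hub k (lin a x) ^ 2 ∂Pi ≤ k ^ 2 / 3 := by
        calc ∫ x, hub k (lin a x) ^ 2 ∂Pi ≤ ∫ x, (k ^ 2 / 3) * lin a x ^ 2 ∂Pi := by
              refine integral_mono ?_ (hi2.const_mul _) fun x => ?_
              · refine Integrable.of_bound (hmh.pow_const 2).aestronglyMeasurable
                  ((2 * k ^ 2 / 3) ^ 2) (ae_of_all _ fun x => ?_)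
                rw [Real.norm_of_nonneg (sq_nonneg _)]
                exact pow_le_pow_left₀ (hub_nonneg hk _) (hub_le_const hk _) 2
              · have g1 := hub_nonneg hk (lin a x)
                have g2 := hub_le_const hk (lin a x)
                have g3 := hub_le_sq hk (lin a x)
                simp only
                calc hub k (lin a x) ^ 2 = hub k (lin a x) * hub k (lin a x) := sq _
                  _ ≤ (2 * k ^ 2 / 3) * (lin a x ^ 2 / 2) := mul_le_mul g2 g3 g1 (by positivity)
                  _ = _ := by ring
          _ = k ^ 2 / 3 := by
              rw [integral_const_mul]
              have : ∫ x, lin a x ^ 2 ∂Pi = 1 := h1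
              rw [this, mul_one]
      have := measure_sum_le_of_nonneg (n := n) Pi hmh (fun x => hub_nonneg hk _)
        (fun x => hub_le_const hk _) hmean (by positivity) hsq (δ := δ) (by norm_num [δ])
      refine this.trans (le_of_eq ?_)
      congr 2
      simp only [δ]
      field_simp
      ring
    refine (Finset.sum_le_sum each).trans ?_
    rw [Finset.sum_const, nsmul_eq_mul, ← ENNReal.ofReal_natCast,
      ← ENNReal.ofReal_mul (Nat.cast_nonneg _)]
    apply ENNReal.ofReal_le_ofReal
    rw [sub_eq_add_neg, Real.exp_add]
    refine mul_le_mul_of_nonneg_right (hcard.trans ?_) (Real.exp_pos _).le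
    have hχ : 1 ≤ c / s := by rw [le_div_iff₀ hs]; linarith
    -- 2√(450·c/s) ≤ 43·c/s because c/s ≥ 1; then 1 + 43·c/s ≤ 44·c/s ≤ e⁴·e^{c/s} ≤ e^{5c/s} bounds
    -- the base of the net cardinality.
    have hinv : 2 / ε ≤ 43 * (c / s) := by
      rw [div_le_iff₀ hε0]
      have hsq : (2 : ℝ) ^ 2 ≤ (43 * (c / s) * ε) ^ 2 := by
        rw [mul_pow, hε2]
        have : (43 * (c / s)) ^ 2 * (s / (450 * c)) = 1849 / 450 * (c / s) := by
          field_simp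
          norm_num
        rw [this]
        linarith
      exact le_of_sq_le_sq hsq (by positivity)
    have h54 : (44 : ℝ) ≤ Real.exp 4 := by
      have h := Real.exp_one_gt_d9
      have e4 : Real.exp 4 = Real.exp 1 ^ 4 := by rw [← Real.exp_nat_mul]; norm_num
      rw [e4]
      calc (44 : ℝ) ≤ 2.7 ^ 4 := by norm_num
        _ ≤ _ := pow_le_pow_left₀ (by norm_num) (by linarith) 4
    have hb : 1 + 2 / ε ≤ Real.exp (5 * (c / s)) := by
      calc 1 + 2 / ε ≤ 44 * (c / s) := by linarith
        _ ≤ Real.exp 4 * Real.exp (c / s) :=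
            mul_le_mul h54 (by linarith [Real.add_one_le_exp (c / s)]) (by positivity)
              (Real.exp_pos _).le
        _ = Real.exp (4 + c / s) := (Real.exp_add _ _).symm
        _ ≤ _ := Real.exp_le_exp.2 (by linarith)
    calc (1 + 2 / ε) ^ p ≤ Real.exp (5 * (c / s)) ^ p := pow_le_pow_left₀ (by positivity) hb p
      _ = _ := by rw [← Real.exp_nat_mul]; congr 1; ring
  · intro x hx hcov a ha
    obtain ⟨a0, ha0, hd⟩ := hN a ha
    have h1 : n * (e - δ) ≤ ∑ i, hub k (lin a0 (x i)) := hx a0 ha0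
    have h2 : ∑ i, hub k (lin a0 (x i)) ≤
        ∑ i, (9 / 8 * hub k (lin a (x i)) + 9 / 2 * lin (a - a0) (x i) ^ 2) :=
      Finset.sum_le_sum fun i _ => by rw [lin_sub]; exact hub_le_add_sq hk _ _
    rw [Finset.sum_add_distrib, ← Finset.mul_sum, ← Finset.mul_sum] at h2
    have h3 := hcov (a - a0)
    have h4 : c * ‖a - a0‖ ^ 2 ≤ 1 / 450 := by
      have h5 := (hmin (a - a0)).trans hd
      rw [hε2, le_div_iff₀ (by positivity)] at h5
      have h6 : s * (450 * (c * ‖a - a0‖ ^ 2)) ≤ s * 1 := by linarith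
      have := le_of_mul_le_mul_left h6 hs
      linarith
    have h5 : (n : ℝ) * (c * ‖a - a0‖ ^ 2) ≤ n * (1 / 450) :=
      mul_le_mul_of_nonneg_left h4 (Nat.cast_nonneg _)
    have hn : (0 : ℝ) ≤ n := Nat.cast_nonneg _
    simp only [e, δ] at h1
    linarith

end Covariates

end MQR

end

noncomputable section

namespace MQR

open scoped RealInnerProductSpace

/-! ### Third moments of linear functionals -/

section ThirdMoment

variable {p m : ℕ}

/-- A vector with a large coordinate whose component in the row space is not negligible. -/
lemma exists_near_rowSpace (Γ : Matrix (Fin p) (Fin m) ℝ) (hr : 0 < Γ.rank) :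
    ∃ (w : EuclideanSpace ℝ (Fin m)) (j : Fin m), ‖w‖ ^ 2 ≤ 16 ∧ 3 ≤ w j ∧
      ‖Matrix.toEuclideanLin (1 - colProj Γ.transpose) w‖ ≤
        3 * ‖Matrix.toEuclideanLin (colProj Γ.transpose) w‖ := by
  have hm : 0 < m := hr.trans_le (Γ.rank_le_width)
  set L := LinearMap.range (Matrix.toEuclideanLin Γ.transpose)
  obtain ⟨v₀, hv₀, hne⟩ : ∃ v ∈ L, v ≠ 0 := by
    refine Submodule.exists_mem_ne_zero_of_ne_bot fun h => ?_
    have h1 := finrank_range_toEuclideanLin Γ.transpose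
    rw [Matrix.rank_transpose] at h1
    have h2 : Module.finrank ℝ L = Γ.rank := h1
    rw [h, finrank_bot] at h2
    omega
  let j : Fin m := ⟨0, hm⟩
  obtain ⟨v, hv, hv1, hvj⟩ : ∃ v ∈ L, ‖v‖ = 1 ∧ 0 ≤ v j := by
    have h1 : ‖(‖v₀‖⁻¹ • v₀)‖ = 1 := norm_smul_inv_norm (𝕜 := ℝ) hne
    rcases le_total 0 ((‖v₀‖⁻¹ • v₀) j) with h | h
    · exact ⟨_, L.smul_mem _ hv₀, h1, h⟩
    · refine ⟨-(‖v₀‖⁻¹ • v₀), L.neg_mem (L.smul_mem _ hv₀), by rw [norm_neg, h1], ?_⟩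
      rw [PiLp.neg_apply]
      linarith
  have hvj1 : v j ≤ 1 := by
    rw [← hv1]
    exact (le_abs_self _).trans (PiLp.norm_apply_le v j)
  have hPv : Matrix.toEuclideanLin (colProj Γ.transpose) v = v := by
    rw [toEuclideanLin_colProj, Submodule.starProjection_eq_self_iff]
    exact hv
  have hP : IsOrthProj (colProj Γ.transpose) := isOrthProj_colProj _
  set e : EuclideanSpace ℝ (Fin m) := EuclideanSpace.single j 1
  have he : ‖e‖ = 1 := by simp [e]
  have hve : ⟪v, e⟫ = v j := by
    simp only [e, EuclideanSpace.inner_single_right]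
    simp
  have hinner : ⟪v, v + (3 : ℝ) • e⟫ = 1 + 3 * v j := by
    rw [inner_add_right, inner_smul_right, real_inner_self_eq_norm_sq, hv1, hve]
    norm_num
  -- A unit row-space vector plus three times a coordinate vector. Only the latter has a part
  -- outside the row space, of norm at most 3. Since v j ≥ 0, the row-space part has norm at least 1
  -- and coordinate j is at least 3, while v j ≤ 1 keeps the squared norm at most 16.
  refine ⟨v + (3 : ℝ) • e, j, ?_, ?_, ?_⟩
  · rw [norm_add_sq_real, inner_smul_right, hve, norm_smul, he, hv1]
    norm_num
    linarith
  · simp [e]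
    linarith
  · have h1 : ‖Matrix.toEuclideanLin (1 - colProj Γ.transpose) (v + (3 : ℝ) • e)‖ ≤ 3 := by
      have : Matrix.toEuclideanLin (1 - colProj Γ.transpose) v = 0 := by
        rw [map_sub, LinearMap.sub_apply, hPv]
        simp [Matrix.toEuclideanLin, Matrix.toLpLin]
      rw [map_add, this, zero_add]
      refine (hP.one_sub.norm_le _).trans ?_
      rw [norm_smul, he]
      norm_num
    have h2 : 1 ≤ ‖Matrix.toEuclideanLin (colProj Γ.transpose) (v + (3 : ℝ) • e)‖ := by
      have h := real_inner_le_norm v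
        (Matrix.toEuclideanLin (colProj Γ.transpose) (v + (3 : ℝ) • e))
      rw [hv1, one_mul, toEuclideanLin_colProj, ← Submodule.inner_starProjection_left_eq_right,
        ← toEuclideanLin_colProj, hPv, hinner] at h
      rw [toEuclideanLin_colProj]
      linarith
    linarith

lemma linPred_vecMulVec (a : EuclideanSpace ℝ (Fin p)) (w : EuclideanSpace ℝ (Fin m)) (j : Fin m)
    (x : Fin p → ℝ) : linPred (Matrix.vecMulVec (a : Fin p → ℝ) (w : Fin m → ℝ)) j x =
      w j * lin a x := by
  simp only [linPred, lin, Matrix.vecMulVec_apply, Finset.mul_sum]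
  exact Finset.sum_congr rfl fun i _ => by ring

variable {Pi : Measure (Fin p → ℝ)}

/-- A positive nonlinearity constant forces a bound on the third moments of all linear functionals:
the cone contains the rank-one matrices `a wᵀ` for suitable `w` and all `a`. -/
lemma third_moment_le {Γ : Matrix (Fin p) (Fin m) ℝ} (hr : 0 < Γ.rank) {fLow fDer t : ℝ}
    (hfl : 0 < fLow) (ht : 0 < t) (hν : ENNReal.ofReal t < nonlinConst Pi Γ fLow fDer) :
    0 < fDer ∧ ∀ a : EuclideanSpace ℝ (Fin p), secondMoment Pi a = 1 →
      Integrable (fun x => |lin a x| ^ 3) Pi ∧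
        ∫ x, |lin a x| ^ 3 ∂Pi ≤ 8 / 9 * (fLow / fDer / (√m * t)) := by
  have hm : 0 < m := hr.trans_le Γ.rank_le_width
  have hmR : (0 : ℝ) < m := Nat.cast_pos.2 hm
  have hD : 0 < fDer := by
    -- If fDer ≤ 0, the prefactor of the nonlinearity constant is zero in `ENNReal` (division by
    -- zero included), which contradicts its being above t.
    by_contra h
    have : fLow / fDer ≤ 0 := div_nonpos_of_nonneg_of_nonpos hfl.le (not_lt.1 h)
    have h0 : ENNReal.ofReal (3 / 8 * (fLow / fDer)) = 0 :=
      ENNReal.ofReal_of_nonpos (by linarith)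
    rw [nonlinConst, h0, zero_mul] at hν
    exact not_lt_bot hν
  refine ⟨hD, fun a ha => ?_⟩
  set κ := fLow / fDer with hκ
  have hκ0 : 0 < κ := div_pos hfl hD
  obtain ⟨w, j, hw, hwj, hcone⟩ := exists_near_rowSpace Γ hr
  -- For this competitor the numerator of the ratio is at most 64/m^{3/2} and the denominator at
  -- least 27·E|Xᵀa|³/m. With the prefactor 3/8 this gives the constant (3/8)(64/27) = 8/9.
  set Δ := Matrix.vecMulVec (a : Fin p → ℝ) (w : Fin m → ℝ) with hΔ
  have hmem : Δ ∈ cone Γ 3 := vecMulVec_mem_cone Γ a w hcone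
  have hne : Δ ≠ 0 := by
    intro h0
    have hlin : ∀ x, lin a x = 0 := fun x => by
      have h1 : linPred Δ j x = w j * lin a x := linPred_vecMulVec a w j x
      rw [h0] at h1
      have h2 : w j * lin a x = 0 := by rw [← h1]; simp [linPred]
      exact (mul_eq_zero.1 h2).resolve_left (by linarith)
    simp [secondMoment, hlin] at ha
  have hnorm : normL2 Pi Δ ≤ 4 / √m := by
    have : ∀ x, ∑ k, linPred Δ k x ^ 2 = ‖w‖ ^ 2 * lin a x ^ 2 := fun x => by
      rw [EuclideanSpace.real_norm_sq_eq, Finset.sum_mul]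
      exact Finset.sum_congr rfl fun k _ => by rw [hΔ, linPred_vecMulVec, mul_pow]
    rw [normL2]
    simp only [this, integral_const_mul]
    have h1 : ∫ x, lin a x ^ 2 ∂Pi = 1 := ha
    rw [h1, mul_one, Real.sqrt_le_left (by positivity), div_pow, Real.sq_sqrt hmR.le,
      inv_mul_eq_div]
    exact div_le_div_of_nonneg_right (by linarith) hmR.le
  set I := ∫⁻ x, ENNReal.ofReal (|lin a x| ^ 3) ∂Pi with hI
  have hden : (m : ℝ≥0∞)⁻¹ * (ENNReal.ofReal 27 * I) ≤
      (m : ℝ≥0∞)⁻¹ * ∑ k, ∫⁻ x, ENNReal.ofReal (|linPred Δ k x| ^ 3) ∂Pi := by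
    gcongr
    refine le_trans ?_ (Finset.single_le_sum
      (f := fun k => ∫⁻ x, ENNReal.ofReal (|linPred Δ k x| ^ 3) ∂Pi) (fun _ _ => zero_le)
      (Finset.mem_univ j))
    rw [hI, ← lintegral_const_mul _ (by fun_prop)]
    refine lintegral_mono fun x => ?_
    rw [← ENNReal.ofReal_mul (by norm_num)]
    apply ENNReal.ofReal_le_ofReal
    rw [hΔ, linPred_vecMulVec, abs_mul, mul_pow]
    gcongr
    have : (3 : ℝ) ≤ |w j| := hwj.trans (le_abs_self _)
    calc (27 : ℝ) = 3 ^ 3 := by norm_num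
      _ ≤ _ := by gcongr
  have hle : ENNReal.ofReal t ≤ ENNReal.ofReal (3 / 8 * κ) * (ENNReal.ofReal ((4 / √m) ^ 3) /
      ((m : ℝ≥0∞)⁻¹ * (ENNReal.ofReal 27 * I))) := by
    refine hν.le.trans ?_
    rw [nonlinConst]
    gcongr
    refine (iInf₂_le Δ ⟨hmem, hne⟩).trans (ENNReal.div_le_div ?_ hden)
    rw [← ENNReal.ofReal_pow (show 0 ≤ normL2 Pi Δ from Real.sqrt_nonneg _)]
    exact ENNReal.ofReal_le_ofReal (pow_le_pow_left₀ (Real.sqrt_nonneg _) hnorm 3)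
  have hmul : ENNReal.ofReal (t * (m : ℝ)⁻¹ * 27) * I ≤
      ENNReal.ofReal (3 / 8 * κ * (4 / √m) ^ 3) := by
    rw [← mul_div_assoc] at hle
    have h1 := ENNReal.mul_le_of_le_div hle
    rw [ENNReal.ofReal_mul (by positivity), ENNReal.ofReal_mul (by positivity),
      ENNReal.ofReal_mul (by positivity), ENNReal.ofReal_inv_of_pos hmR, ENNReal.ofReal_natCast]
    refine le_trans (le_of_eq ?_) h1
    ring
  have hIfin : I ≠ ∞ := by
    intro h
    rw [h, ENNReal.mul_top (by
      rw [Ne, ENNReal.ofReal_eq_zero, not_le]; positivity)] at hmul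
    exact ENNReal.ofReal_ne_top (top_le_iff.1 hmul)
  have hintg : Integrable (fun x => |lin a x| ^ 3) Pi := by
    refine ⟨(by fun_prop : Measurable _).aestronglyMeasurable, ?_⟩
    rw [hasFiniteIntegral_iff_ofReal (ae_of_all _ fun x => by positivity)]
    exact lt_top_iff_ne_top.2 hIfin
  refine ⟨hintg, ?_⟩
  have hIeq : I = ENNReal.ofReal (∫ x, |lin a x| ^ 3 ∂Pi) := by
    rw [ofReal_integral_eq_lintegral_ofReal hintg (ae_of_all _ fun x => by positivity)]
  rw [hIeq, ← ENNReal.ofReal_mul (by positivity),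
    ENNReal.ofReal_le_ofReal_iff (by positivity)] at hmul
  have hsq : √(m : ℝ) ^ 2 = m := Real.sq_sqrt hmR.le
  have hsp : 0 < √(m : ℝ) := Real.sqrt_pos.2 hmR
  generalize hJ : ∫ x, |lin a x| ^ 3 ∂Pi = J at *
  rw [← mul_div_assoc, le_div_iff₀ (by positivity)]
  have h3 : t * (√(m : ℝ) ^ 2)⁻¹ * 27 * J * √m ^ 3 ≤ 3 / 8 * κ * (4 / √m) ^ 3 * √m ^ 3 := by
    rw [hsq]
    exact mul_le_mul_of_nonneg_right hmul (by positivity)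
  have e1 : t * (√(m : ℝ) ^ 2)⁻¹ * 27 * J * √m ^ 3 = 27 * (J * (√m * t)) := by
    field_simp
  have e2 : 3 / 8 * κ * (4 / √(m : ℝ)) ^ 3 * √m ^ 3 = 24 * κ := by
    field_simp; ring
  linarith

end ThirdMoment

end MQR

end

noncomputable section

namespace MQR

/-! ### Conditioning the sample on the covariates -/

section Conditioning

variable {n : ℕ}

/-- The product kernel `x ↦ ⨂ᵢ κ (x i)`. -/
def piKernel {α β : Type*} [MeasurableSpace α] [MeasurableSpace β] (n : ℕ) (κ : Kernel α β)
    [IsMarkovKernel κ] : Kernel (Fin n → α) (Fin n → β) where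
  toFun x := Measure.pi fun i => κ (x i)
  measurable' := by
    refine Measurable.measure_of_isPiSystem_of_isProbabilityMeasure generateFrom_pi.symm
      isPiSystem_pi ?_
    rintro _ ⟨s, hs, rfl⟩
    simp only [Measure.pi_pi]
    exact Finset.measurable_prod _ fun i _ =>
      (κ.measurable_coe (hs i (Set.mem_univ i))).comp (measurable_pi_apply i)

variable {α β : Type*} [MeasurableSpace α] [MeasurableSpace β]

lemma piKernel_apply (κ : Kernel α β) [IsMarkovKernel κ] (x : Fin n → α) :
    piKernel n κ x = Measure.pi fun i => κ (x i) := rfl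

instance (κ : Kernel α β) [IsMarkovKernel κ] : IsMarkovKernel (piKernel n κ) :=
  ⟨fun x => by rw [piKernel_apply]; infer_instance⟩

lemma measurable_zipPi : Measurable fun (z : (Fin n → α) × (Fin n → β)) (i : Fin n) =>
    (z.1 i, z.2 i) := by
  fun_prop

/-- A product of disintegrated measures is disintegrated by the product kernel. -/
lemma pi_compProd (μ : Measure α) [IsProbabilityMeasure μ] (κ : Kernel α β) [IsMarkovKernel κ] :
    Measure.pi (fun _ : Fin n => μ ⊗ₘ κ) =
      ((Measure.pi fun _ : Fin n => μ) ⊗ₘ piKernel n κ).map fun z i => (z.1 i, z.2 i) := by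
  refine Measure.pi_eq fun s hs => ?_
  rw [Measure.map_apply measurable_zipPi (MeasurableSet.univ_pi hs),
    Measure.compProd_apply (measurable_zipPi (MeasurableSet.univ_pi hs))]
  have h1 : ∀ x : Fin n → α, piKernel n κ x (Prod.mk x ⁻¹'
      ((fun (z : (Fin n → α) × (Fin n → β)) i => (z.1 i, z.2 i)) ⁻¹' Set.univ.pi s)) =
      ∏ i, κ (x i) (Prod.mk (x i) ⁻¹' s i) := fun x => by
    rw [piKernel_apply, ← Measure.pi_pi]
    congr 1
  simp only [h1]
  have hm : ∀ i, Measurable fun a => κ a (Prod.mk a ⁻¹' s i) := fun i =>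
    Kernel.measurable_kernel_prodMk_left (hs i)
  -- On rectangles the integrand is a product of functions of separate coordinates, which are
  -- independent under the product measure.
  rw [lintegral_prod_eq_prod_lintegral_of_indepFun Finset.univ
    (fun i (x : Fin n → α) => κ (x i) (Prod.mk (x i) ⁻¹' s i))
    (iIndepFun_pi (μ := fun _ : Fin n => μ) (X := fun i a => κ a (Prod.mk a ⁻¹' s i))
      fun i => (hm i).aemeasurable)
    (fun i => (hm i).comp (measurable_pi_apply i))]
  refine Finset.prod_congr rfl fun i _ => ?_
  rw [Measure.compProd_apply (hs i)]
  exact (measurePreserving_eval (fun _ : Fin n => μ) i).lintegral_comp (hm i)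

end Conditioning

/-! ### Conditional laws of the responses and deviations under a random design -/

section ConditionalLaw

variable {n p m : ℕ} (P : Measure ((Fin p → ℝ) × (Fin m → ℝ))) [IsProbabilityMeasure P]

instance (j : Fin m) (x : Fin p → ℝ) : IsProbabilityMeasure (condLaw P j x) :=
  Measure.isProbabilityMeasure_map (measurable_pi_apply j).aemeasurable

lemma measurable_linPred (S : Matrix (Fin p) (Fin m) ℝ) (j : Fin m) :
    Measurable (linPred S j) := by
  unfold linPred
  fun_prop

lemma continuous_linPred (j : Fin m) (x : Fin p → ℝ) :
    Continuous fun S : Matrix (Fin p) (Fin m) ℝ => linPred S j x := by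
  unfold linPred
  fun_prop

lemma measurable_integral_condLaw {g : (Fin p → ℝ) → ℝ → ℝ} (hg : Measurable (Function.uncurry g))
    (j : Fin m) : Measurable fun x => ∫ y, g x y ∂condLaw P j x := by
  have h : ∀ x, ∫ y, g x y ∂condLaw P j x = ∫ y, g x (y j) ∂P.condKernel x := fun x => by
    rw [condLaw, integral_map (measurable_pi_apply j).aemeasurable]
    exact (hg.comp measurable_prodMk_left).aestronglyMeasurable
  simp only [h]
  refine (StronglyMeasurable.integral_kernel_prod_right (κ := P.condKernel)
    (f := fun x (y : Fin m → ℝ) => g x (y j)) ?_).measurable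
  exact (hg.comp (measurable_fst.prodMk
    ((measurable_pi_apply j).comp measurable_snd))).stronglyMeasurable

variable {P}

lemma pi_condKernel_ae (hci : CondIndepResponses P) :
    ∀ᵐ x ∂Measure.pi (fun _ : Fin n => P.fst), ∀ i,
      P.condKernel (x i) = Measure.pi fun j => condLaw P j (x i) :=
  ae_all_iff.2 fun i => (Measure.quasiMeasurePreserving_eval (fun _ : Fin n => P.fst) i).ae hci

/-- Conditionally on the covariates the responses of the sample are independent. -/
lemma pi_apply_le_of_condLaw (hci : CondIndepResponses P)
    {B : Set (Fin n → (Fin p → ℝ) × (Fin m → ℝ))} (hB : MeasurableSet B) {ε : ℝ≥0∞}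
    (h : ∀ x : Fin n → Fin p → ℝ, Measure.pi (fun i => Measure.pi fun j => condLaw P j (x i))
      {y | (fun i => (x i, y i)) ∈ B} ≤ ε) :
    Measure.pi (fun _ : Fin n => P) B ≤ ε := by
  have hP : P = P.fst ⊗ₘ P.condKernel := (P.disintegrate P.condKernel).symm
  have h1 : Measure.pi (fun _ : Fin n => P) =
      ((Measure.pi fun _ : Fin n => P.fst) ⊗ₘ piKernel n P.condKernel).map
        fun z i => (z.1 i, z.2 i) := by
    rw [← pi_compProd, ← hP]
  rw [h1, Measure.map_apply measurable_zipPi hB, Measure.compProd_apply (measurable_zipPi hB)]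
  calc _ ≤ ∫⁻ _, ε ∂(Measure.pi fun _ : Fin n => P.fst) := by
        refine lintegral_mono_ae ?_
        filter_upwards [pi_condKernel_ae hci] with x hx
        rw [piKernel_apply]
        simp only [hx]
        exact h x
    _ = ε := by simp

lemma isClosed_design (V : ℝ) : IsClosed {x : Fin n → Fin p → ℝ |
    ∀ a : EuclideanSpace ℝ (Fin p), ∑ i, lin a (x i) ^ 2 ≤ V * ‖a‖ ^ 2} := by
  have : {x : Fin n → Fin p → ℝ |
      ∀ a : EuclideanSpace ℝ (Fin p), ∑ i, lin a (x i) ^ 2 ≤ V * ‖a‖ ^ 2} =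
      ⋂ a : EuclideanSpace ℝ (Fin p), {x | ∑ i, lin a (x i) ^ 2 ≤ V * ‖a‖ ^ 2} := by
    ext; simp
  rw [this]
  refine isClosed_iInter fun a => isClosed_le ?_ continuous_const
  have := continuous_lin a
  fun_prop

/-- Uniform deviations over a nuclear ball, for the random design. -/
lemma exists_process_event (hp : 0 < p) (hm : 0 < m) (hci : CondIndepResponses P)
    (Γ : Matrix (Fin p) (Fin m) ℝ) {V B t : ℝ} (hB : 0 < B) (hV : 0 < V) (ht : 0 ≤ t)
    (g : ℝ → ℝ → ℝ → ℝ) (hg : Measurable fun z : ℝ × ℝ × ℝ => g z.1 z.2.1 z.2.2)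
    (hl : ∀ q d d' y, |g q d y - g q d' y| ≤ |d - d'|) (h0 : ∀ q y, g q 0 y = 0) :
    ∃ G : Set (Fin n → (Fin p → ℝ) × (Fin m → ℝ)), MeasurableSet G ∧
      Measure.pi (fun _ : Fin n => P) Gᶜ ≤
        ENNReal.ofReal (9 ^ (p + m) * Real.exp (-(t ^ 2 / (32 * B ^ 2 * V)))) ∧
      ∀ z ∈ G, (∀ a : EuclideanSpace ℝ (Fin p), ∑ i, lin a (z i).1 ^ 2 ≤ V * ‖a‖ ^ 2) →
        ∀ Δ : Matrix (Fin p) (Fin m) ℝ, nuclearNorm Δ ≤ B →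
          ∑ i, ∑ j, (∫ y, g (linPred Γ j (z i).1) (linPred Δ j (z i).1) y ∂condLaw P j (z i).1 -
            g (linPred Γ j (z i).1) (linPred Δ j (z i).1) ((z i).2 j)) ≤ t := by
  have : SecondCountableTopology (Matrix (Fin p) (Fin m) ℝ) :=
    inferInstanceAs (SecondCountableTopology (Fin p → Fin m → ℝ))
  set S : Set (Matrix (Fin p) (Fin m) ℝ) := {Δ | nuclearNorm Δ ≤ B} with hS
  -- A countable dense subset of the nuclear ball makes the exceptional event measurable; continuity
  -- in Δ recovers the whole ball afterwards.
  obtain ⟨D₀, hD₀c, hD₀d⟩ := TopologicalSpace.exists_countable_dense S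
  set D : Set (Matrix (Fin p) (Fin m) ℝ) := Subtype.val '' D₀ with hD
  have hDc : D.Countable := hD₀c.image _
  have hDB : ∀ Δ ∈ D, nuclearNorm Δ ≤ B := by
    rintro _ ⟨Δ, -, rfl⟩
    exact Δ.2
  have hDS : S ⊆ closure D := fun Δ hΔ => by
    have := hD₀d ⟨Δ, hΔ⟩
    rw [closure_subtype] at this
    exact this
  set Φ : Matrix (Fin p) (Fin m) ℝ → (Fin n → (Fin p → ℝ) × (Fin m → ℝ)) → ℝ := fun Δ z =>
    ∑ i, ∑ j, (∫ y, g (linPred Γ j (z i).1) (linPred Δ j (z i).1) y ∂condLaw P j (z i).1 -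
      g (linPred Γ j (z i).1) (linPred Δ j (z i).1) ((z i).2 j)) with hΦ
  have hmΦ : ∀ Δ, Measurable (Φ Δ) := fun Δ => by
    refine Finset.measurable_sum _ fun i _ => Finset.measurable_sum _ fun j _ => Measurable.sub ?_ ?_
    · have h1 : Measurable (Function.uncurry fun (x : Fin p → ℝ) (y : ℝ) =>
          g (linPred Γ j x) (linPred Δ j x) y) := by
        exact hg.comp (((measurable_linPred Γ j).comp measurable_fst).prodMk
          (((measurable_linPred Δ j).comp measurable_fst).prodMk measurable_snd))
      exact (measurable_integral_condLaw P h1 j).comp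
        (measurable_fst.comp (measurable_pi_apply i))
    · have h1 : Measurable fun z : Fin n → (Fin p → ℝ) × (Fin m → ℝ) => (z i).1 :=
        measurable_fst.comp (measurable_pi_apply i)
      have h2 : Measurable fun z : Fin n → (Fin p → ℝ) × (Fin m → ℝ) => (z i).2 j :=
        (measurable_pi_apply j).comp (measurable_snd.comp (measurable_pi_apply i))
      exact hg.comp (((measurable_linPred Γ j).comp h1).prodMk
        (((measurable_linPred Δ j).comp h1).prodMk h2))
  have hmeas_d : ∀ q d, Measurable (g q d) := fun q d =>
    hg.comp (measurable_const.prodMk (measurable_const.prodMk measurable_id))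
  have hintg : ∀ (Q : Measure ℝ) [IsProbabilityMeasure Q] (q d : ℝ), Integrable (g q d) Q :=
    fun Q _ q d => Integrable.of_bound (hmeas_d q d).aestronglyMeasurable |d|
      (ae_of_all _ fun y => by simpa [h0] using hl q d 0 y)
  have hcont : ∀ z, Continuous fun Δ => Φ Δ z := fun z => by
    refine continuous_finsetSum _ fun i _ => continuous_finsetSum _ fun j _ =>
      Continuous.sub ?_ ?_
    · have : LipschitzWith 1 fun d =>
          ∫ y, g (linPred Γ j (z i).1) d y ∂condLaw P j (z i).1 := by
        refine LipschitzWith.of_dist_le_mul fun d d' => ?_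
        rw [Real.dist_eq, Real.dist_eq, NNReal.coe_one, one_mul, ← integral_sub (hintg _ _ _) (hintg _ _ _),
          ← Real.norm_eq_abs]
        refine (norm_integral_le_of_norm_le_const (C := |d - d'|)
          (ae_of_all _ fun y => hl _ d d' y)).trans ?_
        simp
      exact this.continuous.comp (continuous_linPred j _)
    · have : LipschitzWith 1 fun d => g (linPred Γ j (z i).1) d ((z i).2 j) := by
        refine LipschitzWith.of_dist_le_mul fun d d' => ?_
        rw [Real.dist_eq, Real.dist_eq]
        simpa using hl _ d d' _
      exact this.continuous.comp (continuous_linPred j _)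
  have hmX : Measurable fun (z : Fin n → (Fin p → ℝ) × (Fin m → ℝ)) i => (z i).1 := by fun_prop
  set E : Set (Fin n → (Fin p → ℝ) × (Fin m → ℝ)) := (fun z i => (z i).1) ⁻¹' {x |
    ∀ a : EuclideanSpace ℝ (Fin p), ∑ i, lin a (x i) ^ 2 ≤ V * ‖a‖ ^ 2} with hE
  have hmE : MeasurableSet E := hmX (isClosed_design V).measurableSet
  have hmB : MeasurableSet {z | ∃ Δ ∈ D, t < Φ Δ z} := by
    have : {z | ∃ Δ ∈ D, t < Φ Δ z} = ⋃ Δ ∈ D, {z | t < Φ Δ z} := by ext; simp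
    rw [this]
    exact MeasurableSet.biUnion hDc fun Δ _ => measurableSet_lt measurable_const (hmΦ Δ)
  -- The exceptional set is intersected with the design condition, so that its conditional
  -- probability is small for every design: where the condition fails, the section is empty.
  refine ⟨(E ∩ {z | ∃ Δ ∈ D, t < Φ Δ z})ᶜ, (hmE.inter hmB).compl, ?_, ?_⟩
  · rw [compl_compl]
    refine pi_apply_le_of_condLaw hci (hmE.inter hmB) fun x => ?_
    by_cases hx : ∀ a : EuclideanSpace ℝ (Fin p), ∑ i, lin a (x i) ^ 2 ≤ V * ‖a‖ ^ 2
    · refine le_trans (measure_mono fun y hy => ?_) (measure_process_gt_le hp hm x hB hV hx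
        (fun i j => condLaw P j (x i)) (fun i j => g (linPred Γ j (x i)))
        (fun i j d => hmeas_d _ d) (fun i j => hl _) (fun i j => h0 _) hDc hDB ht)
      exact hy.2
    · refine (measure_mono_null (t := ∅) (fun y hy => ?_) measure_empty).le.trans zero_le
      exact (hx hy.1).elim
  · intro z hz hx Δ hΔ
    have hclosed : IsClosed {Δ | Φ Δ z ≤ t} := isClosed_le (hcont z) continuous_const
    refine closure_minimal (fun Δ' hΔ' => ?_) hclosed (hDS hΔ)
    by_contra hlt
    exact hz ⟨hx, Δ', hΔ', not_le.1 hlt⟩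

end ConditionalLaw

end MQR

end

noncomputable section

namespace MQR

/-! ### Deterministic analysis of the estimator -/

section Deterministic

variable {n p m : ℕ}

/-- The `j`-th column of a matrix. -/
def colVec (S : Matrix (Fin p) (Fin m) ℝ) (j : Fin m) : EuclideanSpace ℝ (Fin p) :=
  WithLp.toLp 2 fun a => S a j

lemma linPred_eq_lin (S : Matrix (Fin p) (Fin m) ℝ) (j : Fin m) (x : Fin p → ℝ) :
    linPred S j x = lin (colVec S j) x := rfl

lemma linPred_add (S T : Matrix (Fin p) (Fin m) ℝ) (j : Fin m) (x : Fin p → ℝ) :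
    linPred (S + T) j x = linPred S j x + linPred T j x := by
  simp [linPred, mul_add, Finset.sum_add_distrib]

lemma linPred_smul (c : ℝ) (S : Matrix (Fin p) (Fin m) ℝ) (j : Fin m) (x : Fin p → ℝ) :
    linPred (c • S) j x = c * linPred S j x := by
  simp only [linPred, Finset.mul_sum, Matrix.smul_apply, smul_eq_mul]
  exact Finset.sum_congr rfl fun i _ => by ring

lemma sum_norm_colVec_sq (S : Matrix (Fin p) (Fin m) ℝ) :
    ∑ j, ‖colVec S j‖ ^ 2 = frobNorm S ^ 2 := by
  have h0 : 0 ≤ ∑ a, ∑ j, S a j ^ 2 :=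
    Finset.sum_nonneg fun _ _ => Finset.sum_nonneg fun _ _ => sq_nonneg _
  rw [frobNorm, Real.sq_sqrt h0, Finset.sum_comm]
  exact Finset.sum_congr rfl fun j _ => by rw [EuclideanSpace.real_norm_sq_eq]; rfl

/-! ### The L₂ norm, columnwise -/

section Norms

variable {Pi : Measure (Fin p → ℝ)}

lemma normL2_nonneg (S : Matrix (Fin p) (Fin m) ℝ) : 0 ≤ normL2 Pi S := Real.sqrt_nonneg _

lemma normL2_smul {c : ℝ} (hc : 0 ≤ c) (S : Matrix (Fin p) (Fin m) ℝ) :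
    normL2 Pi (c • S) = c * normL2 Pi S := by
  simp only [normL2, linPred_smul, mul_pow, ← Finset.mul_sum, integral_const_mul]
  rw [← mul_assoc, mul_comm (m : ℝ)⁻¹, mul_assoc, Real.sqrt_mul (sq_nonneg c), Real.sqrt_sq hc]

lemma sum_secondMoment (hm : 0 < m) (hX : ∀ a, MemLp (fun x : Fin p → ℝ => x a) 2 Pi)
    (S : Matrix (Fin p) (Fin m) ℝ) :
    ∑ j, secondMoment Pi (colVec S j) = m * normL2 Pi S ^ 2 := by
  have hmR : (0 : ℝ) < m := Nat.cast_pos.2 hm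
  rw [normL2, Real.sq_sqrt (mul_nonneg (by positivity) (integral_nonneg fun x =>
    Finset.sum_nonneg fun j _ => sq_nonneg _)), integral_finsetSum _ fun j _ => ?_, ← mul_assoc,
    mul_inv_cancel₀ hmR.ne', one_mul]
  · rfl
  · exact (memLp_lin hX (colVec S j)).integrable_sq

lemma frobNorm_le_normL2 (hm : 0 < m) (hX : ∀ a, MemLp (fun x : Fin p → ℝ => x a) 2 Pi) {s : ℝ}
    (hs : 0 < s) (hmin : ∀ a : EuclideanSpace ℝ (Fin p), s * ‖a‖ ^ 2 ≤ secondMoment Pi a)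
    (S : Matrix (Fin p) (Fin m) ℝ) : frobNorm S ≤ √(m / s) * normL2 Pi S := by
  refine le_of_sq_le_sq ?_ (mul_nonneg (Real.sqrt_nonneg _) (normL2_nonneg S))
  rw [mul_pow, Real.sq_sqrt (by positivity), div_mul_eq_mul_div, ← sum_secondMoment hm hX,
    le_div_iff₀ hs, ← sum_norm_colVec_sq, Finset.sum_mul]
  exact Finset.sum_le_sum fun j _ => by rw [mul_comm]; exact hmin _

/-- Lower bound of the summed truncated quadratics by the `L²` norm. -/
lemma sum_hub_ge (hm : 0 < m) (hX : ∀ a, MemLp (fun x : Fin p → ℝ => x a) 2 Pi)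
    {κ t b : ℝ} (hκ : 0 < κ) (ht : 0 < t) (x : Fin n → Fin p → ℝ)
    (h : ∀ a, secondMoment Pi a = 1 → b ≤ ∑ i, hub (κ / (√m * t)) (lin a (x i)))
    {Δ : Matrix (Fin p) (Fin m) ℝ} (hΔ : normL2 Pi Δ = t) :
    b * (m * t ^ 2) ≤ ∑ i, ∑ j, hub κ (linPred Δ j (x i)) := by
  have hmR : (0 : ℝ) < m := Nat.cast_pos.2 hm
  have hnn : ∀ a, 0 ≤ secondMoment Pi a := fun a => integral_nonneg fun x => sq_nonneg _
  rw [Finset.sum_comm, ← hΔ, ← sum_secondMoment hm hX, Finset.mul_sum]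
  refine Finset.sum_le_sum fun j _ => ?_
  rcases (hnn (colVec Δ j)).eq_or_lt with h0 | hpos
  · rw [← h0, mul_zero]
    exact Finset.sum_nonneg fun i _ => hub_nonneg hκ _
  set ρ := √(secondMoment Pi (colVec Δ j)) with hρ
  have hρ0 : 0 < ρ := Real.sqrt_pos.2 hpos
  -- Each column is normalized by its own L₂ size ρ. The threshold becomes κ/ρ, which is at least
  -- κ/(√m·t) since m·t² is the sum of all squared column sizes; monotonicity in the threshold then
  -- applies.
  have hρ2 : ρ ^ 2 = secondMoment Pi (colVec Δ j) := Real.sq_sqrt hpos.le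
  have hρle : ρ ≤ √m * t := by
    refine Real.sqrt_le_iff.2 ⟨by positivity, ?_⟩
    rw [mul_pow, Real.sq_sqrt hmR.le, ← hΔ, ← sum_secondMoment hm hX]
    exact Finset.single_le_sum (f := fun j => secondMoment Pi (colVec Δ j)) (fun i _ => hnn _)
      (Finset.mem_univ j)
  have h1 : secondMoment Pi (ρ⁻¹ • colVec Δ j) = 1 := by
    rw [secondMoment_smul, ← hρ2]
    field_simp
  rw [← hρ2, mul_comm]
  refine (mul_le_mul_of_nonneg_left (h _ h1) (sq_nonneg ρ)).trans ?_
  rw [Finset.mul_sum]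
  refine Finset.sum_le_sum fun i _ => ?_
  have e : hub κ (linPred Δ j (x i)) = ρ ^ 2 * hub (κ / ρ) (lin (ρ⁻¹ • colVec Δ j) (x i)) := by
    rw [← hub_scale hρ0, lin_smul, linPred_eq_lin, ← mul_assoc, mul_inv_cancel₀ hρ0.ne', one_mul,
      mul_div_cancel₀ _ hρ0.ne']
  rw [e]
  refine mul_le_mul_of_nonneg_left (hub_mono (by positivity) ?_ _) (sq_nonneg _)
  exact div_le_div_of_nonneg_left hκ.le hρ0 hρle

end Norms

variable {τ : ℝ} {x : Fin n → Fin p → ℝ} {y : Fin n → Fin m → ℝ}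
  {Γ Γh : Matrix (Fin p) (Fin m) ℝ}

lemma empLoss_sub (Γ Δ : Matrix (Fin p) (Fin m) ℝ) :
    empLoss τ x y (Γ + Δ) - empLoss τ x y Γ = ((n : ℝ) * m)⁻¹ * ∑ i, ∑ j,
      (rho τ (y i j - linPred Γ j (x i) - linPred Δ j (x i)) -
        rho τ (y i j - linPred Γ j (x i))) := by
  simp only [empLoss, ← mul_sub, ← Finset.sum_sub_distrib, linPred_add, sub_sub]

/-- Convexity along a segment: average the two subgradient inequalities at the intermediate point;
the linear terms cancel. -/
lemma rho_convex (τ v w : ℝ) {u : ℝ} (hu0 : 0 ≤ u) (hu1 : u ≤ 1) :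
    rho τ (v + u * w) - rho τ v ≤ u * (rho τ (v + w) - rho τ v) := by
  have h1 := rho_sub_ge τ (v + u * w) (v + w)
  have h2 := rho_sub_ge τ (v + u * w) v
  generalize (τ - if v + u * w ≤ 0 then 1 else 0) = c at h1 h2
  have h3 := mul_le_mul_of_nonneg_left h1 hu0
  have h4 := mul_le_mul_of_nonneg_left h2 (sub_nonneg.2 hu1)
  have e : u * ((v + w - (v + u * w)) * c) + (1 - u) * ((v - (v + u * w)) * c) = 0 := by ring
  linarith

lemma empLoss_convex (Γ Δ : Matrix (Fin p) (Fin m) ℝ) {u : ℝ} (hu0 : 0 ≤ u) (hu1 : u ≤ 1) :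
    empLoss τ x y (Γ + u • Δ) - empLoss τ x y Γ ≤
      u * (empLoss τ x y (Γ + Δ) - empLoss τ x y Γ) := by
  rw [empLoss_sub, empLoss_sub, ← mul_assoc, mul_comm u, mul_assoc]
  refine mul_le_mul_of_nonneg_left ?_ (by positivity)
  simp only [Finset.mul_sum]
  refine Finset.sum_le_sum fun i _ => Finset.sum_le_sum fun j _ => ?_
  have := rho_convex τ (y i j - linPred Γ j (x i)) (-linPred Δ j (x i)) hu0 hu1
  rw [linPred_smul, show y i j - linPred Γ j (x i) - u * linPred Δ j (x i) =
    y i j - linPred Γ j (x i) + u * -linPred Δ j (x i) by ring, sub_eq_add_neg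
    (y i j - linPred Γ j (x i)) (linPred Δ j (x i))]
  exact this

/-- The basic inequality: minimality against Γ, with the penalty difference bounded by
decomposability. -/
lemma IsEstimator.empLoss_sub_le {lam : ℝ} (hlam : 0 ≤ lam) (h : IsEstimator τ lam x y Γh) :
    empLoss τ x y (Γ + (Γh - Γ)) - empLoss τ x y Γ ≤
      lam * (nuclearNorm (suppProj Γ (Γh - Γ)) - nuclearNorm (suppProjPerp Γ (Γh - Γ))) := by
  have h1 := h Γ
  have h2 := nuclearNorm_add_ge Γ (Γh - Γ)
  rw [add_sub_cancel] at h2 ⊢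
  have h3 := mul_le_mul_of_nonneg_left h2 hlam
  linarith

/-- The estimation error lies in the cone as soon as the penalty dominates the score. -/
lemma IsEstimator.sub_mem_cone {lam : ℝ} (hlam : 0 < lam) (h : IsEstimator τ lam x y Γh)
    (hscore : ∀ Δ, -(lam / 2 * nuclearNorm Δ) ≤ empLoss τ x y (Γ + Δ) - empLoss τ x y Γ) :
    Γh - Γ ∈ cone Γ 3 := by
  have h1 := h.empLoss_sub_le (Γ := Γ) hlam.le
  have h2 := hscore (Γh - Γ)
  have h3 := nuclearNorm_add_le (suppProj Γ (Γh - Γ)) (suppProjPerp Γ (Γh - Γ))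
  have h4 : suppProj Γ (Γh - Γ) + suppProjPerp Γ (Γh - Γ) = Γh - Γ := by rw [suppProj]; abel
  rw [h4] at h3
  have h5 := mul_le_mul_of_nonneg_left h3 hlam.le
  have h6 : lam * nuclearNorm (suppProjPerp Γ (Γh - Γ)) ≤
      lam * (3 * nuclearNorm (suppProj Γ (Γh - Γ))) := by linarith
  exact le_of_mul_le_mul_left h6 hlam

/-- Localization: a strictly curved loss keeps the error inside the ball of radius `t`. -/
lemma IsEstimator.normL2_le {Pi : Measure (Fin p → ℝ)} {lam t a K : ℝ} (hlam : 0 < lam)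
    (h : IsEstimator τ lam x y Γh) (hcone : Γh - Γ ∈ cone Γ 3) (ht : 0 < t)
    (hK : ∀ Δ, nuclearNorm (suppProj Γ Δ) ≤ K * normL2 Pi Δ)
    (hcurv : ∀ Δ, normL2 Pi Δ = t → nuclearNorm Δ ≤ 4 * (K * t) →
      a ≤ empLoss τ x y (Γ + Δ) - empLoss τ x y Γ)
    (hlt : lam * (K * t) < a) : normL2 Pi (Γh - Γ) ≤ t := by
  by_contra hgt
  rw [not_le] at hgt
  set Δ := Γh - Γ
  have hN : 0 < normL2 Pi Δ := ht.trans hgt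
  -- If the error lay outside the ball, shrink it to the sphere. The cone is stable under scaling,
  -- so the curvature bound applies at u•Δ, while convexity bounds the increment there by u times
  -- the one at Δ; the two contradict each other.
  set u := t / normL2 Pi Δ with hu
  have hu0 : 0 ≤ u := by positivity
  have hu1 : u ≤ 1 := (div_le_one hN).2 hgt.le
  have hnorm : normL2 Pi (u • Δ) = t := by
    rw [normL2_smul hu0, hu, div_mul_cancel₀ _ hN.ne']
  have h1 := hcurv (u • Δ) hnorm (by
    refine (nuclearNorm_le_of_mem_cone (smul_mem_cone hcone hu0)).trans ?_
    have := hK (u • Δ)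
    rw [hnorm] at this
    linarith)
  have h2 := empLoss_convex (τ := τ) (x := x) (y := y) Γ Δ hu0 hu1
  have h3 : empLoss τ x y (Γ + Δ) - empLoss τ x y Γ ≤ lam * nuclearNorm (suppProj Γ Δ) := by
    refine (h.empLoss_sub_le hlam.le).trans (mul_le_mul_of_nonneg_left ?_ hlam.le)
    linarith [nuclearNorm_nonneg (suppProjPerp Γ Δ)]
  have h4 : u * (empLoss τ x y (Γ + Δ) - empLoss τ x y Γ) ≤ lam * (K * t) := by
    calc u * (empLoss τ x y (Γ + Δ) - empLoss τ x y Γ)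
        ≤ u * (lam * (K * normL2 Pi Δ)) := by
          refine mul_le_mul_of_nonneg_left (h3.trans ?_) hu0
          exact mul_le_mul_of_nonneg_left (hK Δ) hlam.le
      _ = lam * (K * t) := by rw [hu]; field_simp
  linarith

end Deterministic

end MQR

end

noncomputable section

namespace MQR

/-! ### Loss increments on the good events -/

section Increments

variable {n p m : ℕ} {P : Measure ((Fin p → ℝ) × (Fin m → ℝ))} [IsProbabilityMeasure P] {τ : ℝ}
  {Γ : Matrix (Fin p) (Fin m) ℝ} {x : Fin n → Fin p → ℝ} {y : Fin n → Fin m → ℝ}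

/-- Linear part of the increment of the check loss. -/
def scoreFun (τ q d y : ℝ) : ℝ := d * ((if y ≤ q then 1 else 0) - τ)

/-- Increment of the check loss. -/
def lossFun (τ q d y : ℝ) : ℝ := rho τ (y - q - d) - rho τ (y - q)

lemma measurable_scoreFun (τ : ℝ) :
    Measurable fun z : ℝ × ℝ × ℝ => scoreFun τ z.1 z.2.1 z.2.2 := by
  unfold scoreFun
  refine (measurable_fst.comp measurable_snd).mul (Measurable.sub ?_ measurable_const)
  exact Measurable.ite (measurableSet_le (measurable_snd.comp measurable_snd) measurable_fst)
    measurable_const measurable_const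

lemma abs_scoreFun_sub_le (h0 : 0 < τ) (h1 : τ < 1) (q d d' y : ℝ) :
    |scoreFun τ q d y - scoreFun τ q d' y| ≤ |d - d'| := by
  rw [scoreFun, scoreFun, ← sub_mul, abs_mul]
  refine mul_le_of_le_one_right (abs_nonneg _) (abs_le.2 ?_)
  split_ifs <;> constructor <;> linarith

lemma measurable_lossFun (h0 : 0 < τ) (h1 : τ < 1) :
    Measurable fun z : ℝ × ℝ × ℝ => lossFun τ z.1 z.2.1 z.2.2 := by
  have := continuous_rho h0 h1
  unfold lossFun
  exact (by fun_prop : Continuous _).measurable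

lemma abs_lossFun_sub_le (h0 : 0 < τ) (h1 : τ < 1) (q d d' y : ℝ) :
    |lossFun τ q d y - lossFun τ q d' y| ≤ |d - d'| := by
  have h := abs_rho_sub_le h0 h1 (y - q - d') (y - q - d)
  rw [show y - q - d - (y - q - d') = -(d - d') by ring, abs_neg] at h
  rw [lossFun, lossFun, sub_sub_sub_cancel_right]
  exact h

/-- The increment is at least the linear score, by the subgradient inequality. The score has
conditional mean zero because the distribution function equals τ at the quantile, so the deviation
bound on the unit nuclear ball extends to all Δ by homogeneity. -/
lemma score_le_empLoss_sub (hn : 0 < n) (hm : 0 < m)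
    (hq : ∀ i j, (condLaw P j (x i)).real (Set.Iic (linPred Γ j (x i))) = τ) {l : ℝ}
    (hG : ∀ Δ : Matrix (Fin p) (Fin m) ℝ, nuclearNorm Δ ≤ 1 → ∑ i, ∑ j,
      (∫ z, scoreFun τ (linPred Γ j (x i)) (linPred Δ j (x i)) z ∂condLaw P j (x i) -
        scoreFun τ (linPred Γ j (x i)) (linPred Δ j (x i)) (y i j)) ≤ n * m * l)
    (Δ : Matrix (Fin p) (Fin m) ℝ) :
    -(l * nuclearNorm Δ) ≤ empLoss τ x y (Γ + Δ) - empLoss τ x y Γ := by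
  have hnm : (0 : ℝ) < n * m := by positivity
  have hstep : -(n * m * (l * nuclearNorm Δ)) ≤
      ∑ i, ∑ j, scoreFun τ (linPred Γ j (x i)) (linPred Δ j (x i)) (y i j) := by
    rcases (nuclearNorm_nonneg Δ).eq_or_lt with h0 | hpos
    · have hΔ : Δ = 0 := eq_zero_of_nuclearNorm_le_zero h0.ge
      rw [← h0, hΔ]
      simp [scoreFun, linPred]
    set c := nuclearNorm Δ
    have h := hG (c⁻¹ • Δ) (by
      rw [nuclearNorm_smul _ (inv_nonneg.2 hpos.le)]; exact (inv_mul_cancel₀ hpos.ne').le)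
    have e : ∀ i j, (∫ z, scoreFun τ (linPred Γ j (x i)) (linPred (c⁻¹ • Δ) j (x i)) z
        ∂condLaw P j (x i) - scoreFun τ (linPred Γ j (x i)) (linPred (c⁻¹ • Δ) j (x i)) (y i j)) =
        -(c⁻¹ * scoreFun τ (linPred Γ j (x i)) (linPred Δ j (x i)) (y i j)) := fun i j => by
      unfold scoreFun
      rw [integral_score (hq i j), linPred_smul]
      ring
    simp only [e, Finset.sum_neg_distrib, ← Finset.mul_sum] at h
    rw [neg_le, inv_mul_eq_div] at h
    rw [le_div_iff₀ hpos] at h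
    linarith
  rw [empLoss_sub, inv_mul_eq_div, le_div_iff₀ hnm]
  calc -(l * nuclearNorm Δ) * (n * m) = -(n * m * (l * nuclearNorm Δ)) := by ring
    _ ≤ _ := hstep
    _ ≤ _ := Finset.sum_le_sum fun i _ => Finset.sum_le_sum fun j _ => by
      have h := rho_sub_ge τ (y i j - linPred Γ j (x i))
        (y i j - linPred Γ j (x i) - linPred Δ j (x i))
      refine le_trans (le_of_eq ?_) h
      simp only [scoreFun, sub_nonpos]
      ring

/-- The conditional mean of the increment is at least b·f·t² through the truncated quadratic, and
the deviation from that mean loses at most c·f·t². -/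
lemma curvature_le_empLoss_sub {Pi : Measure (Fin p → ℝ)} (hn : 0 < n) (hm : 0 < m)
    (hX : ∀ a, MemLp (fun x : Fin p → ℝ => x a) 2 Pi) {f κ t b c : ℝ} (hf : 0 ≤ f) (hκ : 0 < κ)
    (ht : 0 < t)
    (hexc : ∀ i j d, f * hub κ d ≤ excess (condLaw P j (x i)) τ (linPred Γ j (x i)) d)
    (hhub : ∀ a, secondMoment Pi a = 1 → b * n ≤ ∑ i, hub (κ / (√m * t)) (lin a (x i)))
    {Δ : Matrix (Fin p) (Fin m) ℝ} (hΔ : normL2 Pi Δ = t)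
    (hG : ∑ i, ∑ j,
      (∫ z, lossFun τ (linPred Γ j (x i)) (linPred Δ j (x i)) z ∂condLaw P j (x i) -
        lossFun τ (linPred Γ j (x i)) (linPred Δ j (x i)) (y i j)) ≤ n * m * (c * f * t ^ 2)) :
    (b - c) * f * t ^ 2 ≤ empLoss τ x y (Γ + Δ) - empLoss τ x y Γ := by
  have hnm : (0 : ℝ) < n * m := by positivity
  have h1 := mul_le_mul_of_nonneg_left (sum_hub_ge hm hX hκ ht x hhub hΔ) hf
  have h2 : f * ∑ i, ∑ j, hub κ (linPred Δ j (x i)) ≤ ∑ i, ∑ j,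
      ∫ z, lossFun τ (linPred Γ j (x i)) (linPred Δ j (x i)) z ∂condLaw P j (x i) := by
    simp only [Finset.mul_sum]
    exact Finset.sum_le_sum fun i _ => Finset.sum_le_sum fun j _ => hexc i j _
  simp only [Finset.sum_sub_distrib] at hG
  rw [empLoss_sub, inv_mul_eq_div, le_div_iff₀ hnm]
  have h3 : ∑ i, ∑ j, lossFun τ (linPred Γ j (x i)) (linPred Δ j (x i)) (y i j) =
      ∑ i, ∑ j, (rho τ (y i j - linPred Γ j (x i) - linPred Δ j (x i)) -
        rho τ (y i j - linPred Γ j (x i))) := rfl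
  rw [← h3]
  linarith

end Increments

/-! ### Transfer of events to the sample space -/

section Transfer

variable {n p m : ℕ} {P : Measure ((Fin p → ℝ) × (Fin m → ℝ))}

/-- Neither S nor the estimator need be measurable. The preimages of G and E together with an almost
sure property form a null-measurable set, inside which a measurable set of equal measure is chosen;
S enters only through monotonicity and subadditivity. -/
lemma exists_sample_event {Ω : Type*} [MeasurableSpace Ω] {μ : Measure Ω} [IsProbabilityMeasure μ]
    {X : Fin n → Ω → Fin p → ℝ} {Y : Fin n → Ω → Fin m → ℝ}
    (hlaw : ∀ i, HasLaw (fun ω => (X i ω, Y i ω)) P μ)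
    (hind : iIndepFun (fun i ω => (X i ω, Y i ω)) μ)
    {G E : Set (Fin n → (Fin p → ℝ) × (Fin m → ℝ))} (hGm : MeasurableSet G)
    (hEm : MeasurableSet E) {δ γ : ℝ} (hδ : 0 ≤ δ)
    (hG : Measure.pi (fun _ : Fin n => P) Gᶜ ≤ ENNReal.ofReal δ) {S : Set Ω}
    (hS : 1 - γ ≤ μ.real S) (hSE : ∀ ω ∈ S, (fun i => (X i ω, Y i ω)) ∈ E) {Q : Ω → Prop}
    (hQ : ∀ᵐ ω ∂μ, Q ω) :
    ∃ A : Set Ω, MeasurableSet A ∧ 1 - γ - δ ≤ μ.real A ∧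
      ∀ ω ∈ A, (fun i => (X i ω, Y i ω)) ∈ G ∧ (fun i => (X i ω, Y i ω)) ∈ E ∧ Q ω := by
  set Z : Ω → Fin n → (Fin p → ℝ) × (Fin m → ℝ) := fun ω i => (X i ω, Y i ω) with hZ
  have hZm : AEMeasurable Z μ := aemeasurable_pi_lambda _ fun i => (hlaw i).aemeasurable
  have hmap : μ.map Z = Measure.pi fun _ : Fin n => P := by
    have h := (iIndepFun_iff_map_fun_eq_pi_map fun i => (hlaw i).aemeasurable).1 hind
    simp only [(hlaw _).map_eq] at h
    exact h
  have hnull : NullMeasurableSet (Z ⁻¹' G ∩ Z ⁻¹' E ∩ {ω | Q ω}) μ :=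
    ((hZm.nullMeasurableSet_preimage hGm).inter (hZm.nullMeasurableSet_preimage hEm)).inter
      (NullMeasurableSet.of_compl (NullMeasurableSet.of_null (by exact hQ)))
  obtain ⟨A, hAsub, hAm, hAe⟩ := hnull.exists_measurable_subset_ae_eq
  refine ⟨A, hAm, ?_, fun ω hω => ⟨(hAsub hω).1.1, (hAsub hω).1.2, (hAsub hω).2⟩⟩
  have h1 : μ.real (Z ⁻¹' Gᶜ) ≤ δ := by
    rw [measureReal_def, ← Measure.map_apply_of_aemeasurable hZm hGm.compl, hmap]
    exact ENNReal.toReal_le_of_le_ofReal hδ hG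
  have h2 : μ.real {ω | Q ω}ᶜ = 0 := by
    rw [measureReal_def, show μ {ω | Q ω}ᶜ = 0 from hQ]
    rfl
  have h3 : S ⊆ (Z ⁻¹' G ∩ Z ⁻¹' E ∩ {ω | Q ω}) ∪ (Z ⁻¹' Gᶜ ∪ {ω | Q ω}ᶜ) := fun ω hω => by
    by_cases hg : Z ω ∈ G
    · by_cases hq : Q ω
      · exact Or.inl ⟨⟨hg, hSE ω hω⟩, hq⟩
      · exact Or.inr (Or.inr hq)
    · exact Or.inr (Or.inl hg)
  have h4 := (measureReal_mono h3 : μ.real S ≤ _).trans (measureReal_union_le _ _)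
  have h5 := measureReal_union_le (μ := μ) (Z ⁻¹' Gᶜ) {ω | Q ω}ᶜ
  rw [measureReal_congr hAe]
  linarith

end Transfer

/-! ### Constants -/

section Constants

variable {n p m : ℕ}

lemma sq_CStar {C c₂ : ℝ} (hC : 0 < C) (hc : 0 ≤ c₂) :
    CStar C c₂ ^ 2 = 32 * (c₂ / C) * Real.log 8 := by
  have : 0 ≤ Real.log 8 := Real.log_nonneg (by norm_num)
  rw [CStar, mul_pow, Real.sq_sqrt (by positivity)]
  ring

lemma CStar_nonneg (C c₂ : ℝ) : 0 ≤ CStar C c₂ := mul_nonneg (by norm_num) (Real.sqrt_nonneg _)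

lemma CStar_le_CTau (C c₂ τ : ℝ) : 8 * √2 * CStar C c₂ ≤ CTau C c₂ τ :=
  mul_le_mul_of_nonneg_left (le_max_right _ _) (by positivity)

lemma CTau_nonneg (C c₂ τ : ℝ) : 0 ≤ CTau C c₂ τ :=
  (mul_nonneg (by positivity) (CStar_nonneg C c₂)).trans (CStar_le_CTau C c₂ τ)

lemma sqrt_le_rate (n p m : ℕ) : √(((p : ℝ) + m) / n) ≤ rate n p m :=
  le_add_of_nonneg_left (Real.sqrt_nonneg _)

/-- The radius of the `L²` ball that contains the estimation error. -/
def radius (C c₂ τ f σ s : ℝ) (n p m r : ℕ) : ℝ :=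
  CTau C c₂ τ / (f * √m) * √(σ / s) * √(max τ (1 - τ)) * rate n p m * √r

variable {C c₂ τ f σ s : ℝ} {r : ℕ}

/-- Only the C* branch of the maximum in `CTau` and only the term √((p+m)/n) of the rate are
retained. This lower bound on the radius is what all exponents are measured against. -/
lemma radius_sq_ge (hn : 0 < n) (hm : 0 < m) (hf : 0 < f) (hσ : 0 ≤ σ) (hs : 0 < s) (hτ : 0 < τ) :
    128 * CStar C c₂ ^ 2 * (σ / s) * max τ (1 - τ) * ((p : ℝ) + m) * r ≤
      n * m * (f * radius C c₂ τ f σ s n p m r) ^ 2 := by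
  have hnR : (0 : ℝ) < n := Nat.cast_pos.2 hn
  have hmR : (0 : ℝ) < m := Nat.cast_pos.2 hm
  have hT : 0 < max τ (1 - τ) := lt_max_of_lt_left hτ
  have hsm : 0 < √(m : ℝ) := Real.sqrt_pos.2 hmR
  have e : f * radius C c₂ τ f σ s n p m r =
      CTau C c₂ τ * √(σ / s) * √(max τ (1 - τ)) * rate n p m * √r / √m := by
    rw [radius]; field_simp
  have h1 : 8 * √2 * CStar C c₂ * √(σ / s) * √(max τ (1 - τ)) * √(((p : ℝ) + m) / n) * √r / √m ≤
      f * radius C c₂ τ f σ s n p m r := by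
    rw [e]
    have := CStar_nonneg C c₂
    gcongr
    · have := CTau_nonneg C c₂ τ
      positivity
    · exact CStar_le_CTau C c₂ τ
    · exact sqrt_le_rate n p m
  have h0 : 0 ≤ 8 * √2 * CStar C c₂ * √(σ / s) * √(max τ (1 - τ)) * √(((p : ℝ) + m) / n) * √r / √m :=
    by have := CStar_nonneg C c₂; positivity
  have h2 := mul_le_mul_of_nonneg_left (pow_le_pow_left₀ h0 h1 2)
    (by positivity : 0 ≤ (n : ℝ) * m)
  refine le_trans (le_of_eq ?_) h2
  simp only [mul_pow, div_pow]
  rw [Real.sq_sqrt hmR.le, Real.sq_sqrt (by positivity : 0 ≤ σ / s), Real.sq_sqrt hT.le,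
    Real.sq_sqrt (by positivity : 0 ≤ ((p : ℝ) + m) / n), Real.sq_sqrt (Nat.cast_nonneg r),
    Real.sq_sqrt (by norm_num : (0 : ℝ) ≤ 2)]
  field_simp
  ring

/-- Since 9 ≤ 8², the net cardinality uses up two of the three units of (p+m)·log 8 in the exponent.
-/
lemma nine_pow_mul_exp_le {a : ℝ} (h : 3 * (((p : ℝ) + m) * Real.log 8) ≤ a) :
    9 ^ (p + m) * Real.exp (-a) ≤ Real.exp (-(((p : ℝ) + m) * Real.log 8)) := by
  have h9 : (9 : ℝ) ^ (p + m) ≤ Real.exp (2 * (((p : ℝ) + m) * Real.log 8)) := by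
    have e : Real.exp (2 * (((p : ℝ) + m) * Real.log 8)) = 64 ^ (p + m) := by
      rw [show 2 * (((p : ℝ) + m) * Real.log 8) = ((p + m : ℕ) : ℝ) * (2 * Real.log 8) by
        push_cast; ring, Real.exp_nat_mul, two_mul, Real.exp_add, Real.exp_log (by norm_num)]
      norm_num
    rw [e]
    exact pow_le_pow_left₀ (by norm_num) (by norm_num) _
  calc _ ≤ Real.exp (2 * (((p : ℝ) + m) * Real.log 8)) * Real.exp (-a) := by gcongr
    _ = Real.exp (2 * (((p : ℝ) + m) * Real.log 8) - a) := by rw [← Real.exp_add]; ring_nf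
    _ ≤ _ := Real.exp_le_exp.2 (by linarith)

end Constants

end MQR

end

noncomputable section

namespace MQR

/-! ### Good events -/

section Events

variable {n p m : ℕ} {P : Measure ((Fin p → ℝ) × (Fin m → ℝ))} [IsProbabilityMeasure P]
  {τ : ℝ} {Γ : Matrix (Fin p) (Fin m) ℝ}

lemma pos_of_sigmaMin_pos {A : Matrix (Fin p) (Fin p) ℝ} (h : 0 < sigmaMin A) : 0 < p := by
  rcases Nat.eq_zero_or_pos p with rfl | hp
  · rw [sigmaMin, sv_eq_zero A ((Matrix.rank_le_width A).trans (Nat.zero_le _))] at h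
    exact h.false.elim
  · exact hp

lemma lam_pos {C c₂ : ℝ} (hC : 0 < C) (hc : 0 < c₂) (hn : 0 < n) (hm : 0 < m) (hτ : 0 < τ)
    {Sg : Matrix (Fin p) (Fin p) ℝ} (hσ : 0 < sigmaMax Sg) : 0 < lam C c₂ τ n p m Sg := by
  have hnR : (0 : ℝ) < n := Nat.cast_pos.2 hn
  have hmR : (0 : ℝ) < m := Nat.cast_pos.2 hm
  have hT : 0 < max τ (1 - τ) := lt_max_of_lt_left hτ
  have hL : 0 < Real.log 8 := Real.log_pos (by norm_num)
  have hS : 0 < CStar C c₂ := mul_pos (by norm_num) (Real.sqrt_pos.2 (by positivity))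
  unfold lam
  have : 0 < √(sigmaMax Sg * max τ (1 - τ)) := Real.sqrt_pos.2 (by positivity)
  have : 0 < √(((p : ℝ) + m) / n) := Real.sqrt_pos.2 (by positivity)
  positivity

lemma lam_sq {C c₂ : ℝ} (hτ : 0 < τ) {Sg : Matrix (Fin p) (Fin p) ℝ}
    (hσ : 0 < sigmaMax Sg) : lam C c₂ τ n p m Sg ^ 2 =
      4 * (CStar C c₂ ^ 2 / m ^ 2) * (sigmaMax Sg * max τ (1 - τ)) * (((p : ℝ) + m) / n) := by
  have hT : 0 < max τ (1 - τ) := lt_max_of_lt_left hτ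
  rw [lam, mul_pow, mul_pow, mul_pow, div_pow, Real.sq_sqrt (by positivity),
    Real.sq_sqrt (by positivity)]
  ring

lemma half_le_max (τ : ℝ) : 1 / 2 ≤ max τ (1 - τ) := by
  rcases le_total (1 / 2) τ with h | h
  · exact h.trans (le_max_left _ _)
  · exact le_trans (by linarith) (le_max_right _ _)

lemma radius_nonneg {C c₂ s σ f : ℝ} (hf : 0 < f) (r : ℕ) :
    0 ≤ radius C c₂ τ f σ s n p m r := by
  have := CTau_nonneg C c₂ τ
  have : 0 ≤ rate n p m := (Real.sqrt_nonneg _).trans (sqrt_le_rate n p m)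
  unfold radius
  positivity

lemma radius_pos {C c₂ s σ f : ℝ} (hC : 0 < C) (hc : 0 < c₂) (hn : 0 < n) (hm : 0 < m) (hτ : 0 < τ)
    (hf : 0 < f) (hσ : 0 < σ) (hs : 0 < s) {r : ℕ} (hr : 0 < r) :
    0 < radius C c₂ τ f σ s n p m r := by
  refine (radius_nonneg hf r).lt_of_ne fun h => ?_
  have hkey := radius_sq_ge (C := C) (c₂ := c₂) (p := p) (r := r) hn hm hf hσ.le hs hτ
  rw [← h, sq_CStar hC hc.le] at hkey
  have hmR : (0 : ℝ) < m := Nat.cast_pos.2 hm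
  have hrR : (0 : ℝ) < r := Nat.cast_pos.2 hr
  have hT : 0 < max τ (1 - τ) := lt_max_of_lt_left hτ
  have hL : 0 < Real.log 8 := Real.log_pos (by norm_num)
  have : 0 < 128 * (32 * (c₂ / C) * Real.log 8) * (σ / s) * max τ (1 - τ) * ((p : ℝ) + m) * r := by
    positivity
  norm_num at hkey
  linarith

/-- With high probability the penalty dominates the score. -/
lemma exists_score_event (hn : 0 < n) (hp : 0 < p) (hm : 0 < m) (h0 : 0 < τ) (h1 : τ < 1)
    (hci : CondIndepResponses P) (Γ : Matrix (Fin p) (Fin m) ℝ) {C c₂ : ℝ} (hC : 0 < C)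
    (hC' : C ≤ 1 / 10000) (hc : 0 < c₂) {Sg : Matrix (Fin p) (Fin p) ℝ} (hσ : 0 < sigmaMax Sg) :
    ∃ G : Set (Fin n → (Fin p → ℝ) × (Fin m → ℝ)), MeasurableSet G ∧
      Measure.pi (fun _ : Fin n => P) Gᶜ ≤
        ENNReal.ofReal (Real.exp (-(((p : ℝ) + m) * Real.log 8))) ∧
      ∀ z ∈ G, (∀ a : EuclideanSpace ℝ (Fin p),
          ∑ i, lin a (z i).1 ^ 2 ≤ n * (c₂ * sigmaMax Sg) * ‖a‖ ^ 2) →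
        (∀ i j, (condLaw P j (z i).1).real (Set.Iic (linPred Γ j (z i).1)) = τ) →
        ∀ Δ, -(lam C c₂ τ n p m Sg / 2 * nuclearNorm Δ) ≤
          empLoss τ (fun i => (z i).1) (fun i => (z i).2) (Γ + Δ) -
            empLoss τ (fun i => (z i).1) (fun i => (z i).2) Γ := by
  have hnR : (0 : ℝ) < n := Nat.cast_pos.2 hn
  have hmR : (0 : ℝ) < m := Nat.cast_pos.2 hm
  have hl := lam_pos (p := p) hC hc hn hm h0 hσ
  have hL : 0 < Real.log 8 := Real.log_pos (by norm_num)
  obtain ⟨G, hGm, hGP, hG⟩ := exists_process_event (n := n) hp hm hci Γ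
    (V := n * (c₂ * sigmaMax Sg)) (B := 1) (t := n * m * (lam C c₂ τ n p m Sg / 2)) one_pos
    (by positivity) (by positivity) (scoreFun τ) (measurable_scoreFun τ)
    (abs_scoreFun_sub_le h0 h1) (fun q y => by simp [scoreFun])
  refine ⟨G, hGm, hGP.trans (ENNReal.ofReal_le_ofReal (nine_pow_mul_exp_le ?_)), ?_⟩
  -- With this λ the exponent is (τ ∨ (1−τ))/C times (p+m)·log 8, at least 5000 units where three
  -- suffice.
  · have e : (n * m * (lam C c₂ τ n p m Sg / 2)) ^ 2 / (32 * 1 ^ 2 * (n * (c₂ * sigmaMax Sg))) =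
        1 / C * (max τ (1 - τ) * (((p : ℝ) + m) * Real.log 8)) := by
      rw [mul_pow, div_pow, lam_sq h0 hσ, sq_CStar hC hc.le]
      field_simp
      norm_num
    rw [e]
    have hT := half_le_max τ
    have hCi : 10000 ≤ 1 / C := by rw [le_div_iff₀ hC]; linarith
    have hNL : 0 ≤ ((p : ℝ) + m) * Real.log 8 := by positivity
    calc 3 * (((p : ℝ) + m) * Real.log 8)
        ≤ 10000 * (1 / 2 * (((p : ℝ) + m) * Real.log 8)) := by linarith
      _ ≤ _ := by gcongr
  · intro z hz hx hq Δ
    exact score_le_empLoss_sub hn hm hq (hG z hz hx) Δ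

/-- With high probability the empirical loss is curved on the relevant part of the sphere of
radius `t`. -/
lemma exists_curvature_event (hn : 0 < n) (hm : 0 < m) (h0 : 0 < τ) (h1 : τ < 1)
    (hci : CondIndepResponses P) (hr : 0 < Γ.rank)
    (hX : ∀ a, MemLp (fun x : Fin p → ℝ => x a) 2 P.fst) {C c₂ s σ f D : ℝ} (hC : 0 < C)
    (hC' : C ≤ 1 / 10000) (hc : 1 ≤ c₂) (hs : 0 < s) (hsσ : s ≤ σ)
    (hmin : ∀ a : EuclideanSpace ℝ (Fin p), s * ‖a‖ ^ 2 ≤ secondMoment P.fst a)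
    (hf : 0 < f) (hfκ : f * (f / D) ≤ 2)
    (hν : ENNReal.ofReal (radius C c₂ τ f σ s n p m Γ.rank) < nonlinConst P.fst Γ f D) :
    ∃ G : Set (Fin n → (Fin p → ℝ) × (Fin m → ℝ)), MeasurableSet G ∧
      Measure.pi (fun _ : Fin n => P) Gᶜ ≤
        ENNReal.ofReal (2 * Real.exp (-(((p : ℝ) + m) * Real.log 8))) ∧
      ∀ z ∈ G, (∀ a : EuclideanSpace ℝ (Fin p),
          ∑ i, lin a (z i).1 ^ 2 ≤ n * (c₂ * σ) * ‖a‖ ^ 2) →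
        (∀ i j d, f * hub (f / D) d ≤ excess (condLaw P j (z i).1) τ (linPred Γ j (z i).1) d) →
        ∀ Δ, normL2 P.fst Δ = radius C c₂ τ f σ s n p m Γ.rank →
          nuclearNorm Δ ≤
            4 * (√2 * √Γ.rank * √(m / s) * radius C c₂ τ f σ s n p m Γ.rank) →
          (7 / 25 - 1 / 50) * f * radius C c₂ τ f σ s n p m Γ.rank ^ 2 ≤
          empLoss τ (fun i => (z i).1) (fun i => (z i).2) (Γ + Δ) -
            empLoss τ (fun i => (z i).1) (fun i => (z i).2) Γ := by
  have hnR : (0 : ℝ) < n := Nat.cast_pos.2 hn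
  have hmR : (0 : ℝ) < m := Nat.cast_pos.2 hm
  have hrR : (1 : ℝ) ≤ Γ.rank := by exact_mod_cast hr
  have hp : 0 < p := hr.trans_le Γ.rank_le_height
  have hσ : 0 < σ := hs.trans_le hsσ
  have hL : 0 < Real.log 8 := Real.log_pos (by norm_num)
  have hL1 : 1 ≤ Real.log 8 := by
    rw [Real.le_log_iff_exp_le (by norm_num)]
    linarith [Real.exp_one_lt_d9]
  have hc0 : 0 < c₂ := one_pos.trans_le hc
  have hT := half_le_max τ
  have hCi : 10000 ≤ 1 / C := by rw [le_div_iff₀ hC]; linarith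
  have hkey := radius_sq_ge (C := C) (c₂ := c₂) (p := p) (r := Γ.rank) hn hm hf hσ.le hs h0
  rw [sq_CStar hC hc0.le] at hkey
  obtain ⟨t, htdef⟩ : ∃ t, t = radius C c₂ τ f σ s n p m Γ.rank := ⟨_, rfl⟩
  rw [← htdef] at hkey hν ⊢
  obtain ⟨N, hN⟩ : ∃ N : ℝ, N = (p : ℝ) + m := ⟨_, rfl⟩
  have hN0 : 0 < N := by rw [hN]; positivity
  have hpN : (p : ℝ) ≤ N := by rw [hN]; linarith
  rw [← hN] at hkey
  obtain ⟨T, hTdef⟩ : ∃ T, T = max τ (1 - τ) := ⟨_, rfl⟩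
  rw [← hTdef] at hkey hT
  obtain ⟨R, hR⟩ : ∃ R : ℝ, R = Γ.rank := ⟨_, rfl⟩
  rw [← hR] at hrR hkey
  have hχ : 1 ≤ σ / s := (one_le_div hs).2 hsσ
  -- 20480000 = 128·32·10000·(1/2), from the square of C*, from 1/C ≥ 10000 and from τ ∨ (1−τ) ≥
  -- 1/2.
  have hkey2 : 20480000 * (c₂ * (σ / s)) * (N * Real.log 8) * R ≤ n * m * (f * t) ^ 2 := by
    refine le_trans ?_ hkey
    calc 20480000 * (c₂ * (σ / s)) * (N * Real.log 8) * R
        = 128 * (32 * (c₂ * 10000) * Real.log 8) * (σ / s) * (1 / 2) * N * R := by ring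
      _ ≤ 128 * (32 * (c₂ * (1 / C)) * Real.log 8) * (σ / s) * T * N * R := by gcongr
      _ = _ := by ring
  have ht0 : 0 < t := htdef ▸ radius_pos hC hc0 hn hm h0 hf hσ hs hr
  obtain ⟨hD, hthird⟩ := third_moment_le hr hf ht0 hν
  set κ := f / D with hκdef
  have hκ : 0 < κ := div_pos hf hD
  have hsm : 0 < √(m : ℝ) := Real.sqrt_pos.2 hmR
  -- The threshold κ/(√m·t) is the one occurring in the third-moment bound and also the one needed
  -- for the largest column on the sphere of radius t.
  obtain ⟨E, hEm, hEP, hE⟩ := exists_covariate_event (n := n) hX (k := κ / (√m * t)) (s := s)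
    (c := c₂ * σ) (by positivity) hs (by nlinarith) hmin hthird
  have hB : 0 < 4 * (√2 * √R * √(m / s) * t) := by
    have : 0 < √R := Real.sqrt_pos.2 (by linarith)
    have : 0 < √((m : ℝ) / s) := Real.sqrt_pos.2 (by positivity)
    positivity
  -- B bounds the nuclear norm of cone elements on the sphere. The tolerance is a fiftieth of f·t²
  -- per response; the resulting exponent is at least 20480000/2560000 = 8 units of (p+m)·log 8.
  obtain ⟨G, hGm, hGP, hG⟩ := exists_process_event (n := n) hp hm hci Γ
    (V := n * (c₂ * σ)) (B := 4 * (√2 * √R * √(m / s) * t))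
    (t := n * m * (1 / 50 * f * t ^ 2)) hB
    (by positivity) (by positivity) (lossFun τ) (measurable_lossFun h0 h1)
    (abs_lossFun_sub_le h0 h1) (fun q y => by simp [lossFun])
  have hmX : Measurable fun (z : Fin n → (Fin p → ℝ) × (Fin m → ℝ)) i => (z i).1 := by fun_prop
  refine ⟨(fun z i => (z i).1) ⁻¹' E ∩ G, (hmX hEm).inter hGm, ?_, ?_⟩
  · have hmap : (Measure.pi fun _ : Fin n => P).map (fun z i => (z i).1) =
        Measure.pi fun _ : Fin n => P.fst :=
      Measure.pi_map_pi (μ := fun _ : Fin n => P) (f := fun _ z => z.1)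
        fun _ => measurable_fst.aemeasurable
    have hb1 : Measure.pi (fun _ : Fin n => P) ((fun z i => (z i).1) ⁻¹' E)ᶜ ≤
        ENNReal.ofReal (Real.exp (-(N * Real.log 8))) := by
      rw [← Set.preimage_compl, ← Measure.map_apply hmX hEm.compl, hmap]
      refine hEP.trans (ENNReal.ofReal_le_ofReal (Real.exp_le_exp.2 ?_))
      have e : 3 * (n : ℝ) / (5000 * (κ / (√m * t)) ^ 2) =
          3 / 5000 * (n * m * (f * t) ^ 2) / (f * κ) ^ 2 := by
        rw [div_pow, mul_pow √(m : ℝ), Real.sq_sqrt hmR.le]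
        field_simp
      -- The exponent involves (f·t)²/(f·κ)², so the mass bound f·κ ≤ 2 converts the lower bound on
      -- f·t into one on the exponent, with 3072 = (3/5000)·20480000/4.
      have h4 : (f * κ) ^ 2 ≤ 4 := by
        have : 0 ≤ f * κ := by positivity
        nlinarith
      have h5 : 3072 * (c₂ * (σ / s)) * (N * Real.log 8) ≤
          3 * (n : ℝ) / (5000 * (κ / (√m * t)) ^ 2) := by
        rw [e, le_div_iff₀ (by positivity)]
        calc 3072 * (c₂ * (σ / s)) * (N * Real.log 8) * (f * κ) ^ 2
            ≤ 3072 * (c₂ * (σ / s)) * (N * Real.log 8) * 4 := by gcongr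
          _ = 3 / 5000 * (20480000 * (c₂ * (σ / s)) * (N * Real.log 8) * 1) := by ring
          _ ≤ 3 / 5000 * (20480000 * (c₂ * (σ / s)) * (N * Real.log 8) * R) := by gcongr
          _ ≤ _ := by gcongr
      have h6 : (1 : ℝ) ≤ c₂ * (σ / s) := one_le_mul_of_one_le_of_one_le hc hχ
      have h7 : p * (c₂ * (σ / s)) ≤ c₂ * (σ / s) * (N * Real.log 8) := by
        rw [mul_comm]
        gcongr
        nlinarith
      have h8 : N * Real.log 8 ≤ c₂ * (σ / s) * (N * Real.log 8) :=
        le_mul_of_one_le_left (by positivity) h6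
      have h9 : 0 ≤ N * Real.log 8 := by positivity
      rw [mul_div_assoc c₂ σ s]
      linarith
    have hb2 : Measure.pi (fun _ : Fin n => P) Gᶜ ≤
        ENNReal.ofReal (Real.exp (-(N * Real.log 8))) := by
      rw [hN]
      refine hGP.trans (ENNReal.ofReal_le_ofReal (nine_pow_mul_exp_le ?_))
      rw [← hN]
      have e : (n * m * (1 / 50 * f * t ^ 2)) ^ 2 /
          (32 * (4 * (√2 * √R * √(m / s) * t)) ^ 2 * (n * (c₂ * σ))) =
          n * m * (f * t) ^ 2 / (2560000 * (c₂ * (σ / s)) * R) := by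
        simp only [mul_pow]
        rw [Real.sq_sqrt (by norm_num : (0 : ℝ) ≤ 2), Real.sq_sqrt (by linarith : (0 : ℝ) ≤ R),
          Real.sq_sqrt (by positivity : (0 : ℝ) ≤ m / s)]
        field_simp
        norm_num
      rw [e, le_div_iff₀ (by positivity)]
      refine le_trans ?_ hkey2
      have : 0 ≤ (c₂ * (σ / s)) * (N * Real.log 8) * R := by positivity
      linarith
    rw [Set.compl_inter, ← hN]
    refine (measure_union_le _ _).trans ((add_le_add hb1 hb2).trans (le_of_eq ?_))
    rw [← ENNReal.ofReal_add (Real.exp_pos _).le (Real.exp_pos _).le, two_mul]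
  · intro z hz hx hexc Δ hΔ hΔB
    rw [← hR] at hΔB
    refine curvature_le_empLoss_sub hn hm hX hf.le hκ ht0 hexc ?_ hΔ (hG z hz.2 hx Δ hΔB)
    exact hE _ hz.1 fun b => (hx b).trans_eq (by ring)

/-- The penalty gain on the sphere of radius t is at most f·t²/4: squared, the left side is exactly
1/16 of the quantity bounded in `radius_sq_ge`. -/
lemma lam_mul_le {C c₂ s f : ℝ} (hn : 0 < n) (hm : 0 < m) (hτ : 0 < τ)
    (hf : 0 < f) {Sg : Matrix (Fin p) (Fin p) ℝ} (hσ : 0 < sigmaMax Sg) (hs : 0 < s) (r : ℕ) :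
    lam C c₂ τ n p m Sg * (√2 * √r * √(m / s)) ≤
      1 / 4 * (f * radius C c₂ τ f (sigmaMax Sg) s n p m r) := by
  have hnR : (0 : ℝ) < n := Nat.cast_pos.2 hn
  have hmR : (0 : ℝ) < m := Nat.cast_pos.2 hm
  have h := radius_sq_ge (C := C) (c₂ := c₂) (p := p) (r := r) hn hm hf hσ.le hs hτ
  have hrad : 0 ≤ radius C c₂ τ f (sigmaMax Sg) s n p m r := radius_nonneg hf r
  refine le_of_sq_le_sq ?_ (by positivity)
  refine le_of_mul_le_mul_left ?_ (by positivity : (0 : ℝ) < n * m)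
  rw [mul_pow (1 / 4 : ℝ)]
  calc (n : ℝ) * m * (lam C c₂ τ n p m Sg * (√2 * √r * √(m / s))) ^ 2
      = 1 / 16 * (128 * CStar C c₂ ^ 2 * (sigmaMax Sg / s) * max τ (1 - τ) * ((p : ℝ) + m) * r) := by
        simp only [mul_pow]
        rw [lam_sq hτ hσ, Real.sq_sqrt (by norm_num : (0 : ℝ) ≤ 2),
          Real.sq_sqrt (Nat.cast_nonneg r), Real.sq_sqrt (by positivity : (0 : ℝ) ≤ m / s)]
        field_simp
        ring
    _ ≤ 1 / 16 * (n * m * (f * radius C c₂ τ f (sigmaMax Sg) s n p m r) ^ 2) := by gcongr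
    _ = _ := by ring

end Events

end MQR

end

noncomputable section

namespace MQR

/-! ### The error bounds -/

section Bounds

variable {n p m : ℕ} {P : Measure ((Fin p → ℝ) × (Fin m → ℝ))} [IsProbabilityMeasure P]
  {τ : ℝ} {Γ : Matrix (Fin p) (Fin m) ℝ}

/-- The conditional laws at `x` have the prescribed quantiles and smooth densities. -/
def RegularAt (P : Measure ((Fin p → ℝ) × (Fin m → ℝ))) [IsFiniteMeasure P] (τ : ℝ)
    (Γ : Matrix (Fin p) (Fin m) ℝ) (f D : ℝ) (x : Fin p → ℝ) : Prop :=
  ∀ j, quantile (condLaw P j x) τ = linPred Γ j x ∧ ∃ g : ℝ → ℝ, (∀ y, 0 ≤ g y) ∧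
    condLaw P j x = volume.withDensity (fun y => ENNReal.ofReal (g y)) ∧
    Differentiable ℝ g ∧ (∀ y, |deriv g y| ≤ D) ∧ f ≤ g (linPred Γ j x)

lemma RegularAt.measureReal_Iic {f D : ℝ} {x : Fin p → ℝ} (h : RegularAt P τ Γ f D x) (h0 : 0 < τ)
    (h1 : τ < 1) (j : Fin m) : (condLaw P j x).real (Set.Iic (linPred Γ j x)) = τ := by
  obtain ⟨hq, g, hg0, hgQ, hgd, -, -⟩ := h j
  rw [← hq]
  exact measureReal_Iic_quantile h0 h1 (continuous_measureReal_Iic hg0 hgQ hgd.continuous)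

lemma RegularAt.hub_le_excess {f D : ℝ} {x : Fin p → ℝ} (h : RegularAt P τ Γ f D x) (h0 : 0 < τ)
    (h1 : τ < 1) (hf : 0 < f) (hD : 0 < D) (j : Fin m) (d : ℝ) :
    f * hub (f / D) d ≤ excess (condLaw P j x) τ (linPred Γ j x) d := by
  obtain ⟨hq, g, hg0, hgQ, hgd, hgD, hgf⟩ := h j
  rw [← hq] at hgf ⊢
  exact MQR.hub_le_excess h0 h1 hf hD hg0 hgQ hgd hgD hgf d

lemma RegularAt.density_ratio_le {f D : ℝ} {x : Fin p → ℝ} (h : RegularAt P τ Γ f D x)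
    (hf : 0 < f) (hD : 0 < D) (j : Fin m) : f * (f / D) ≤ 2 := by
  obtain ⟨-, g, hg0, hgQ, hgd, hgD, hgf⟩ := h j
  exact MQR.density_ratio_le hf hD hg0 hgQ hgd hgD hgf

/-- The error bounds follow from the cone condition and the bound in `L²`. -/
lemma error_bounds {Pi : Measure (Fin p → ℝ)} (hm : 0 < m)
    (hX : ∀ a, MemLp (fun x : Fin p → ℝ => x a) 2 Pi) {C c₂ s σ f : ℝ} (hf : 0 < f) (hs : 0 < s)
    (hσ : 0 < σ) (hmin : ∀ a : EuclideanSpace ℝ (Fin p), s * ‖a‖ ^ 2 ≤ secondMoment Pi a)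
    {Δ : Matrix (Fin p) (Fin m) ℝ} (hcone : Δ ∈ cone Γ 3)
    (h : normL2 Pi Δ ≤ radius C c₂ τ f σ s n p m Γ.rank) :
    normL2 Pi Δ ≤ CTau C c₂ τ / (f * √m) * √(σ / s) * √(max τ (1 - τ)) * √Γ.rank * rate n p m ∧
    frobNorm Δ ≤ CTau C c₂ τ / f * √(σ / s ^ 2) * √(max τ (1 - τ)) * √Γ.rank * rate n p m ∧
    nuclearNorm Δ ≤ 4 * √2 * CTau C c₂ τ / f * √(σ / s ^ 2) * √(max τ (1 - τ)) * Γ.rank *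
      rate n p m := by
  have hmR : (0 : ℝ) < m := Nat.cast_pos.2 hm
  have hsm : 0 < √(m : ℝ) := Real.sqrt_pos.2 hmR
  have hss : 0 < √s := Real.sqrt_pos.2 hs
  have e : √(m / s) * radius C c₂ τ f σ s n p m Γ.rank =
      CTau C c₂ τ / f * √(σ / s ^ 2) * √(max τ (1 - τ)) * √Γ.rank * rate n p m := by
    rw [radius, Real.sqrt_div hmR.le, Real.sqrt_div hσ.le, Real.sqrt_div hσ.le, Real.sqrt_sq hs.le]
    have h2 : √s ^ 2 = s := Real.sq_sqrt hs.le
    field_simp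
    rw [h2]
    ring
  have hF : frobNorm Δ ≤
      CTau C c₂ τ / f * √(σ / s ^ 2) * √(max τ (1 - τ)) * √Γ.rank * rate n p m := by
    rw [← e]
    exact (frobNorm_le_normL2 hm hX hs hmin Δ).trans
      (mul_le_mul_of_nonneg_left h (Real.sqrt_nonneg _))
  refine ⟨h.trans_eq (by rw [radius]; ring), hF, ?_⟩
  calc nuclearNorm Δ ≤ 4 * (√2 * √Γ.rank * frobNorm Δ) :=
        (nuclearNorm_le_of_mem_cone hcone).trans (by gcongr; exact nuclearNorm_suppProj_le Γ Δ)
    _ ≤ 4 * (√2 * √Γ.rank *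
        (CTau C c₂ τ / f * √(σ / s ^ 2) * √(max τ (1 - τ)) * √Γ.rank * rate n p m)) := by gcongr
    _ = 4 * √2 * CTau C c₂ τ / f * √(σ / s ^ 2) * √(max τ (1 - τ)) * (√Γ.rank * √Γ.rank) *
        rate n p m := by ring
    _ = _ := by rw [Real.mul_self_sqrt (Nat.cast_nonneg _)]

/-- The error bounds hold on an event of large probability. -/
lemma exists_error_event (hn : 0 < n) (hm : 0 < m) (h0 : 0 < τ) (h1 : τ < 1)
    {Ω : Type*} [MeasurableSpace Ω] {μ : Measure Ω} [IsProbabilityMeasure μ]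
    {X : Fin n → Ω → Fin p → ℝ} {Y : Fin n → Ω → Fin m → ℝ}
    (hlaw : ∀ i, HasLaw (fun ω => (X i ω, Y i ω)) P μ)
    (hind : iIndepFun (fun i ω => (X i ω, Y i ω)) μ)
    (hquant : LinearQuantiles P τ Γ) (hci : CondIndepResponses P)
    (hX : ∀ a, MemLp (fun x : Fin p → ℝ => x a) 2 P.fst) (hs : 0 < sigmaMin (covMat P.fst))
    {C c₂ γ : ℝ} (hC : 0 < C) (hC' : C ≤ 1 / 10000) (hc : 1 ≤ c₂)
    (hcov : 1 - γ ≤ μ.real {ω |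
      sigmaMax (sampleCov fun i => X i ω) ≤ c₂ * sigmaMax (covMat P.fst)})
    {f D : ℝ} (hf : 0 < f) (hdens : DensityCondition P Γ f D)
    (hν : ENNReal.ofReal (radius C c₂ τ f (sigmaMax (covMat P.fst)) (sigmaMin (covMat P.fst))
      n p m Γ.rank) < nonlinConst P.fst Γ f D)
    {Γh : Ω → Matrix (Fin p) (Fin m) ℝ}
    (hest : ∀ᵐ ω ∂μ, IsEstimator τ (lam C c₂ τ n p m (covMat P.fst))
      (fun i => X i ω) (fun i => Y i ω) (Γh ω)) :
    ∃ A : Set Ω, MeasurableSet A ∧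
      1 - γ - 3 * Real.exp (-(((p : ℝ) + m) * Real.log 8)) ≤ μ.real A ∧
      ∀ ω ∈ A, Γh ω - Γ ∈ cone Γ 3 ∧ normL2 P.fst (Γh ω - Γ) ≤
        radius C c₂ τ f (sigmaMax (covMat P.fst)) (sigmaMin (covMat P.fst)) n p m Γ.rank := by
  set σ := sigmaMax (covMat P.fst) with hσdef
  set s := sigmaMin (covMat P.fst) with hsdef
  have hp : 0 < p := pos_of_sigmaMin_pos hs
  have hsσ : s ≤ σ := sigmaMin_le_sigmaMax _
  have hσ : 0 < σ := hs.trans_le hsσ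
  have hc0 : 0 < c₂ := one_pos.trans_le hc
  have hmin : ∀ a : EuclideanSpace ℝ (Fin p), s * ‖a‖ ^ 2 ≤ secondMoment P.fst a :=
    sigmaMin_covMat_le P.fst hX
  have hlam := lam_pos (p := p) (τ := τ) hC hc0 hn hm h0 (Sg := covMat P.fst) hσ
  set δ := Real.exp (-(((p : ℝ) + m) * Real.log 8)) with hδ
  have hδ0 : 0 ≤ δ := (Real.exp_pos _).le
  have hreg : ∀ᵐ x ∂P.fst, RegularAt P τ Γ f D x := by
    filter_upwards [hquant, hdens] with x hx1 hx2 j using ⟨hx1 j, hx2 j⟩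
  have hregΩ : ∀ᵐ ω ∂μ, ∀ i, RegularAt P τ Γ f D (X i ω) := by
    refine ae_all_iff.2 fun i => ?_
    have hXi : AEMeasurable (X i) μ := measurable_fst.comp_aemeasurable (hlaw i).aemeasurable
    have hmap : μ.map (X i) = P.fst := by
      rw [Measure.fst, ← (hlaw i).map_eq,
        AEMeasurable.map_map_of_aemeasurable measurable_fst.aemeasurable (hlaw i).aemeasurable]
      rfl
    rw [← hmap] at hreg
    exact ae_of_ae_map hXi hreg
  obtain ⟨G, hGm, hGP, hG⟩ := exists_score_event (n := n) hn hp hm h0 h1 hci Γ hC hC' hc0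
    (Sg := covMat P.fst) hσ
  obtain ⟨E, hEm, hE⟩ : ∃ E : Set (Fin n → (Fin p → ℝ) × (Fin m → ℝ)), MeasurableSet E ∧
      ∀ z, z ∈ E ↔ ∀ a : EuclideanSpace ℝ (Fin p),
        ∑ i, lin a (z i).1 ^ 2 ≤ n * (c₂ * σ) * ‖a‖ ^ 2 := by
    have hmX : Measurable fun (z : Fin n → (Fin p → ℝ) × (Fin m → ℝ)) i => (z i).1 := by fun_prop
    exact ⟨_, hmX (isClosed_design (n * (c₂ * σ))).measurableSet, fun z => Iff.rfl⟩
  have hSE : ∀ ω ∈ {ω | sigmaMax (sampleCov fun i => X i ω) ≤ c₂ * σ},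
      (fun i => (X i ω, Y i ω)) ∈ E := fun ω hω => (hE _).2 fun a =>
    (sum_lin_sq_le_of_sigmaMax hn _ hω a).trans_eq (by ring)
  have hQ := hregΩ.and hest
  have hcone : ∀ ω, (fun i => (X i ω, Y i ω)) ∈ G → (fun i => (X i ω, Y i ω)) ∈ E →
      (∀ i, RegularAt P τ Γ f D (X i ω)) →
      IsEstimator τ (lam C c₂ τ n p m (covMat P.fst)) (fun i => X i ω) (fun i => Y i ω) (Γh ω) →
      Γh ω - Γ ∈ cone Γ 3 := by
    intro ω hωG hωE hr he
    have hx := (hE _).1 hωE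
    have h := hG _ hωG hx fun i j => (hr i).measureReal_Iic h0 h1 j
    exact he.sub_mem_cone hlam h
  -- For rank zero the radius vanishes and there is no sphere to work on, but the cone is {0}, so
  -- the score event alone gives exact recovery.
  rcases Nat.eq_zero_or_pos Γ.rank with hr | hr
  · obtain ⟨A, hAm, hAP, hA⟩ := exists_sample_event hlaw hind hGm hEm hδ0 hGP hcov hSE hQ
    refine ⟨A, hAm, by linarith, fun ω hω => ?_⟩
    obtain ⟨hωG, hωE, hωr, hωe⟩ := hA ω hω
    have hmem := hcone ω hωG hωE hωr hωe
    refine ⟨hmem, ?_⟩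
    rw [eq_zero_of_mem_cone hr hmem]
    have : normL2 P.fst (0 : Matrix (Fin p) (Fin m) ℝ) = 0 := by simp [normL2, linPred]
    rw [this, radius, hr]
    simp
  · have ht := radius_pos (p := p) (n := n) hC hc0 hn hm h0 hf hσ hs hr
    have hD : 0 < D := (third_moment_le hr hf ht hν).1
    have hfκ : f * (f / D) ≤ 2 := by
      obtain ⟨x, hx⟩ := hreg.exists
      exact hx.density_ratio_le hf hD ⟨0, hm⟩
    obtain ⟨G', hGm', hGP', hG'⟩ := exists_curvature_event hn hm h0 h1 hci hr hX hC hC' hc hs hsσ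
      hmin hf hfκ hν
    have hGG : Measure.pi (fun _ : Fin n => P) (G ∩ G')ᶜ ≤ ENNReal.ofReal (3 * δ) := by
      rw [Set.compl_inter]
      refine (measure_union_le _ _).trans ((add_le_add hGP hGP').trans (le_of_eq ?_))
      rw [← ENNReal.ofReal_add hδ0 (by positivity)]
      congr 1
      ring
    obtain ⟨A, hAm, hAP, hA⟩ := exists_sample_event hlaw hind (hGm.inter hGm') hEm
      (by positivity) hGG hcov hSE hQ
    refine ⟨A, hAm, hAP, fun ω hω => ?_⟩
    obtain ⟨⟨hωG, hωG'⟩, hωE, hωr, hωe⟩ := hA ω hω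
    have hmem := hcone ω hωG hωE hωr hωe
    refine ⟨hmem, ?_⟩
    have hl := lam_mul_le (p := p) (n := n) (C := C) (c₂ := c₂) hn hm h0 hf (Sg := covMat P.fst) hσ hs
      Γ.rank
    rw [← hσdef] at hl
    have hft := mul_pos hf ht
    have hx := (hE _).1 hωE
    have hcurv := hG' _ hωG' hx fun i j d => (hωr i).hub_le_excess h0 h1 hf hD j d
    refine hωe.normL2_le hlam hmem ht (K := √2 * √Γ.rank * √(m / s)) (fun Δ => ?_)
      hcurv ?_
    · refine (nuclearNorm_suppProj_le Γ Δ).trans ?_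
      rw [mul_assoc (√2 * √Γ.rank)]
      exact mul_le_mul_of_nonneg_left (frobNorm_le_normL2 hm hX hs hmin Δ) (by positivity)
    -- Penalty 1/4 against curvature 7/25 − 1/50 = 13/50: this narrow gap gives the strict
    -- inequality for localization.
    · rw [← mul_assoc]
      have := mul_le_mul_of_nonneg_right hl ht.le
      nlinarith

end Bounds

end MQR

end

theorem mainTheorem2 :
    ∃ C' : ℝ, 0 < C' ∧ MQR.IsHoeffdingConst C' ∧
      ∀ (n p m : ℕ) (_ : 0 < n) (_ : 0 < m) (_ : 3 < p + m)
        (τ : ℝ) (_ : 0 < τ) (_ : τ < 1)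
        -- joint law of the covariates and the responses
        (P : Measure ((Fin p → ℝ) × (Fin m → ℝ))) [IsProbabilityMeasure P]
        (Γ : Matrix (Fin p) (Fin m) ℝ)
        -- the sample
        {Ω : Type*} [MeasurableSpace Ω] (μ : Measure Ω) [IsProbabilityMeasure μ]
        (X : Fin n → Ω → Fin p → ℝ) (Y : Fin n → Ω → Fin m → ℝ)
        (_ : ∀ i, HasLaw (fun ω => (X i ω, Y i ω)) P μ)
        (_ : iIndepFun (fun i ω => (X i ω, Y i ω)) μ)
        (_ : MQR.LinearQuantiles P τ Γ)
        (_ : MQR.CondIndepResponses P)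
        -- covariance condition
        (_ : ∀ a, MemLp (fun x : Fin p → ℝ => x a) 2 P.fst)
        (_ : 0 < MQR.sigmaMin (MQR.covMat P.fst))
        (c₁ c₂ γ : ℝ) (_ : 0 < c₁) (_ : 1 ≤ c₂)
        (_ : 1 - γ ≤ μ.real {ω |
          c₁ * MQR.sigmaMin (MQR.covMat P.fst) ≤ MQR.sigmaMin (MQR.sampleCov fun i => X i ω) ∧
          MQR.sigmaMax (MQR.sampleCov fun i => X i ω) ≤ c₂ * MQR.sigmaMax (MQR.covMat P.fst)})
        -- conditional density condition
        (fLow fDer : ℝ) (_ : 0 < fLow) (_ : MQR.DensityCondition P Γ fLow fDer)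
        -- growth condition on the rank
        (_ : ENNReal.ofReal (MQR.CTau C' c₂ τ / (fLow * √m) *
            √(MQR.sigmaMax (MQR.covMat P.fst) / MQR.sigmaMin (MQR.covMat P.fst)) *
            √(max τ (1 - τ)) * MQR.rate n p m * √Γ.rank) < MQR.nonlinConst P.fst Γ fLow fDer)
        -- the estimator
        (Γhat : Ω → Matrix (Fin p) (Fin m) ℝ)
        (_ : ∀ᵐ ω ∂μ, MQR.IsEstimator τ (MQR.lam C' c₂ τ n p m (MQR.covMat P.fst))
          (fun i => X i ω) (fun i => Y i ω) (Γhat ω)),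
        ∃ A : Set Ω, MeasurableSet A ∧
          1 - γ - 9 * (((p : ℝ) + m) ^ 2)⁻¹ - 3 * Real.exp (-(((p : ℝ) + m) * Real.log 8))
            ≤ μ.real A ∧
          ∀ ω ∈ A,
            MQR.normL2 P.fst (Γhat ω - Γ) ≤ MQR.CTau C' c₂ τ / (fLow * √m) *
              √(MQR.sigmaMax (MQR.covMat P.fst) / MQR.sigmaMin (MQR.covMat P.fst)) *
              √(max τ (1 - τ)) * √Γ.rank * MQR.rate n p m ∧
            MQR.frobNorm (Γhat ω - Γ) ≤ MQR.CTau C' c₂ τ / fLow *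
              √(MQR.sigmaMax (MQR.covMat P.fst) / MQR.sigmaMin (MQR.covMat P.fst) ^ 2) *
              √(max τ (1 - τ)) * √Γ.rank * MQR.rate n p m ∧
            MQR.nuclearNorm (Γhat ω - Γ) ≤ 4 * √2 * MQR.CTau C' c₂ τ / fLow *
              √(MQR.sigmaMax (MQR.covMat P.fst) / MQR.sigmaMin (MQR.covMat P.fst) ^ 2) *
              √(max τ (1 - τ)) * Γ.rank * MQR.rate n p m := by
  -- Far below the admissible 1/56: a small C' raises λ and the radius until all numerical losses in
  -- the deviation bounds fit.
  refine ⟨1 / 10000, by norm_num, MQR.isHoeffdingConst_of_le (by norm_num), ?_⟩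
  intro n p m hn hm _ τ h0 h1 P _ Γ Ω _ μ _ X Y hlaw hind hquant hci hX hs c₁ c₂ γ _ hc hcov fLow
    fDer hf hdens hν Γhat hest
  have hcov' := hcov.trans (measureReal_mono (μ := μ) fun ω hω => hω.2)
  obtain ⟨A, hAm, hAP, hA⟩ := MQR.exists_error_event hn hm h0 h1 hlaw hind hquant hci hX hs
    (by norm_num) le_rfl hc hcov' hf hdens hν hest
  refine ⟨A, hAm, ?_, fun ω hω => ?_⟩
  · have : 0 ≤ 9 * (((p : ℝ) + m) ^ 2)⁻¹ := by positivity
    linarith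
  · exact MQR.error_bounds hm hX hf hs (hs.trans_le (MQR.sigmaMin_le_sigmaMax _))
      (MQR.sigmaMin_covMat_le P.fst hX) (hA ω hω).1 (hA ω hω).2
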